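/- Fix $\lambda>0$, $\mu>1$, $c>0$, $m\in(-1,1)$. Let $N$ be a Poisson process with rate $\mu$ on a probability space, with jump times $\sigma_1<\sigma_2<\dots$, and let $\mathbb F$ be its natural filtration, augmented by the null sets and made right-continuous. For $(\phi_0,\phi_1)\in\mathbb R_+^2$ let $x(\cdot,\phi_0)$, $y(\cdot,\phi_1)$ solve $$x'=(\lambda+1)x+\tfrac{\lambda(1-m)}{\sqrt2},\quad x(0)=\phi_0,\qquad y'=(\lambda-1)y+\tfrac{\lambda(1+m)}{\sqrt2},\quad y(0)=\phi_1,$$ let $S(\phi_0,\phi_1)=\big((1-\tfrac1\mu)\phi_0,(1+\tfrac1\mu)\phi_1\big)$, and let $\tilde\Phi$ be the process started at $(\phi_0,\phi_1)$ that follows the flow $(x,y)$ between the jumps of $N$ and is moved by $S$ at each jump of $N$. With $g(\phi_0,\phi_1)=\phi_0+\phi_1-\frac{\lambda}{c}\sqrt2$, define $$V(\phi_0,\phi_1)=\inf_{\tau}\mathbb E^{\phi_0,\phi_1}\Big[\int_0^\tau e^{-\lambda t}g(\tilde\Phi_t)\,dt\Big],\qquad V_n(\phi_0,\phi_1)=\inf_{\tau}\mathbb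 E^{\phi_0,\phi_1}\Big[\int_0^{\tau\wedge\sigma_n} e^{-\lambda t}g(\tilde\Phi_t)\,dt\Big],$$ the infima being over all $\mathbb F$-stopping times $\tau$ with values in $[0,\infty]$. Define also $v_0\equiv0$ and $$v_{n+1}(\phi_0,\phi_1)=\inf_{t\in[0,\infty]}\mathbb E^{\phi_0,\phi_1}\Big[\int_0^{t\wedge\sigma_1}e^{-\lambda u}g(\tilde\Phi_u)\,du+\mathbf 1_{\{t\ge\sigma_1\}}e^{-\lambda\sigma_1}v_n(\tilde\Phi_{\sigma_1})\Big],\qquad v=\lim_{n\to\infty} v_n,$$ and, for $n\ge1$, $$\Gamma_n=\{v_n=0\},\quad C_n=\mathbb R_+^2\setminus\Gamma_n,\quad \Gamma=\{v=0\},\quad C=\mathbb R_+^2\setminus\Gamma,$$ $$\gamma_n(x)=\inf\{y\ge0:(x,y)\in\Gamma_n\},\qquad \gamma(x)=\inf\{y\ge0:(x,y)\in\Gamma\},\qquad x\ge 0.$$ For $R\subseteq\mathbb R_+^2$ let $S^{-n}(R)=\{p\in\mathbb R_+^2: S^n p\in R\}$, and for $f:\mathbb R_+\to\mathbb R_+$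 let $S^{-n}[f](x)=\inf\{y\ge0:(x,y)\in S^{-n}(\operatorname{epi} f)\}$, where $\operatorname{epi} f=\{(x,y)\in\mathbb R_+^2:y\ge f(x)\}$, and $x_n(f)=\min\{x\ge0:S^{-n}[f](x)=f(x)\}$ when this minimum exists. Assume that for every $n\ge1$, every $(\phi_0,\phi_1)\in S^{-n}(\Gamma)$ and every $t\ge0$ we have $(x(t,\phi_0),y(t,\phi_1))\in S^{-n}(\Gamma)$. Then: 1. For all $k\ge n\ge1$: $V=V_k$ on $S^{-n}(\Gamma)$, $\;S^{-n}(\Gamma)\cap\Gamma=S^{-n}(\Gamma)\cap\Gamma_k$, and $S^{-n}(\Gamma)\cap C=S^{-n}(\Gamma)\cap C_k$. 2. For every $n\ge1$ the number $x_n:=x_n(\gamma)$ exists and lies in $(0,\infty)$. For every $k\ge n$, the number $x_n(\gamma_k)$ exists and equals $x_n$, $$S^{-n}(\Gamma)\cap C\cap([0,x_n]\times\mathbb R_+)=S^{-n}(\Gamma_k)\cap C_k\cap([0,x_n]\times\mathbb R_+),$$ and $\gamma=\gamma_k$ on $[0,x_n]$. Moreover $V=V_n$ on $S^{-n}(\Gamma_n)\cap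 C_n\cap([0,x_n]\times\mathbb R_+)$. 3. For every $B>0$ there is $n\ge1$ with $\big(\frac{\mu}{\mu+1}\big)^n\gamma_1(0)<B$, and for every such $n$ and every $k\ge n$ we have $V=V_k=v_k$ on $\mathbb R_+\times[B,\infty)$ and $(\mathbb R_+\times[B,\infty))\cap C=(\mathbb R_+\times[B,\infty))\cap C_k$. -/

import Mathlib

open MeasureTheory ProbabilityTheory Filter Topology Set
open scoped NNReal ENNReal

namespace PoissonDisorder

/-- The standing parameters: `lam` is the rate of the exponential prior of the disorder time, `mu` is
the pre-disorder arrival rate, `c` is the cost of delay per unit time, and `m` is the mean of the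
Bernoulli distributed change of the rate, which is `+1` or `-1`. -/
structure Params where
  lam : ℝ
  mu : ℝ
  c : ℝ
  m : ℝ
  lam_pos : 0 < lam
  one_lt_mu : 1 < mu
  c_pos : 0 < c
  neg_one_lt_m : -1 < m
  m_lt_one : m < 1

/-- A homogeneous Poisson process with rate `mu` on the probability space `(Ω, P)`, given by its
interarrival times, which are positive, independent and exponentially distributed with rate `mu`;
only finitely many arrivals happen in a bounded time interval. -/
structure PoissonProcess {Ω : Type*} [MeasurableSpace Ω] (P : Measure Ω) (mu : ℝ) where
  /-- `gap n` is the time between the `n`-th and the `(n+1)`-st arrival. -/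
  gap : ℕ → Ω → ℝ
  measurable_gap : ∀ n, Measurable (gap n)
  gap_pos : ∀ n ω, 0 < gap n ω
  tendsto_sum_gap : ∀ ω, Tendsto (fun n => ∑ i ∈ Finset.range n, gap i ω) atTop atTop
  indep_gap : iIndepFun gap P
  law_gap : ∀ n, P.map (gap n) = expMeasure mu

namespace PoissonProcess

variable {Ω : Type*} [MeasurableSpace Ω] {P : Measure Ω} {mu : ℝ}

/-- The `n`-th jump time `σ_n`, with `σ_0 = 0`. -/
def jumpTime (N : PoissonProcess P mu) (n : ℕ) (ω : Ω) : ℝ :=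
  ∑ i ∈ Finset.range n, N.gap i ω

/-- The number `N_t` of arrivals in `[0, t]`: the largest `n` with `σ_n ≤ t`. -/
noncomputable def count (N : PoissonProcess P mu) (t : ℝ) (ω : Ω) : ℕ :=
  sSup {n : ℕ | N.jumpTime n ω ≤ t}

theorem le_count_iff (N : PoissonProcess P mu) {t : ℝ} (ht : 0 ≤ t) (n : ℕ) (ω : Ω) :
    n ≤ N.count t ω ↔ N.jumpTime n ω ≤ t := by
  have hmono : Monotone fun n => N.jumpTime n ω := monotone_nat_of_le_succ fun n => by
    simp only [jumpTime, Finset.sum_range_succ]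
    linarith [N.gap_pos n ω]
  have hne : {n : ℕ | N.jumpTime n ω ≤ t}.Nonempty := ⟨0, by simpa [jumpTime] using ht⟩
  have hbdd : BddAbove {n : ℕ | N.jumpTime n ω ≤ t} := by
    obtain ⟨b, hb⟩ := ((N.tendsto_sum_gap ω).eventually_gt_atTop t).exists
    refine ⟨b, fun k hk => ?_⟩
    by_contra! hlt
    have h1 : N.jumpTime b ω ≤ N.jumpTime k ω := hmono hlt.le
    have h2 : t < N.jumpTime b ω := hb
    exact absurd (h2.trans_le h1) (not_lt.mpr hk)
  constructor
  · intro h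
    exact (hmono h).trans (Nat.sSup_mem hne hbdd)
  · intro h
    exact le_csSup hbdd h

theorem measurable_jumpTime (N : PoissonProcess P mu) (n : ℕ) : Measurable (N.jumpTime n) :=
  Finset.measurable_sum _ fun i _ => N.measurable_gap i

theorem measurable_count (N : PoissonProcess P mu) {t : ℝ} (ht : 0 ≤ t) :
    Measurable (N.count t) := by
  refine measurable_of_Ici fun n => ?_
  have : N.count t ⁻¹' Ici n = N.jumpTime n ⁻¹' Iic t := by
    ext ω
    exact N.le_count_iff ht n ω
  rw [this]
  exact N.measurable_jumpTime n measurableSet_Iic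

/-- The observation filtration `𝔽`: the natural filtration `σ(N_s; 0 ≤ s ≤ t)` of the Poisson process,
augmented by the `P`-null sets and made right-continuous. -/
noncomputable def filtration (N : PoissonProcess P mu) :
    Filtration ℝ≥0 (inferInstance : MeasurableSpace Ω) :=
  (Filtration.natural (fun (t : ℝ≥0) => N.count t)
      (fun t => (N.measurable_count t.coe_nonneg).stronglyMeasurable) ⊔
    Filtration.const ℝ≥0
      (MeasurableSpace.generateFrom {A : Set Ω | MeasurableSet A ∧ P A = 0})
      (MeasurableSpace.generateFrom_le fun _ hA => hA.1)).rightCont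

end PoissonProcess

/-- The state space `ℝ₊²`. -/
def quadrant : Set (ℝ × ℝ) := {p | 0 ≤ p.1 ∧ 0 ≤ p.2}

namespace Params

variable (M : Params)

/-- The solution `x(t, φ₀)` of `x' = (λ + 1) x + λ (1 - m) / √2`, `x(0) = φ₀`. -/
noncomputable def flowX (t φ₀ : ℝ) : ℝ :=
  -(M.lam * (1 - M.m) / (√2 * (M.lam + 1))) +
    Real.exp ((M.lam + 1) * t) * (φ₀ + M.lam * (1 - M.m) / (√2 * (M.lam + 1)))

open Classical in
/-- The solution `y(t, φ₁)` of `y' = (λ - 1) y + λ (1 + m) / √2`, `y(0) = φ₁`. -/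
noncomputable def flowY (t φ₁ : ℝ) : ℝ :=
  if M.lam = 1 then φ₁ + (1 + M.m) / √2 * t
  else -(M.lam * (1 + M.m) / (√2 * (M.lam - 1))) +
    Real.exp ((M.lam - 1) * t) * (φ₁ + M.lam * (1 + M.m) / (√2 * (M.lam - 1)))

/-- The deterministic motion of the sufficient statistic between two jumps. -/
noncomputable def flow (t : ℝ) (p : ℝ × ℝ) : ℝ × ℝ := (M.flowX t p.1, M.flowY t p.2)

/-- The jump map `S(φ₀, φ₁) = ((1 - 1/μ) φ₀, (1 + 1/μ) φ₁)`. -/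
noncomputable def jump (p : ℝ × ℝ) : ℝ × ℝ := ((1 - 1 / M.mu) * p.1, (1 + 1 / M.mu) * p.2)

/-- The running cost `g(φ₀, φ₁) = φ₀ + φ₁ - (λ / c) √2`. -/
noncomputable def g (p : ℝ × ℝ) : ℝ := p.1 + p.2 - M.lam / M.c * √2

variable {Ω : Type*} [MeasurableSpace Ω] {P : Measure Ω} (N : PoissonProcess P M.mu)

/-- The state right after the `n`-th jump, when the initial state is `p`. -/
noncomputable def postJump (p : ℝ × ℝ) : ℕ → Ω → ℝ × ℝ
  | 0, _ => p
  | n + 1, ω => M.jump (M.flow (N.gap n ω) (postJump p n ω))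

/-- The sufficient statistic started at `p`: the piecewise deterministic process which follows the
flow between the jumps of `N` and is moved by the map `S` at each jump of `N`. It is the solution of
`dΦ⁰ = ((λ + 1) Φ⁰ + λ (1 - m) / √2) dt - μ⁻¹ Φ⁰₋ dN`,
`dΦ¹ = ((λ - 1) Φ¹ + λ (1 + m) / √2) dt + μ⁻¹ Φ¹₋ dN` with the initial state `p`. -/
noncomputable def Phi (p : ℝ × ℝ) (t : ℝ) (ω : Ω) : ℝ × ℝ :=
  M.flow (t - N.jumpTime (N.count t ω) ω) (M.postJump N p (N.count t ω) ω)

/-- The expected cost `E [∫₀^τ e^{-λ t} g(Φ_t) dt]` of a `[0, ∞]`-valued random time, for the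
initial state `p`. It is the expectation of the positive part of the integrand (possibly infinite)
minus that of the negative part (always at most `√2 / c`). -/
noncomputable def cost (p : ℝ × ℝ) (τ : Ω → WithTop ℝ≥0) : EReal :=
  ((∫⁻ ω, (∫⁻ t in {t : ℝ | 0 ≤ t ∧ (t.toNNReal : WithTop ℝ≥0) < τ ω},
      ENNReal.ofReal (Real.exp (-M.lam * t) * M.g (M.Phi N p t ω))) ∂P : ℝ≥0∞) : EReal) -
  ((∫⁻ ω, (∫⁻ t in {t : ℝ | 0 ≤ t ∧ (t.toNNReal : WithTop ℝ≥0) < τ ω},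
      ENNReal.ofReal (-(Real.exp (-M.lam * t) * M.g (M.Phi N p t ω)))) ∂P : ℝ≥0∞) : EReal)

/-- The value function `V` of the optimal stopping problem, an infimum over all stopping times of the
observation filtration. -/
noncomputable def V (p : ℝ × ℝ) : EReal :=
  ⨅ (τ : Ω → WithTop ℝ≥0) (_ : IsStoppingTime N.filtration τ), M.cost N p τ

/-- The value function `V_n` of the problem that is stopped at the `n`-th jump time. -/
noncomputable def Vn (n : ℕ) (p : ℝ × ℝ) : EReal :=
  ⨅ (τ : Ω → WithTop ℝ≥0) (_ : IsStoppingTime N.filtration τ),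
    M.cost N p fun ω => min (τ ω) ((N.jumpTime n ω).toNNReal : WithTop ℝ≥0)

open Classical in
/-- The single-jump operator `Jw(t, φ₀, φ₁)`, `t ∈ [0, ∞]`: the expectation of
`∫₀^{t ∧ σ₁} e^{-λ u} g(Φ_u) du + 1_{t ≥ σ₁} e^{-λ σ₁} w(Φ_{σ₁})`. -/
noncomputable def J (w : ℝ × ℝ → ℝ) (t : ℝ≥0∞) (p : ℝ × ℝ) : ℝ :=
  ∫ ω, ((∫ u in (0 : ℝ)..(min t (ENNReal.ofReal (N.jumpTime 1 ω))).toReal,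
      Real.exp (-M.lam * u) * M.g (M.Phi N p u ω)) +
    if ENNReal.ofReal (N.jumpTime 1 ω) ≤ t then
      Real.exp (-M.lam * N.jumpTime 1 ω) * w (M.Phi N p (N.jumpTime 1 ω) ω) else 0) ∂P

/-- `J₀w(φ₀, φ₁) = inf_{t ∈ [0, ∞]} Jw(t, φ₀, φ₁)`. -/
noncomputable def J0 (w : ℝ × ℝ → ℝ) (p : ℝ × ℝ) : ℝ := ⨅ t : ℝ≥0∞, M.J N w t p

/-- The iterates `v_0 = 0`, `v_{n+1} = J₀ v_n`. -/
noncomputable def vn : ℕ → ℝ × ℝ → ℝ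
  | 0 => fun _ => 0
  | n + 1 => M.J0 N (vn n)

/-- The limit `v` of the iterates `v_n`. -/
noncomputable def v (p : ℝ × ℝ) : ℝ := limUnder atTop fun n => M.vn N n p

/-- The stopping region `Γ_n` and the continuation region `C_n`. -/
def Gamman (n : ℕ) : Set (ℝ × ℝ) := {p ∈ quadrant | M.vn N n p = 0}

def Cn (n : ℕ) : Set (ℝ × ℝ) := quadrant \ M.Gamman N n

/-- The optimal stopping region `Γ` and the optimal continuation region `C`. -/
def Gamma : Set (ℝ × ℝ) := {p ∈ quadrant | M.v N p = 0}

def C : Set (ℝ × ℝ) := quadrant \ M.Gamma N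

/-- The boundary functions `γ_n(x) = inf {y ≥ 0 : (x, y) ∈ Γ_n}` and
`γ(x) = inf {y ≥ 0 : (x, y) ∈ Γ}`. -/
noncomputable def gamman (n : ℕ) (x : ℝ) : ℝ := sInf {y : ℝ | 0 ≤ y ∧ (x, y) ∈ M.Gamman N n}

noncomputable def gamma (x : ℝ) : ℝ := sInf {y : ℝ | 0 ≤ y ∧ (x, y) ∈ M.Gamma N}

/-- The set `S^{-n}(R)`, where `S^{-1}(R) = {p ∈ ℝ₊² : S p ∈ R}`. -/
def preim (n : ℕ) (R : Set (ℝ × ℝ)) : Set (ℝ × ℝ) :=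
  (fun A : Set (ℝ × ℝ) => {p ∈ quadrant | M.jump p ∈ A})^[n] R

/-- The function `S^{-n}[f] : x ↦ inf {y ≥ 0 : (x, y) ∈ S^{-n}(epi f)}`. -/
noncomputable def preimFun (n : ℕ) (f : ℝ → ℝ) (x : ℝ) : ℝ :=
  sInf {y : ℝ | 0 ≤ y ∧ (x, y) ∈ M.preim n {p ∈ quadrant | f p.1 ≤ p.2}}

/-- `x` is the number `x_n(f) = min {x ≥ 0 : S^{-n}[f](x) = f(x)}` (the minimum exists). -/
def IsFirstCrossing (n : ℕ) (f : ℝ → ℝ) (x : ℝ) : Prop :=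
  IsLeast {x : ℝ | 0 ≤ x ∧ M.preimFun n f x = f x} x

/-- The closedness condition: the deterministic flow cannot leave any `S^{-n}(Γ)`, `n ≥ 1`. -/
def FlowClosed : Prop :=
  ∀ n : ℕ, 1 ≤ n → ∀ p ∈ M.preim n (M.Gamma N), ∀ t : ℝ, 0 ≤ t →
    M.flow t p ∈ M.preim n (M.Gamma N)

end Params

end PoissonDisorder

/-! The heart is a squeeze. On the whole quadrant `v ≤ V ≤ V_k ≤ v_k`, and on `S^{-n}(Γ)` with `k ≥
n` the two ends coincide.

The ends coincide by induction on `n` (`vn_eq_of_mem_preim`). On `Γ` every iterate vanishes. A state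
of `S^{-(n+1)}(Γ)` stays there along the flow by hypothesis, so the first jump lands in `S^{-n}(Γ)`.
Since `J w` sees `w` only at states just after a jump, `v_{k+1} = v_{n+1}` there as soon as `v_k =
v_n` on `S^{-n}(Γ)`.

The inequality `v ≤ V` (`v_le_V`) holds because a stopping time is almost surely a function of the
interarrival times that depends on the past only. Before the first jump such a time is
deterministic, and after it the problem restarts from the new state. Induction on the number of
jumps bounds the cost up to the `n`-th jump by `v_n` from below, and monotone convergence removes
the truncation. The inequality `V_k ≤ v_k` (`Vn_le_vn`) comes from measurably chosen ε-optimal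
waiting times, used one after another. Expected costs are differences of two `[0, ∞]`-valued
integrals, the negative one being at most `kap`, so most estimates are additive inequalities in
`ℝ≥0∞`.

The rest is plane geometry. The iterates are monotone, concave and nonpositive, so `Γ` and `Γ_n` are
closed, convex and upward closed; they miss the origin and meet both axes (`IsUpRegion`). Their
boundary functions are therefore continuous, nonincreasing, positive at `0` and zero far out, and
the intermediate value theorem yields a positive first crossing (`exists_isFirstCrossing`). Left of
the crossing, the part of the strip near the graph of `γ` lies in `S^{-n}(Γ)`, where `Γ` and `Γ_k`
agree, which forces `γ = γ_k` (`boundary_eq_of_inter_eq`). Finally `n` jumps multiply the second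
coordinate by `(1 + 1/μ)^n`, which lifts the half-plane above `B` over the level `γ(0) = γ_1(0)`
(`strip_subset_preim`). -/

namespace PoissonDisorder

/-! ### The exponential distribution -/

section Exponential

variable {r : ℝ}

theorem lintegral_expMeasure {f : ℝ → ℝ≥0∞} (hf : Measurable f) :
    ∫⁻ a, f a ∂expMeasure r = ∫⁻ a in Ici 0, ENNReal.ofReal (r * Real.exp (-(r * a))) * f a := by
  have h1 : expMeasure r = volume.withDensity (exponentialPDF r) := rfl
  have h2 : Measurable (exponentialPDF r) :=
    (measurable_exponentialPDFReal r).ennreal_ofReal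
  rw [h1, lintegral_withDensity_eq_lintegral_mul _ h2 hf, ← lintegral_indicator measurableSet_Ici]
  refine lintegral_congr fun a => ?_
  by_cases ha : 0 ≤ a
  · rw [indicator_of_mem (by exact ha), Pi.mul_apply, exponentialPDF_of_nonneg ha]
  · rw [indicator_of_notMem (by exact ha), Pi.mul_apply, exponentialPDF_of_neg (not_le.mp ha),
      zero_mul]

/-- Lets measurability be checked on positive times only, where the flow stays in the quadrant and
the iterates are continuous. -/
theorem expMeasure_absolutelyContinuous : expMeasure r ≪ volume.restrict (Ioi (0 : ℝ)) := by
  refine Measure.AbsolutelyContinuous.mk fun s hs h0 => ?_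
  have h1 : ∀ᵐ a ∂volume.restrict (Ioi (0 : ℝ)), a ∉ s := measure_eq_zero_iff_ae_notMem.1 h0
  rw [← lintegral_indicator_one hs, lintegral_expMeasure (measurable_one.indicator hs),
    ← Measure.restrict_congr_set Ioi_ae_eq_Ici]
  refine (lintegral_congr_ae (h1.mono fun a ha => ?_)).trans lintegral_zero
  simp [indicator_of_notMem ha]

theorem ae_expMeasure_pos : ∀ᵐ a ∂expMeasure r, 0 < a :=
  expMeasure_absolutelyContinuous.ae_le (ae_restrict_mem measurableSet_Ioi)

/-- Provides the integrable majorant `e^{σ₁}` of all one-jump costs; its finiteness is exactly `μ >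
1`. -/
theorem integrable_exp_expMeasure (hr : 1 < r) : Integrable Real.exp (expMeasure r) := by
  refine ⟨by fun_prop, ?_⟩
  rw [hasFiniteIntegral_iff_ofReal (Eventually.of_forall fun _ => (Real.exp_pos _).le),
    lintegral_expMeasure (by fun_prop)]
  have h : IntegrableOn (fun a => r * Real.exp (-(r - 1) * a)) (Ici 0) :=
    ((integrableOn_Ici_iff_integrableOn_Ioi).2
      (integrableOn_exp_mul_Ioi (by linarith) 0)).const_mul r
  refine lt_of_le_of_lt (le_of_eq ?_) h.lintegral_lt_top
  refine lintegral_congr fun a => ?_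
  rw [← ENNReal.ofReal_mul (by positivity), mul_assoc, ← Real.exp_add]
  ring_nf

end Exponential

namespace Params

variable (M : Params)

/-! ### The flow and the jumps -/

theorem mu_pos : 0 < M.mu := by linarith [M.one_lt_mu]

theorem inv_mu_pos : 0 < 1 / M.mu := one_div_pos.2 M.mu_pos

theorem inv_mu_lt_one : 1 / M.mu < 1 := by
  rw [div_lt_one M.mu_pos]; exact M.one_lt_mu

theorem flowX_eq (t x : ℝ) : M.flowX t x = M.flowX t 0 + Real.exp ((M.lam + 1) * t) * x := by
  unfold flowX; ring

theorem flowY_eq (t y : ℝ) : M.flowY t y = M.flowY t 0 + Real.exp ((M.lam - 1) * t) * y := by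
  unfold flowY
  split_ifs with h
  · simp [h]; ring
  · ring

theorem continuous_flowX : Continuous fun q : ℝ × ℝ => M.flowX q.1 q.2 := by
  unfold flowX; fun_prop

theorem continuous_flowY : Continuous fun q : ℝ × ℝ => M.flowY q.1 q.2 := by
  unfold flowY
  split_ifs <;> fun_prop

@[fun_prop]
theorem continuous_flow {X : Type*} [TopologicalSpace X] {f : X → ℝ} {p : X → ℝ × ℝ}
    (hf : Continuous f) (hp : Continuous p) : Continuous fun x => M.flow (f x) (p x) :=
  (M.continuous_flowX.comp (hf.prodMk hp.fst)).prodMk (M.continuous_flowY.comp (hf.prodMk hp.snd))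

@[fun_prop]
theorem measurable_flow {X : Type*} [MeasurableSpace X] {f : X → ℝ} {p : X → ℝ × ℝ}
    (hf : Measurable f) (hp : Measurable p) : Measurable fun x => M.flow (f x) (p x) :=
  (M.continuous_flow continuous_fst continuous_snd).measurable.comp (hf.prodMk hp)

@[fun_prop]
theorem continuous_jump : Continuous M.jump := by
  unfold jump; fun_prop

@[fun_prop]
theorem measurable_jump : Measurable M.jump := M.continuous_jump.measurable

@[fun_prop]
theorem continuous_g : Continuous M.g := by
  unfold g; fun_prop

@[fun_prop]
theorem measurable_g : Measurable M.g := M.continuous_g.measurable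

theorem flowX_zero_eq (t : ℝ) : M.flowX t 0 =
    M.lam * (1 - M.m) / (√2 * (M.lam + 1)) * (Real.exp ((M.lam + 1) * t) - 1) := by
  unfold flowX; ring

theorem flowX_zero_nonneg {t : ℝ} (ht : 0 ≤ t) : 0 ≤ M.flowX t 0 := by
  have h1 := M.lam_pos
  have h2 := M.m_lt_one
  rw [flowX_zero_eq]
  refine mul_nonneg (div_nonneg (mul_nonneg h1.le (by linarith)) (by positivity)) ?_
  have := Real.add_one_le_exp ((M.lam + 1) * t)
  have : 0 ≤ (M.lam + 1) * t := by positivity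
  linarith

theorem flowY_zero_nonneg {t : ℝ} (ht : 0 ≤ t) : 0 ≤ M.flowY t 0 := by
  have h1 := M.lam_pos
  have h2 := M.neg_one_lt_m
  unfold flowY
  split_ifs with h
  · have : 0 ≤ (1 + M.m) / √2 := div_nonneg (by linarith) (by positivity)
    simpa using mul_nonneg this ht
  · have e : -(M.lam * (1 + M.m) / (√2 * (M.lam - 1))) +
        Real.exp ((M.lam - 1) * t) * (0 + M.lam * (1 + M.m) / (√2 * (M.lam - 1))) =
        M.lam * (1 + M.m) / √2 * ((Real.exp ((M.lam - 1) * t) - 1) / (M.lam - 1)) := by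
      have : M.lam - 1 ≠ 0 := sub_ne_zero.2 h
      field_simp
      ring
    rw [e]
    refine mul_nonneg (div_nonneg (mul_nonneg h1.le (by linarith)) (by positivity)) ?_
    rcases lt_or_gt_of_ne h with h' | h'
    · refine div_nonneg_of_nonpos ?_ (by linarith)
      have : Real.exp ((M.lam - 1) * t) ≤ 1 :=
        Real.exp_le_one_iff.2 (mul_nonpos_of_nonpos_of_nonneg (by linarith) ht)
      linarith
    · refine div_nonneg ?_ (by linarith)
      have : 1 ≤ Real.exp ((M.lam - 1) * t) :=
        Real.one_le_exp (mul_nonneg (by linarith) ht)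
      linarith

theorem flow_mem {p : ℝ × ℝ} (hp : p ∈ quadrant) {t : ℝ} (ht : 0 ≤ t) :
    M.flow t p ∈ quadrant := by
  constructor
  · change 0 ≤ M.flowX t p.1
    rw [flowX_eq]
    have := M.flowX_zero_nonneg ht
    have := mul_nonneg (Real.exp_pos ((M.lam + 1) * t)).le hp.1
    linarith
  · change 0 ≤ M.flowY t p.2
    rw [flowY_eq]
    have := M.flowY_zero_nonneg ht
    have := mul_nonneg (Real.exp_pos ((M.lam - 1) * t)).le hp.2
    linarith

theorem jump_mem {p : ℝ × ℝ} (hp : p ∈ quadrant) : M.jump p ∈ quadrant :=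
  ⟨mul_nonneg (by linarith [M.inv_mu_lt_one]) hp.1,
    mul_nonneg (by linarith [M.inv_mu_pos]) hp.2⟩

theorem exists_flow_zero_le : ∃ K : ℝ, 0 ≤ K ∧ ∀ t : ℝ, 0 ≤ t →
    M.flowX t 0 + M.flowY t 0 ≤ K * Real.exp ((M.lam + 1) * t) := by
  have hl := M.lam_pos
  have hX : ∃ K : ℝ, 0 ≤ K ∧ ∀ t : ℝ, 0 ≤ t →
      M.flowX t 0 ≤ K * Real.exp ((M.lam + 1) * t) := by
    refine ⟨|M.lam * (1 - M.m) / (√2 * (M.lam + 1))|, abs_nonneg _, fun t ht => ?_⟩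
    rw [flowX_zero_eq]
    have : 0 ≤ Real.exp ((M.lam + 1) * t) - 1 := by
      have : 0 ≤ (M.lam + 1) * t := by positivity
      linarith [Real.one_le_exp this]
    refine (mul_le_mul_of_nonneg_right (le_abs_self _) this).trans ?_
    exact mul_le_mul_of_nonneg_left (by linarith) (abs_nonneg _)
  have hY : ∃ K : ℝ, 0 ≤ K ∧ ∀ t : ℝ, 0 ≤ t →
      M.flowY t 0 ≤ K * Real.exp ((M.lam + 1) * t) := by
    unfold flowY
    split_ifs with h
    · refine ⟨|(1 + M.m) / √2|, abs_nonneg _, fun t ht => ?_⟩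
      rw [zero_add]
      refine (mul_le_mul_of_nonneg_right (le_abs_self _) ht).trans ?_
      refine mul_le_mul_of_nonneg_left ?_ (abs_nonneg _)
      have := Real.add_one_le_exp ((M.lam + 1) * t)
      nlinarith
    · refine ⟨2 * |M.lam * (1 + M.m) / (√2 * (M.lam - 1))|, by positivity, fun t ht => ?_⟩
      set K := M.lam * (1 + M.m) / (√2 * (M.lam - 1))
      have h1 : Real.exp ((M.lam - 1) * t) ≤ Real.exp ((M.lam + 1) * t) :=
        Real.exp_le_exp.2 (by nlinarith)
      have h2 : 1 ≤ Real.exp ((M.lam + 1) * t) := Real.one_le_exp (by positivity)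
      have h3 := neg_abs_le K
      have h4 := le_abs_self K
      have h5 := Real.exp_pos ((M.lam - 1) * t)
      nlinarith [abs_nonneg K]
  obtain ⟨A, hA, hA'⟩ := hX
  obtain ⟨B, hB, hB'⟩ := hY
  exact ⟨A + B, by positivity, fun t ht => by linarith [hA' t ht, hB' t ht]⟩

/-- The lower bound `-√2 / c` of the value functions, up to the sign. -/
noncomputable def kap : ℝ := √2 / M.c

theorem kap_pos : 0 < M.kap := div_pos (by positivity) M.c_pos

theorem g_eq (p : ℝ × ℝ) : M.g p = p.1 + p.2 - M.lam * M.kap := by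
  unfold g kap; ring

theorem neg_le_g {p : ℝ × ℝ} (hp : p ∈ quadrant) : -(M.lam * M.kap) ≤ M.g p := by
  rw [g_eq]; linarith [hp.1, hp.2]

/-- The flow grows at most like `e^{(λ+1)t}`, and the discount leaves `e^t`. -/
theorem exists_abs_g_flow_le {p : ℝ × ℝ} (hp : p ∈ quadrant) : ∃ K : ℝ, 0 ≤ K ∧ ∀ t : ℝ, 0 ≤ t →
    |Real.exp (-M.lam * t) * M.g (M.flow t p)| ≤ K * Real.exp t := by
  obtain ⟨K, hK, h⟩ := M.exists_flow_zero_le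
  have hl := M.lam_pos
  have hk := M.kap_pos
  have hp1 := hp.1
  have hp2 := hp.2
  refine ⟨K + p.1 + p.2 + M.lam * M.kap, by positivity, fun t ht => ?_⟩
  have e : Real.exp t = Real.exp (-M.lam * t) * Real.exp ((M.lam + 1) * t) := by
    rw [← Real.exp_add]; ring_nf
  rw [abs_mul, abs_of_pos (Real.exp_pos _), e, mul_left_comm]
  refine mul_le_mul_of_nonneg_left ?_ (Real.exp_pos _).le
  have h1 : Real.exp ((M.lam - 1) * t) ≤ Real.exp ((M.lam + 1) * t) :=
    Real.exp_le_exp.2 (by nlinarith)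
  have h2 : 1 ≤ Real.exp ((M.lam + 1) * t) := Real.one_le_exp (by positivity)
  have h3 := M.neg_le_g (M.flow_mem hp ht)
  have h4 : 0 ≤ M.lam * M.kap := by positivity
  rw [abs_le]
  constructor
  · nlinarith [mul_nonneg hK (Real.exp_pos ((M.lam + 1) * t)).le]
  · rw [g_eq]
    change M.flowX t p.1 + M.flowY t p.2 - _ ≤ _
    rw [flowX_eq, flowY_eq]
    nlinarith [h t ht, mul_le_mul_of_nonneg_right h1 hp2]

end Params

/-! ### The single-jump operator -/

theorem convex_quadrant : Convex ℝ quadrant := by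
  intro p hp q hq a b ha hb _
  exact ⟨add_nonneg (mul_nonneg ha hp.1) (mul_nonneg hb hq.1),
    add_nonneg (mul_nonneg ha hp.2) (mul_nonneg hb hq.2)⟩

theorem isClosed_quadrant : IsClosed quadrant :=
  (isClosed_le continuous_const continuous_fst).inter (isClosed_le continuous_const continuous_snd)

namespace Params

variable (M : Params)

/-- The cost of the deterministic motion on `[0, s]`. -/
noncomputable def costTo (p : ℝ × ℝ) (s : ℝ) : ℝ :=
  ∫ u in (0 : ℝ)..s, Real.exp (-M.lam * u) * M.g (M.flow u p)

/-- The cost incurred up to the time `t ∧ a`, with the terminal cost `w` if the first jump happens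
at the time `a ≤ t`. -/
noncomputable def stepVal (w : ℝ × ℝ → ℝ) (t : ℝ≥0∞) (p : ℝ × ℝ) (a : ℝ) : ℝ :=
  M.costTo p (min t (ENNReal.ofReal a)).toReal +
    if ENNReal.ofReal a ≤ t then Real.exp (-M.lam * a) * w (M.jump (M.flow a p)) else 0

/-- The properties of the iterates `v_n` that are preserved by the operator `J₀`. -/
structure Adm (w : ℝ × ℝ → ℝ) : Prop where
  lip : ∃ L : ℝ, 0 ≤ L ∧ ∀ p ∈ quadrant, ∀ q ∈ quadrant,
    |w p - w q| ≤ L * (|p.1 - q.1| + |p.2 - q.2|)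
  lb : ∀ p ∈ quadrant, -M.kap ≤ w p
  ub : ∀ p ∈ quadrant, w p ≤ 0
  mono : ∀ p ∈ quadrant, ∀ q ∈ quadrant, p ≤ q → w p ≤ w q
  conc : ConcaveOn ℝ quadrant w

theorem continuousOn_of_lip {w : ℝ × ℝ → ℝ} {L : ℝ} (hL : 0 ≤ L)
    (h : ∀ p ∈ quadrant, ∀ q ∈ quadrant, |w p - w q| ≤ L * (|p.1 - q.1| + |p.2 - q.2|)) :
    ContinuousOn w quadrant := by
  have : LipschitzOnWith (2 * L).toNNReal w quadrant := by
    refine LipschitzOnWith.of_dist_le_mul fun p hp q hq => ?_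
    rw [Real.dist_eq, Real.coe_toNNReal _ (by positivity)]
    refine (h p hp q hq).trans ?_
    have h1 : |p.1 - q.1| ≤ dist p q := by
      rw [← Real.dist_eq]; exact le_max_left _ _
    have h2 : |p.2 - q.2| ≤ dist p q := by
      rw [← Real.dist_eq]; exact le_max_right _ _
    nlinarith
  exact this.continuousOn

variable {M} in
theorem Adm.continuousOn {w : ℝ × ℝ → ℝ} (hw : M.Adm w) : ContinuousOn w quadrant := by
  obtain ⟨L, hL, h⟩ := hw.lip
  exact continuousOn_of_lip hL h

theorem adm_zero : M.Adm fun _ => 0 where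
  lip := ⟨0, le_rfl, by simp⟩
  lb := fun _ _ => by linarith [M.kap_pos]
  ub := fun _ _ => le_rfl
  mono := fun _ _ _ _ _ => le_rfl
  conc := concaveOn_const 0 convex_quadrant

theorem continuous_running (p : ℝ × ℝ) :
    Continuous fun u : ℝ => Real.exp (-M.lam * u) * M.g (M.flow u p) :=
  (by fun_prop : Continuous fun u : ℝ => Real.exp (-M.lam * u)).mul
    (M.continuous_g.comp (M.continuous_flow continuous_id continuous_const))

theorem continuous_costTo (p : ℝ × ℝ) : Continuous (M.costTo p) :=
  intervalIntegral.continuous_primitive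
    (fun _ _ => (M.continuous_running p).intervalIntegrable _ _) 0

theorem measurable_stepTime (t : ℝ≥0∞) : Measurable fun a : ℝ => (min t (ENNReal.ofReal a)).toReal := by
  fun_prop

theorem stepTime_nonneg (t : ℝ≥0∞) (a : ℝ) : 0 ≤ (min t (ENNReal.ofReal a)).toReal :=
  ENNReal.toReal_nonneg

theorem stepTime_le (t : ℝ≥0∞) {a : ℝ} (ha : 0 ≤ a) : (min t (ENNReal.ofReal a)).toReal ≤ a :=
  (ENNReal.toReal_mono ENNReal.ofReal_ne_top (min_le_right _ _)).trans
    (ENNReal.toReal_ofReal ha).le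

theorem ae_continuousOn_comp {w : ℝ × ℝ → ℝ} (hw : ContinuousOn w quadrant) {p : ℝ × ℝ}
    (hp : p ∈ quadrant) :
    AEStronglyMeasurable (fun a => w (M.jump (M.flow a p))) (expMeasure M.mu) := by
  have h : ContinuousOn (fun a => w (M.jump (M.flow a p))) (Ioi 0) := by
    refine hw.comp (Continuous.continuousOn ?_) fun a ha => M.jump_mem (M.flow_mem hp (le_of_lt ha))
    exact M.continuous_jump.comp (M.continuous_flow continuous_id continuous_const)
  exact (h.aestronglyMeasurable measurableSet_Ioi).mono_ac expMeasure_absolutelyContinuous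

theorem aestronglyMeasurable_stepVal {w : ℝ × ℝ → ℝ} (hw : ContinuousOn w quadrant) (t : ℝ≥0∞)
    {p : ℝ × ℝ} (hp : p ∈ quadrant) :
    AEStronglyMeasurable (M.stepVal w t p) (expMeasure M.mu) := by
  refine AEStronglyMeasurable.add ?_ ?_
  · exact ((M.continuous_costTo p).measurable.comp (measurable_stepTime t)).aestronglyMeasurable
  · have h1 : AEStronglyMeasurable
        (fun a => Real.exp (-M.lam * a) * w (M.jump (M.flow a p))) (expMeasure M.mu) :=
      (by fun_prop : Measurable fun a => Real.exp (-M.lam * a)).aestronglyMeasurable.mul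
        (M.ae_continuousOn_comp hw hp)
    have h2 : MeasurableSet {a : ℝ | ENNReal.ofReal a ≤ t} :=
      measurableSet_le (by fun_prop) measurable_const
    refine (h1.indicator h2).congr (Eventually.of_forall fun a => ?_)
    by_cases h : ENNReal.ofReal a ≤ t <;> simp [indicator, h]

theorem integral_discount (s : ℝ) :
    ∫ u in (0 : ℝ)..s, M.lam * Real.exp (-M.lam * u) = 1 - Real.exp (-M.lam * s) := by
  have h : ∀ u ∈ uIcc 0 s, HasDerivAt (fun u => -Real.exp (-M.lam * u))
      (M.lam * Real.exp (-M.lam * u)) u := fun u _ => by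
    have := ((hasDerivAt_id u).const_mul (-M.lam)).exp.neg
    exact this.congr_deriv (by simp only [id]; ring)
  rw [intervalIntegral.integral_eq_sub_of_hasDerivAt h
    ((by fun_prop : Continuous _).intervalIntegrable _ _)]
  simp; ring

theorem le_costTo {k : ℝ} {p : ℝ × ℝ} (hk : ∀ u : ℝ, 0 ≤ u → k * M.lam ≤ M.g (M.flow u p))
    {s : ℝ} (hs : 0 ≤ s) : k * (1 - Real.exp (-M.lam * s)) ≤ M.costTo p s := by
  rw [← integral_discount, ← intervalIntegral.integral_const_mul]
  refine intervalIntegral.integral_mono_on hs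
    ((by fun_prop : Continuous _).intervalIntegrable _ _)
    ((M.continuous_running p).intervalIntegrable _ _) fun u hu => ?_
  have := mul_le_mul_of_nonneg_left (hk u hu.1) (Real.exp_pos (-M.lam * u)).le
  linarith

theorem neg_kap_le_costTo {p : ℝ × ℝ} (hp : p ∈ quadrant) {s : ℝ} (hs : 0 ≤ s) :
    -M.kap * (1 - Real.exp (-M.lam * s)) ≤ M.costTo p s :=
  M.le_costTo (fun u hu => by linarith [M.neg_le_g (M.flow_mem hp hu)]) hs

theorem exp_le_one_of_nonneg {a : ℝ} (ha : 0 ≤ a) : Real.exp (-M.lam * a) ≤ 1 :=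
  Real.exp_le_one_iff.2 (by nlinarith [M.lam_pos])

/-- The bound reproduces itself: the running part is at least `-kap (1 - e^{-λs})`, and the terminal
part at least `-kap e^{-λs}`. -/
theorem neg_kap_le_stepVal {w : ℝ × ℝ → ℝ} (hlb : ∀ p ∈ quadrant, -M.kap ≤ w p) (t : ℝ≥0∞)
    {p : ℝ × ℝ} (hp : p ∈ quadrant) {a : ℝ} (ha : 0 ≤ a) : -M.kap ≤ M.stepVal w t p a := by
  have h1 := M.neg_kap_le_costTo hp (stepTime_nonneg t a)
  have hk := M.kap_pos
  unfold stepVal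
  split_ifs with h
  · rw [min_eq_right h, ENNReal.toReal_ofReal ha] at *
    have h2 := hlb _ (M.jump_mem (M.flow_mem hp ha))
    nlinarith [Real.exp_pos (-M.lam * a)]
  · nlinarith [Real.exp_pos (-M.lam * (min t (ENNReal.ofReal a)).toReal)]

theorem exists_abs_costTo_le {p : ℝ × ℝ} (hp : p ∈ quadrant) : ∃ K : ℝ, 0 ≤ K ∧
    ∀ s : ℝ, 0 ≤ s → |M.costTo p s| ≤ K * Real.exp s := by
  obtain ⟨K, hK, h⟩ := M.exists_abs_g_flow_le hp
  refine ⟨K, hK, fun s hs => ?_⟩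
  have h1 : ‖M.costTo p s‖ ≤ ∫ u in (0 : ℝ)..s, K * Real.exp u :=
    intervalIntegral.norm_integral_le_of_norm_le hs
      (Eventually.of_forall fun u hu => h u hu.1.le)
      ((by fun_prop : Continuous _).intervalIntegrable _ _)
  rw [intervalIntegral.integral_const_mul, integral_exp] at h1
  rw [← Real.norm_eq_abs]
  refine h1.trans (mul_le_mul_of_nonneg_left ?_ hK)
  linarith [Real.exp_pos 0]

theorem exists_abs_stepVal_le {w : ℝ × ℝ → ℝ} (hlb : ∀ p ∈ quadrant, -M.kap ≤ w p)
    (hub : ∀ p ∈ quadrant, w p ≤ 0) {p : ℝ × ℝ} (hp : p ∈ quadrant) :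
    ∃ K : ℝ, 0 ≤ K ∧ ∀ (t : ℝ≥0∞) (a : ℝ), 0 ≤ a → |M.stepVal w t p a| ≤ K * Real.exp a := by
  obtain ⟨K, hK, h⟩ := M.exists_abs_costTo_le hp
  have hk := M.kap_pos
  refine ⟨K + M.kap, by positivity, fun t a ha => ?_⟩
  have h1 := h _ (stepTime_nonneg t a)
  have h2 : |(if ENNReal.ofReal a ≤ t then
      Real.exp (-M.lam * a) * w (M.jump (M.flow a p)) else 0)| ≤ M.kap := by
    split_ifs
    · have hm := M.jump_mem (M.flow_mem hp ha)
      rw [abs_mul, abs_of_pos (Real.exp_pos _), abs_of_nonpos (hub _ hm)]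
      nlinarith [hlb _ hm, hub _ hm, M.exp_le_one_of_nonneg ha, Real.exp_pos (-M.lam * a)]
    · simpa using hk.le
  have h3 : Real.exp (min t (ENNReal.ofReal a)).toReal ≤ Real.exp a :=
    Real.exp_le_exp.2 (stepTime_le t ha)
  have h4 := Real.one_le_exp ha
  refine (abs_add_le _ _).trans ?_
  nlinarith

theorem integrable_stepVal {w : ℝ × ℝ → ℝ} (hw : M.Adm w) (t : ℝ≥0∞)
    {p : ℝ × ℝ} (hp : p ∈ quadrant) : Integrable (M.stepVal w t p) (expMeasure M.mu) := by
  obtain ⟨K, _, h⟩ := M.exists_abs_stepVal_le hw.lb hw.ub hp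
  exact ((integrable_exp_expMeasure M.one_lt_mu).const_mul K).mono'
    (M.aestronglyMeasurable_stepVal hw.continuousOn t hp)
    (ae_expMeasure_pos.mono fun a ha => h t a ha.le)

section Jumps

variable {Ω : Type*} [MeasurableSpace Ω] {P : Measure Ω} (N : PoissonProcess P M.mu)

theorem jumpTime_zero (ω : Ω) : N.jumpTime 0 ω = 0 := by simp [PoissonProcess.jumpTime]

theorem jumpTime_succ (n : ℕ) (ω : Ω) : N.jumpTime (n + 1) ω = N.jumpTime n ω + N.gap n ω :=
  Finset.sum_range_succ _ _

theorem jumpTime_one (ω : Ω) : N.jumpTime 1 ω = N.gap 0 ω := by simp [PoissonProcess.jumpTime]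

theorem count_eq_iff {t : ℝ} (ht : 0 ≤ t) (n : ℕ) (ω : Ω) :
    N.count t ω = n ↔ N.jumpTime n ω ≤ t ∧ t < N.jumpTime (n + 1) ω := by
  rw [← N.le_count_iff ht, ← not_le, ← N.le_count_iff ht]
  omega

theorem Phi_of_lt (p : ℝ × ℝ) {t : ℝ} (ht : 0 ≤ t) {ω : Ω} (h : t < N.gap 0 ω) :
    M.Phi N p t ω = M.flow t p := by
  have : N.count t ω = 0 := (M.count_eq_iff N ht 0 ω).2
    ⟨by rwa [jumpTime_zero], by rwa [zero_add, jumpTime_one]⟩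
  simp [Phi, this, jumpTime_zero, postJump]

theorem Phi_gap_zero (p : ℝ × ℝ) (ω : Ω) :
    M.Phi N p (N.gap 0 ω) ω = M.flow 0 (M.jump (M.flow (N.gap 0 ω) p)) := by
  have : N.count (N.gap 0 ω) ω = 1 := (M.count_eq_iff N (N.gap_pos 0 ω).le 1 ω).2
    ⟨by rw [jumpTime_one], by rw [jumpTime_succ, jumpTime_one]; linarith [N.gap_pos 1 ω]⟩
  simp [Phi, this, jumpTime_one, postJump]

theorem flow_zero (p : ℝ × ℝ) : M.flow 0 p = p := by
  refine Prod.ext ?_ ?_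
  · change M.flowX 0 p.1 = _
    rw [flowX_eq, flowX_zero_eq]; simp
  · change M.flowY 0 p.2 = _
    unfold flowY
    split_ifs <;> simp

/-- Up to and including the first jump the path is determined by the first gap alone, so the
expectation is an integral against the exponential law. -/
theorem J_eq {w : ℝ × ℝ → ℝ} (hw : M.Adm w) (t : ℝ≥0∞) {p : ℝ × ℝ} (hp : p ∈ quadrant) :
    M.J N w t p = ∫ a, M.stepVal w t p a ∂expMeasure M.mu := by
  rw [← N.law_gap 0, integral_map (N.measurable_gap 0).aemeasurable
    (by rw [N.law_gap 0]; exact M.aestronglyMeasurable_stepVal hw.continuousOn t hp)]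
  unfold J
  refine integral_congr_ae (Eventually.of_forall fun ω => ?_)
  simp only [stepVal, costTo, jumpTime_one, Phi_gap_zero, flow_zero]
  congr 1
  refine intervalIntegral.integral_congr_ae ?_
  -- At the jump time itself the process has already left the flow; this is a single point.
  have hne : ∀ᵐ u : ℝ, u ≠ N.gap 0 ω := by simp [ae_iff]
  filter_upwards [hne] with u hu hmem
  rw [uIoc_of_le (stepTime_nonneg _ _)] at hmem
  have : u < N.gap 0 ω :=
    lt_of_le_of_ne (hmem.2.trans (stepTime_le t (N.gap_pos 0 ω).le)) hu
  rw [M.Phi_of_lt N p hmem.1.le this]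

end Jumps

theorem flow_fst_sub (u : ℝ) (p q : ℝ × ℝ) :
    (M.flow u p).1 - (M.flow u q).1 = Real.exp ((M.lam + 1) * u) * (p.1 - q.1) := by
  change M.flowX u p.1 - M.flowX u q.1 = _
  rw [M.flowX_eq u p.1, M.flowX_eq u q.1]; ring

theorem flow_snd_sub (u : ℝ) (p q : ℝ × ℝ) :
    (M.flow u p).2 - (M.flow u q).2 = Real.exp ((M.lam - 1) * u) * (p.2 - q.2) := by
  change M.flowY u p.2 - M.flowY u q.2 = _
  rw [M.flowY_eq u p.2, M.flowY_eq u q.2]; ring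

theorem exp_mul_flow_sub_le {u : ℝ} (hu : 0 ≤ u) (p q : ℝ × ℝ) :
    Real.exp (-M.lam * u) * |(M.flow u p).1 - (M.flow u q).1| +
      Real.exp (-M.lam * u) * |(M.flow u p).2 - (M.flow u q).2| ≤
      Real.exp u * (|p.1 - q.1| + |p.2 - q.2|) := by
  rw [flow_fst_sub, flow_snd_sub, abs_mul, abs_mul, abs_of_pos (Real.exp_pos _),
    abs_of_pos (Real.exp_pos _), ← mul_assoc, ← mul_assoc, ← Real.exp_add, ← Real.exp_add, mul_add]
  refine add_le_add ?_ ?_ <;> refine mul_le_mul_of_nonneg_right ?_ (abs_nonneg _) <;>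
    refine Real.exp_le_exp.2 ?_ <;> nlinarith

theorem abs_costTo_sub_le (p q : ℝ × ℝ) {s : ℝ} (hs : 0 ≤ s) :
    |M.costTo p s - M.costTo q s| ≤ Real.exp s * (|p.1 - q.1| + |p.2 - q.2|) := by
  unfold costTo
  rw [← intervalIntegral.integral_sub ((M.continuous_running p).intervalIntegrable _ _)
    ((M.continuous_running q).intervalIntegrable _ _), ← Real.norm_eq_abs]
  refine (intervalIntegral.norm_integral_le_of_norm_le
    (g := fun u => Real.exp u * (|p.1 - q.1| + |p.2 - q.2|)) hs
    (Eventually.of_forall fun u hu => ?_)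
    ((by fun_prop : Continuous _).intervalIntegrable _ _)).trans ?_
  · rw [← mul_sub, Real.norm_eq_abs, abs_mul, abs_of_pos (Real.exp_pos _)]
    refine le_trans ?_ (M.exp_mul_flow_sub_le hu.1.le p q)
    rw [← mul_add]
    refine mul_le_mul_of_nonneg_left ?_ (Real.exp_pos _).le
    have e : M.g (M.flow u p) - M.g (M.flow u q) =
      ((M.flow u p).1 - (M.flow u q).1) + ((M.flow u p).2 - (M.flow u q).2) := by
      rw [g_eq, g_eq]; ring
    rw [e]
    exact abs_add_le _ _
  · rw [intervalIntegral.integral_mul_const, integral_exp]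
    refine mul_le_mul_of_nonneg_right ?_ (by positivity)
    linarith [Real.exp_pos 0]

theorem abs_stepVal_sub_le {w : ℝ × ℝ → ℝ} {L : ℝ} (hL : 0 ≤ L)
    (hlip : ∀ p ∈ quadrant, ∀ q ∈ quadrant, |w p - w q| ≤ L * (|p.1 - q.1| + |p.2 - q.2|))
    (t : ℝ≥0∞) {p q : ℝ × ℝ} (hp : p ∈ quadrant) (hq : q ∈ quadrant) {a : ℝ} (ha : 0 ≤ a) :
    |M.stepVal w t p a - M.stepVal w t q a| ≤
      (1 + 2 * L) * (|p.1 - q.1| + |p.2 - q.2|) * Real.exp a := by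
  have hd : 0 ≤ |p.1 - q.1| + |p.2 - q.2| := by positivity
  have h1 := M.abs_costTo_sub_le p q (stepTime_nonneg t a)
  have h3 : Real.exp (min t (ENNReal.ofReal a)).toReal ≤ Real.exp a :=
    Real.exp_le_exp.2 (stepTime_le t ha)
  have h4 := mul_le_mul_of_nonneg_right h3 hd
  unfold stepVal
  split_ifs with h
  · have h2 := hlip _ (M.jump_mem (M.flow_mem hp ha)) _ (M.jump_mem (M.flow_mem hq ha))
    have h5 := M.exp_mul_flow_sub_le ha p q
    -- Both jump factors `1 ± 1/μ` lie in `(0, 2)`, which explains the constant `2 L`.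
    have h6 : |(M.jump (M.flow a p)).1 - (M.jump (M.flow a q)).1| ≤
        2 * |(M.flow a p).1 - (M.flow a q).1| := by
      simp only [jump]
      rw [← mul_sub, abs_mul, abs_of_pos (by linarith [M.inv_mu_lt_one])]
      exact mul_le_mul_of_nonneg_right (by linarith [M.inv_mu_pos]) (abs_nonneg _)
    have h7 : |(M.jump (M.flow a p)).2 - (M.jump (M.flow a q)).2| ≤
        2 * |(M.flow a p).2 - (M.flow a q).2| := by
      simp only [jump]
      rw [← mul_sub, abs_mul, abs_of_pos (by linarith [M.inv_mu_pos])]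
      exact mul_le_mul_of_nonneg_right (by linarith [M.inv_mu_lt_one]) (abs_nonneg _)
    have h8 : |Real.exp (-M.lam * a) * w (M.jump (M.flow a p)) -
        Real.exp (-M.lam * a) * w (M.jump (M.flow a q))| ≤
        2 * L * (Real.exp a * (|p.1 - q.1| + |p.2 - q.2|)) := by
      rw [← mul_sub, abs_mul, abs_of_pos (Real.exp_pos _)]
      refine le_trans ?_ (mul_le_mul_of_nonneg_left h5 (by positivity))
      refine (mul_le_mul_of_nonneg_left (h2.trans (mul_le_mul_of_nonneg_left
        (add_le_add h6 h7) hL)) (Real.exp_pos _).le).trans (le_of_eq ?_)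
      ring
    rw [add_sub_add_comm]
    refine (abs_add_le _ _).trans ?_
    linarith
  · rw [add_zero, add_zero]
    refine h1.trans (h4.trans ?_)
    have := mul_nonneg (mul_nonneg hL hd) (Real.exp_pos a).le
    linarith

theorem flow_mono {p q : ℝ × ℝ} (h : p ≤ q) (u : ℝ) : M.flow u p ≤ M.flow u q := by
  constructor
  · have := M.flow_fst_sub u q p
    have := mul_nonneg (Real.exp_pos ((M.lam + 1) * u)).le (sub_nonneg.2 h.1)
    linarith
  · have := M.flow_snd_sub u q p
    have := mul_nonneg (Real.exp_pos ((M.lam - 1) * u)).le (sub_nonneg.2 h.2)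
    linarith

theorem jump_mono {p q : ℝ × ℝ} (h : p ≤ q) : M.jump p ≤ M.jump q :=
  ⟨mul_le_mul_of_nonneg_left h.1 (by linarith [M.inv_mu_lt_one]),
    mul_le_mul_of_nonneg_left h.2 (by linarith [M.inv_mu_pos])⟩

theorem g_mono {p q : ℝ × ℝ} (h : p ≤ q) : M.g p ≤ M.g q := by
  rw [g_eq, g_eq]; linarith [h.1, h.2]

theorem costTo_mono {p q : ℝ × ℝ} (h : p ≤ q) {s : ℝ} (hs : 0 ≤ s) :
    M.costTo p s ≤ M.costTo q s :=
  intervalIntegral.integral_mono_on hs ((M.continuous_running p).intervalIntegrable _ _)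
    ((M.continuous_running q).intervalIntegrable _ _) fun u _ =>
    mul_le_mul_of_nonneg_left (M.g_mono (M.flow_mono h u)) (Real.exp_pos _).le

theorem flow_combo {α β : ℝ} (h : α + β = 1) (p q : ℝ × ℝ) (u : ℝ) :
    M.flow u (α • p + β • q) = α • M.flow u p + β • M.flow u q := by
  obtain rfl : β = 1 - α := by linarith
  refine Prod.ext ?_ ?_
  · change M.flowX u (α * p.1 + (1 - α) * q.1) = α * M.flowX u p.1 + (1 - α) * M.flowX u q.1
    rw [M.flowX_eq, M.flowX_eq u p.1, M.flowX_eq u q.1]; ring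
  · change M.flowY u (α * p.2 + (1 - α) * q.2) = α * M.flowY u p.2 + (1 - α) * M.flowY u q.2
    rw [M.flowY_eq, M.flowY_eq u p.2, M.flowY_eq u q.2]; ring

theorem jump_combo (α β : ℝ) (p q : ℝ × ℝ) :
    M.jump (α • p + β • q) = α • M.jump p + β • M.jump q := by
  refine Prod.ext ?_ ?_ <;> simp [jump] <;> ring

theorem g_combo {α β : ℝ} (h : α + β = 1) (p q : ℝ × ℝ) :
    M.g (α • p + β • q) = α * M.g p + β * M.g q := by
  obtain rfl : β = 1 - α := by linarith
  simp [g_eq]; ring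

theorem costTo_combo {α β : ℝ} (h : α + β = 1) (p q : ℝ × ℝ) (s : ℝ) :
    M.costTo (α • p + β • q) s = α * M.costTo p s + β * M.costTo q s := by
  unfold costTo
  rw [← intervalIntegral.integral_const_mul, ← intervalIntegral.integral_const_mul,
    ← intervalIntegral.integral_add
      (((M.continuous_running p).const_mul α |>.intervalIntegrable _ _))
      (((M.continuous_running q).const_mul β |>.intervalIntegrable _ _))]
  refine intervalIntegral.integral_congr fun u _ => ?_
  simp only [M.flow_combo h, M.g_combo h]
  ring

section Jumps

variable {Ω : Type*} [MeasurableSpace Ω] {P : Measure Ω} (N : PoissonProcess P M.mu)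

instance isProbabilityMeasure_expMeasure_mu : IsProbabilityMeasure (expMeasure M.mu) :=
  isProbabilityMeasure_expMeasure M.mu_pos

theorem neg_kap_le_J {w : ℝ × ℝ → ℝ} (hw : M.Adm w) (t : ℝ≥0∞) {p : ℝ × ℝ} (hp : p ∈ quadrant) :
    -M.kap ≤ M.J N w t p := by
  rw [M.J_eq N hw t hp]
  have h := integral_mono_ae (integrable_const (-M.kap)) (M.integrable_stepVal hw t hp)
    (ae_expMeasure_pos.mono fun a ha => M.neg_kap_le_stepVal hw.lb t hp ha.le)
  simpa using h

theorem bddBelow_J {w : ℝ × ℝ → ℝ} (hw : M.Adm w) {p : ℝ × ℝ} (hp : p ∈ quadrant) :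
    BddBelow (range fun t : ℝ≥0∞ => M.J N w t p) :=
  ⟨-M.kap, by rintro _ ⟨t, rfl⟩; exact M.neg_kap_le_J N hw t hp⟩

theorem J0_le_J {w : ℝ × ℝ → ℝ} (hw : M.Adm w) (t : ℝ≥0∞) {p : ℝ × ℝ} (hp : p ∈ quadrant) :
    M.J0 N w p ≤ M.J N w t p :=
  ciInf_le (M.bddBelow_J N hw hp) t

theorem J_zero {w : ℝ × ℝ → ℝ} (hw : M.Adm w) {p : ℝ × ℝ} (hp : p ∈ quadrant) :
    M.J N w 0 p = 0 := by
  rw [M.J_eq N hw 0 hp]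
  refine (integral_congr_ae (ae_expMeasure_pos.mono fun a ha => ?_)).trans (integral_zero _ _)
  simp [stepVal, costTo, not_le.2 ha]

theorem J_lip {w : ℝ × ℝ → ℝ} (hw : M.Adm w) : ∃ L : ℝ, 0 ≤ L ∧ ∀ t : ℝ≥0∞,
    ∀ p ∈ quadrant, ∀ q ∈ quadrant,
      |M.J N w t p - M.J N w t q| ≤ L * (|p.1 - q.1| + |p.2 - q.2|) := by
  obtain ⟨L, hL, hlip⟩ := hw.lip
  refine ⟨(1 + 2 * L) * ∫ a, Real.exp a ∂expMeasure M.mu,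
    mul_nonneg (by positivity) (integral_nonneg fun _ => (Real.exp_pos _).le),
    fun t p hp q hq => ?_⟩
  rw [M.J_eq N hw t hp, M.J_eq N hw t hq,
    ← integral_sub (M.integrable_stepVal hw t hp) (M.integrable_stepVal hw t hq),
    ← Real.norm_eq_abs]
  refine (norm_integral_le_of_norm_le
    ((integrable_exp_expMeasure M.one_lt_mu).const_mul
      ((1 + 2 * L) * (|p.1 - q.1| + |p.2 - q.2|)))
    (ae_expMeasure_pos.mono fun a ha => M.abs_stepVal_sub_le hL hlip t hp hq ha.le)).trans
    (le_of_eq ?_)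
  rw [integral_const_mul]; ring

theorem J_mono_state {w : ℝ × ℝ → ℝ} (hw : M.Adm w) (t : ℝ≥0∞) {p q : ℝ × ℝ}
    (hp : p ∈ quadrant) (hq : q ∈ quadrant) (h : p ≤ q) : M.J N w t p ≤ M.J N w t q := by
  rw [M.J_eq N hw t hp, M.J_eq N hw t hq]
  refine integral_mono_ae (M.integrable_stepVal hw t hp) (M.integrable_stepVal hw t hq)
    (ae_expMeasure_pos.mono fun a ha => add_le_add (M.costTo_mono h (stepTime_nonneg t a)) ?_)
  split_ifs
  · exact mul_le_mul_of_nonneg_left (hw.mono _ (M.jump_mem (M.flow_mem hp ha.le)) _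
      (M.jump_mem (M.flow_mem hq ha.le)) (M.jump_mono (M.flow_mono h a))) (Real.exp_pos _).le
  · exact le_rfl

theorem J_mono {w w' : ℝ × ℝ → ℝ} (hw : M.Adm w) (hw' : M.Adm w')
    (h : ∀ p ∈ quadrant, w p ≤ w' p) (t : ℝ≥0∞) {p : ℝ × ℝ} (hp : p ∈ quadrant) :
    M.J N w t p ≤ M.J N w' t p := by
  rw [M.J_eq N hw t hp, M.J_eq N hw' t hp]
  refine integral_mono_ae (M.integrable_stepVal hw t hp) (M.integrable_stepVal hw' t hp)
    (ae_expMeasure_pos.mono fun a ha => add_le_add le_rfl ?_)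
  split_ifs
  · exact mul_le_mul_of_nonneg_left (h _ (M.jump_mem (M.flow_mem hp ha.le))) (Real.exp_pos _).le
  · exact le_rfl

/-- The operator looks at `w` only along the states reached by flowing from `p` and jumping once.
This is what makes the closedness condition effective. -/
theorem J_congr {w w' : ℝ × ℝ → ℝ} (hw : M.Adm w) (hw' : M.Adm w') {p : ℝ × ℝ}
    (hp : p ∈ quadrant) (h : ∀ a : ℝ, 0 ≤ a → w (M.jump (M.flow a p)) = w' (M.jump (M.flow a p)))
    (t : ℝ≥0∞) : M.J N w t p = M.J N w' t p := by
  rw [M.J_eq N hw t hp, M.J_eq N hw' t hp]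
  refine integral_congr_ae (ae_expMeasure_pos.mono fun a ha => ?_)
  simp only [stepVal, h a ha.le]

theorem J_concave {w : ℝ × ℝ → ℝ} (hw : M.Adm w) (t : ℝ≥0∞) {p q : ℝ × ℝ}
    (hp : p ∈ quadrant) (hq : q ∈ quadrant) {α β : ℝ} (hα : 0 ≤ α) (hβ : 0 ≤ β) (h : α + β = 1) :
    α * M.J N w t p + β * M.J N w t q ≤ M.J N w t (α • p + β • q) := by
  have hm := convex_quadrant hp hq hα hβ h
  rw [M.J_eq N hw t hp, M.J_eq N hw t hq, M.J_eq N hw t hm, ← integral_const_mul,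
    ← integral_const_mul, ← integral_add ((M.integrable_stepVal hw t hp).const_mul α)
      ((M.integrable_stepVal hw t hq).const_mul β)]
  refine integral_mono_ae (((M.integrable_stepVal hw t hp).const_mul α).add
    ((M.integrable_stepVal hw t hq).const_mul β)) (M.integrable_stepVal hw t hm)
    (ae_expMeasure_pos.mono fun a ha => ?_)
  simp only [stepVal, M.costTo_combo h, M.flow_combo h, M.jump_combo]
  split_ifs
  · have h1 := hw.conc.2 (M.jump_mem (M.flow_mem hp ha.le)) (M.jump_mem (M.flow_mem hq ha.le))
      hα hβ h
    have h2 := mul_le_mul_of_nonneg_left h1 (Real.exp_pos (-M.lam * a)).le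
    simp only [smul_eq_mul] at h2
    linarith
  · simp only [add_zero]; exact le_rfl

/-- All five properties pass to an infimum over `t`, because each `J w t` has them with bounds
uniform in `t`; concavity uses that flow, jump and cost are affine. The Lipschitz constant may grow
from one iterate to the next, which is harmless since only individual iterates need continuity. -/
theorem adm_J0 {w : ℝ × ℝ → ℝ} (hw : M.Adm w) : M.Adm (M.J0 N w) where
  lip := by
    obtain ⟨L, hL, h⟩ := M.J_lip N hw
    refine ⟨L, hL, ?_⟩
    have key : ∀ p ∈ quadrant, ∀ q ∈ quadrant,
        M.J0 N w p - L * (|p.1 - q.1| + |p.2 - q.2|) ≤ M.J0 N w q := fun p hp q hq => by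
      refine le_ciInf fun t => ?_
      have h1 := M.J0_le_J N hw t hp
      have h2 := (abs_le.1 (h t p hp q hq)).2
      linarith
    intro p hp q hq
    rw [abs_le]
    have h1 := key p hp q hq
    have h2 := key q hq p hp
    rw [abs_sub_comm q.1, abs_sub_comm q.2] at h2
    constructor <;> linarith
  lb := fun _ hp => le_ciInf fun t => M.neg_kap_le_J N hw t hp
  ub := fun _ hp => (M.J0_le_J N hw 0 hp).trans (M.J_zero N hw hp).le
  mono := fun _ hp _ hq h => le_ciInf fun t =>
    (M.J0_le_J N hw t hp).trans (M.J_mono_state N hw t hp hq h)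
  conc := by
    refine ⟨convex_quadrant, fun p hp q hq α β hα hβ h => le_ciInf fun t => ?_⟩
    refine le_trans ?_ (M.J_concave N hw t hp hq hα hβ h)
    exact add_le_add (mul_le_mul_of_nonneg_left (M.J0_le_J N hw t hp) hα)
      (mul_le_mul_of_nonneg_left (M.J0_le_J N hw t hq) hβ)

theorem adm_vn (n : ℕ) : M.Adm (M.vn N n) := by
  induction n with
  | zero => exact M.adm_zero
  | succ n ih => exact M.adm_J0 N ih

theorem vn_succ_le (n : ℕ) : ∀ p ∈ quadrant, M.vn N (n + 1) p ≤ M.vn N n p := by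
  induction n with
  | zero => exact fun p hp => (M.adm_vn N 1).ub p hp
  | succ n ih =>
    intro p hp
    refine le_ciInf fun t => (M.J0_le_J N (M.adm_vn N (n + 1)) t hp).trans ?_
    exact M.J_mono N (M.adm_vn N (n + 1)) (M.adm_vn N n) ih t hp

theorem vn_antitone {p : ℝ × ℝ} (hp : p ∈ quadrant) : Antitone fun n => M.vn N n p :=
  antitone_nat_of_succ_le fun n => M.vn_succ_le N n p hp

theorem tendsto_vn {p : ℝ × ℝ} (hp : p ∈ quadrant) :
    Tendsto (fun n => M.vn N n p) atTop (𝓝 (M.v N p)) :=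
  tendsto_nhds_limUnder ⟨_, tendsto_atTop_ciInf (M.vn_antitone N hp)
    ⟨-M.kap, by rintro _ ⟨n, rfl⟩; exact (M.adm_vn N n).lb p hp⟩⟩

theorem v_le_vn (n : ℕ) {p : ℝ × ℝ} (hp : p ∈ quadrant) : M.v N p ≤ M.vn N n p :=
  (M.vn_antitone N hp).le_of_tendsto (M.tendsto_vn N hp) n

/-- The iterates decrease to `v` and are nonpositive. Closedness and convexity of `Γ` thus follow
from those of the `Γ_n`, without continuity of the limit `v`. -/
theorem Gamma_eq_iInter : M.Gamma N = ⋂ n, M.Gamman N n := by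
  ext p
  simp only [Gamma, Gamman, mem_iInter, mem_ofPred_eq]
  constructor
  · intro h n
    refine ⟨h.1, le_antisymm ((M.adm_vn N n).ub p h.1) ?_⟩
    rw [← h.2]
    exact M.v_le_vn N n h.1
  · intro h
    refine ⟨(h 0).1, tendsto_nhds_unique (M.tendsto_vn N (h 0).1) ?_⟩
    simp [fun n => (h n).2]

theorem Gamma_subset_Gamman (n : ℕ) : M.Gamma N ⊆ M.Gamman N n := by
  rw [Gamma_eq_iInter]; exact iInter_subset _ n

theorem isClosed_Gamman (n : ℕ) : IsClosed (M.Gamman N n) :=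
  (M.adm_vn N n).continuousOn.preimage_isClosed_of_isClosed isClosed_quadrant
    (isClosed_singleton (x := (0 : ℝ)))

/-- Since `v_n ≤ 0`, the zero set is a superlevel set of a concave function. -/
theorem convex_Gamman (n : ℕ) : Convex ℝ (M.Gamman N n) := by
  have h := (M.adm_vn N n).conc.convex_ge 0
  refine (congrArg (Convex ℝ) ?_).mpr h
  ext p
  exact and_congr_right fun hp => ⟨fun h => h.ge, fun h => le_antisymm ((M.adm_vn N n).ub p hp) h⟩

theorem Gamman_upward (n : ℕ) {p q : ℝ × ℝ} (hp : p ∈ M.Gamman N n) (h : p ≤ q) :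
    q ∈ M.Gamman N n := by
  have hq : q ∈ quadrant := ⟨hp.1.1.trans h.1, hp.1.2.trans h.2⟩
  refine ⟨hq, le_antisymm ((M.adm_vn N n).ub q hq) ?_⟩
  rw [← hp.2]
  exact (M.adm_vn N n).mono p hp.1 q hq h

end Jumps

end Params

/-! ### Upward closed convex regions of the quadrant and their boundary functions -/

/-- A closed convex upward closed subset of the quadrant that does not contain the origin and meets
both axes. -/
structure IsUpRegion (G : Set (ℝ × ℝ)) : Prop where
  sub : G ⊆ quadrant
  closed : IsClosed G
  convex : Convex ℝ G
  up : ∀ p ∈ G, ∀ q, p ≤ q → q ∈ G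
  meets_fst : ∃ x, (x, 0) ∈ G
  meets_snd : ∃ y, (0, y) ∈ G
  zero_notMem : ((0 : ℝ), (0 : ℝ)) ∉ G

/-- The boundary function of a region. -/
noncomputable def boundary (G : Set (ℝ × ℝ)) (x : ℝ) : ℝ := sInf {y : ℝ | 0 ≤ y ∧ (x, y) ∈ G}

theorem boundary_nonneg (G : Set (ℝ × ℝ)) (x : ℝ) : 0 ≤ boundary G x :=
  Real.sInf_nonneg fun _ h => h.1

namespace IsUpRegion

variable {G : Set (ℝ × ℝ)}

theorem mem_iff (hG : IsUpRegion G) {x y : ℝ} (hx : 0 ≤ x) (hy : 0 ≤ y) :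
    (x, y) ∈ G ↔ boundary G x ≤ y := by
  have hbdd : BddBelow {y : ℝ | 0 ≤ y ∧ (x, y) ∈ G} := ⟨0, fun _ h => h.1⟩
  constructor
  · intro h
    exact csInf_le hbdd ⟨hy, h⟩
  · intro h
    have hcl : IsClosed {y : ℝ | 0 ≤ y ∧ (x, y) ∈ G} :=
      isClosed_Ici.inter (hG.closed.preimage (by fun_prop : Continuous fun y : ℝ => (x, y)))
    obtain ⟨Y, hY⟩ := hG.meets_snd
    have hne : {y : ℝ | 0 ≤ y ∧ (x, y) ∈ G}.Nonempty :=
      ⟨Y, (hG.sub hY).2, hG.up _ hY _ ⟨hx, le_rfl⟩⟩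
    exact hG.up _ (hcl.csInf_mem hne hbdd).2 _ ⟨le_rfl, h⟩

theorem boundary_mem (hG : IsUpRegion G) {x : ℝ} (hx : 0 ≤ x) : (x, boundary G x) ∈ G :=
  (hG.mem_iff hx (boundary_nonneg G x)).2 le_rfl

theorem boundary_anti (hG : IsUpRegion G) {x x' : ℝ} (hx : 0 ≤ x) (h : x ≤ x') :
    boundary G x' ≤ boundary G x :=
  (hG.mem_iff (hx.trans h) (boundary_nonneg G x)).1
    (hG.up _ (hG.boundary_mem hx) _ ⟨h, le_rfl⟩)

theorem boundary_zero_pos (hG : IsUpRegion G) : 0 < boundary G 0 := by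
  refine lt_of_le_of_ne (boundary_nonneg G 0) fun h => hG.zero_notMem ?_
  exact (hG.mem_iff le_rfl le_rfl).2 h.ge

theorem convexOn_boundary (hG : IsUpRegion G) : ConvexOn ℝ (Ici 0) (boundary G) := by
  refine ⟨convex_Ici 0, fun x hx x' hx' α β hα hβ h => ?_⟩
  have hm := hG.convex (hG.boundary_mem hx) (hG.boundary_mem hx') hα hβ h
  refine (hG.mem_iff ?_ ?_).1 hm
  · exact add_nonneg (mul_nonneg hα hx) (mul_nonneg hβ hx')
  · exact add_nonneg (mul_nonneg hα (boundary_nonneg _ _)) (mul_nonneg hβ (boundary_nonneg _ _))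

/-- Convexity gives continuity on the open half-line only. At `0`, closedness of the region prevents
a drop, and monotonicity prevents a rise. -/
theorem continuousOn_boundary (hG : IsUpRegion G) : ContinuousOn (boundary G) (Ici 0) := by
  have hint : ContinuousOn (boundary G) (Ioi 0) :=
    (hG.convexOn_boundary.subset Ioi_subset_Ici_self (convex_Ioi 0)).continuousOn isOpen_Ioi
  intro x hx
  rcases eq_or_lt_of_le (show (0 : ℝ) ≤ x from hx) with rfl | hx0
  · rw [Metric.continuousWithinAt_iff']
    intro ε hε
    have hlow : ∀ᶠ x in 𝓝[≥] (0 : ℝ), boundary G 0 - ε < boundary G x := by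
      rcases lt_or_ge (boundary G 0 - ε) 0 with hneg | hnn
      · exact Eventually.of_forall fun x => hneg.trans_le (boundary_nonneg G x)
      · have hnot : ((0 : ℝ), boundary G 0 - ε) ∉ G := fun h => by
          linarith [(hG.mem_iff le_rfl hnn).1 h]
        have hev : ∀ᶠ x in 𝓝 (0 : ℝ), (x, boundary G 0 - ε) ∈ Gᶜ :=
          (by fun_prop : Continuous fun x : ℝ => (x, boundary G 0 - ε)).continuousAt.eventually_mem
            (hG.closed.isOpen_compl.mem_nhds hnot)
        filter_upwards [nhdsWithin_le_nhds hev, self_mem_nhdsWithin] with x h1 h2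
        by_contra! hle
        exact h1 ((hG.mem_iff h2 hnn).2 hle)
    filter_upwards [hlow, self_mem_nhdsWithin] with x h1 h2
    rw [Real.dist_eq, abs_lt]
    have := hG.boundary_anti le_rfl h2
    constructor <;> linarith
  · exact (hint.continuousAt (Ioi_mem_nhds hx0)).continuousWithinAt

end IsUpRegion

/-! ### Preimages under the jump map and first crossings -/

namespace Params

variable (M : Params)

/-- The jump map is diagonal and preserves the quadrant, so the membership conditions at the
intermediate steps are automatic; `hR` serves the case `n = 0`. -/
theorem mem_preim {R : Set (ℝ × ℝ)} (hR : R ⊆ quadrant) (n : ℕ) (p : ℝ × ℝ) :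
    p ∈ M.preim n R ↔ p ∈ quadrant ∧
      ((1 - 1 / M.mu) ^ n * p.1, (1 + 1 / M.mu) ^ n * p.2) ∈ R := by
  induction n generalizing p with
  | zero => simpa [preim] using fun h => hR h
  | succ n ih =>
    have e : p ∈ M.preim (n + 1) R ↔ p ∈ quadrant ∧ M.jump p ∈ M.preim n R := by
      unfold preim
      rw [Function.iterate_succ_apply']
      rfl
    rw [e, ih]
    simp only [jump, ← mul_assoc, ← pow_succ]
    exact ⟨fun h => ⟨h.1, h.2.2⟩, fun h => ⟨h.1, M.jump_mem h.1, h.2⟩⟩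

theorem preimFun_eq (n : ℕ) {f : ℝ → ℝ} (hf : ∀ x, 0 ≤ f x) {x : ℝ} (hx : 0 ≤ x) :
    M.preimFun n f x = f ((1 - 1 / M.mu) ^ n * x) / (1 + 1 / M.mu) ^ n := by
  have ha : 0 < (1 + 1 / M.mu) ^ n := pow_pos (by linarith [M.inv_mu_pos]) n
  have hb : 0 < (1 - 1 / M.mu) ^ n := pow_pos (by linarith [M.inv_mu_lt_one]) n
  have e : {y : ℝ | 0 ≤ y ∧ (x, y) ∈ M.preim n {p ∈ quadrant | f p.1 ≤ p.2}} =
      Ici (f ((1 - 1 / M.mu) ^ n * x) / (1 + 1 / M.mu) ^ n) := by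
    ext y
    simp only [mem_ofPred_eq, mem_Ici]
    rw [M.mem_preim (fun p h => h.1), div_le_iff₀ ha, mul_comm y]
    constructor
    · intro h
      exact h.2.2.2
    · intro h
      have hy : 0 ≤ y := nonneg_of_mul_nonneg_right ((hf _).trans h) ha
      exact ⟨hy, ⟨hx, hy⟩, ⟨mul_nonneg hb.le hx, mul_nonneg ha.le hy⟩, h⟩
  rw [preimFun, e, csInf_Ici]

/-- Here `S^{-n}[f](x) = f((1 - 1/μ)^n x) / (1 + 1/μ)^n`. At `x = 0` this is strictly below `f(0) >
0`, and where the region meets the horizontal axis `f` vanishes, so the continuous difference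
changes sign. Its zero set is closed and has a least element. -/
theorem exists_isFirstCrossing {G : Set (ℝ × ℝ)} (hG : IsUpRegion G) {n : ℕ} (hn : 1 ≤ n) :
    ∃ x, 0 < x ∧ M.IsFirstCrossing n (boundary G) x ∧
      ∀ x' ∈ Ico 0 x, M.preimFun n (boundary G) x' < boundary G x' := by
  have ha : 1 < (1 + 1 / M.mu) ^ n := one_lt_pow₀ (by linarith [M.inv_mu_pos]) (by omega)
  have hb : 0 < (1 - 1 / M.mu) ^ n := pow_pos (by linarith [M.inv_mu_lt_one]) n
  set h : ℝ → ℝ := fun x =>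
    boundary G x - boundary G ((1 - 1 / M.mu) ^ n * x) / (1 + 1 / M.mu) ^ n with hh
  have hcont : ContinuousOn h (Ici 0) := by
    refine hG.continuousOn_boundary.sub (ContinuousOn.div_const ?_ _)
    exact hG.continuousOn_boundary.comp (by fun_prop) fun x hx => mul_nonneg hb.le hx
  have hset : {x : ℝ | 0 ≤ x ∧ M.preimFun n (boundary G) x = boundary G x} =
      Ici 0 ∩ h ⁻¹' {0} := by
    ext x
    refine and_congr_right fun hx => ?_
    rw [M.preimFun_eq n (boundary_nonneg G) hx]
    simp only [mem_preimage, mem_singleton_iff, hh, sub_eq_zero]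
    exact eq_comm
  have hcl : IsClosed (Ici 0 ∩ h ⁻¹' {0}) :=
    hcont.preimage_isClosed_of_isClosed isClosed_Ici isClosed_singleton
  have h0 : 0 < h 0 := by
    simp only [hh, mul_zero, sub_pos]
    exact div_lt_self hG.boundary_zero_pos ha
  have hzero : ∀ x, 0 ≤ x → h x ≤ 0 → ∃ z ∈ Icc 0 x, h z = 0 := fun x hx hle =>
    intermediate_value_Icc' hx (hcont.mono Icc_subset_Ici_self) ⟨hle, h0.le⟩
  obtain ⟨X, hX⟩ := hG.meets_fst
  have hX0 : 0 ≤ X := (hG.sub hX).1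
  have hXle : h X ≤ 0 := by
    have h1 : boundary G X ≤ 0 := (hG.mem_iff hX0 le_rfl).1 hX
    have h2 : 0 ≤ boundary G ((1 - 1 / M.mu) ^ n * X) / (1 + 1 / M.mu) ^ n :=
      div_nonneg (boundary_nonneg _ _) (by linarith)
    simp only [hh]; linarith
  obtain ⟨z, hz, hz0⟩ := hzero X hX0 hXle
  have hbdd : BddBelow (Ici 0 ∩ h ⁻¹' {0}) := ⟨0, fun _ h => h.1⟩
  have hmem := hcl.csInf_mem ⟨z, hz.1, hz0⟩ hbdd
  set x₀ := sInf (Ici 0 ∩ h ⁻¹' {0})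
  refine ⟨x₀, lt_of_le_of_ne hmem.1 fun e => ?_, ?_, fun x' hx' => ?_⟩
  · have := hmem.2
    rw [← e] at this
    exact h0.ne' this
  · unfold IsFirstCrossing
    rw [hset]
    exact ⟨hmem, fun y hy => csInf_le hbdd hy⟩
  · rw [M.preimFun_eq n (boundary_nonneg G) hx'.1]
    by_contra! hle
    obtain ⟨z, hz, hz0⟩ := hzero x' hx'.1 (by simp only [hh]; linarith)
    exact absurd (csInf_le hbdd ⟨hz.1, hz0⟩) (not_le.2 (hz.2.trans_lt hx'.2))

/-- If `H` began strictly lower than `G` over some `x < x₀`, the point at height `max s (boundary H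
x)` would lie in `S^{-n}(G)` and in `H` but below `G`. The endpoint `x₀` follows by continuity. -/
theorem boundary_eq_of_inter_eq {G H : Set (ℝ × ℝ)} (hG : IsUpRegion G) (hH : IsUpRegion H)
    (hGH : G ⊆ H) {n : ℕ} (hinter : M.preim n G ∩ G = M.preim n G ∩ H) {x₀ : ℝ} (hx₀ : 0 < x₀)
    (hlt : ∀ x ∈ Ico 0 x₀, M.preimFun n (boundary G) x < boundary G x) :
    ∀ x ∈ Icc 0 x₀, boundary G x = boundary H x := by
  have ha : 0 < (1 + 1 / M.mu) ^ n := pow_pos (by linarith [M.inv_mu_pos]) n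
  have hb : 0 < (1 - 1 / M.mu) ^ n := pow_pos (by linarith [M.inv_mu_lt_one]) n
  have key : ∀ x ∈ Ico 0 x₀, boundary G x = boundary H x := by
    intro x hx
    have h1 : boundary H x ≤ boundary G x :=
      (hH.mem_iff hx.1 (boundary_nonneg G x)).1 (hGH (hG.boundary_mem hx.1))
    refine le_antisymm ?_ h1
    by_contra! hcon
    have h2 := hlt x hx
    rw [M.preimFun_eq n (boundary_nonneg G) hx.1] at h2
    set s := boundary G ((1 - 1 / M.mu) ^ n * x) / (1 + 1 / M.mu) ^ n with hs
    have hs0 : 0 ≤ s := div_nonneg (boundary_nonneg _ _) ha.le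
    have hy0 : 0 ≤ max s (boundary H x) := hs0.trans (le_max_left _ _)
    have hpre : (x, max s (boundary H x)) ∈ M.preim n G := by
      refine (M.mem_preim hG.sub n _).2 ⟨⟨hx.1, hy0⟩, ?_⟩
      refine (hG.mem_iff (mul_nonneg hb.le hx.1) (mul_nonneg ha.le hy0)).2 ?_
      exact (div_le_iff₀' ha).1 (le_max_left _ _)
    have hin : (x, max s (boundary H x)) ∈ M.preim n G ∩ H :=
      ⟨hpre, (hH.mem_iff hx.1 hy0).2 (le_max_right _ _)⟩
    rw [← hinter] at hin
    exact absurd ((hG.mem_iff hx.1 hy0).1 hin.2) (not_le.2 (max_lt h2 hcon))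
  have hcl : closure (Ico 0 x₀) = Icc 0 x₀ := closure_Ico hx₀.ne
  intro x hx
  have hcG := hG.continuousOn_boundary.mono (Icc_subset_Ici_self : Icc 0 x₀ ⊆ _)
  have hcH := hH.continuousOn_boundary.mono (Icc_subset_Ici_self : Icc 0 x₀ ⊆ _)
  exact Set.EqOn.of_subset_closure key hcG hcH Ico_subset_Icc_self hcl.ge hx

/-- Evaluating `S^{-n}[f]` on `[0, x₀]` uses `f` only at points `(1 - 1/μ)^n x ≤ x`, which stay in
that interval. -/
theorem isFirstCrossing_congr {f f' : ℝ → ℝ} (hf : ∀ x, 0 ≤ f x) (hf' : ∀ x, 0 ≤ f' x) {n : ℕ}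
    {x₀ : ℝ} (h : M.IsFirstCrossing n f x₀) (heq : ∀ x ∈ Icc 0 x₀, f x = f' x) :
    M.IsFirstCrossing n f' x₀ := by
  have hb : 0 < (1 - 1 / M.mu) ^ n := pow_pos (by linarith [M.inv_mu_lt_one]) n
  have hb1 : (1 - 1 / M.mu) ^ n ≤ 1 :=
    pow_le_one₀ (by linarith [M.inv_mu_lt_one]) (by linarith [M.inv_mu_pos])
  have e : ∀ x ∈ Icc 0 x₀, M.preimFun n f x = M.preimFun n f' x := fun x hx => by
    rw [M.preimFun_eq n hf hx.1, M.preimFun_eq n hf' hx.1, heq]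
    exact ⟨mul_nonneg hb.le hx.1, (mul_le_of_le_one_left hx.1 hb1).trans hx.2⟩
  have hm := h.1
  refine ⟨⟨hm.1, ?_⟩, fun y hy => ?_⟩
  · rw [← e x₀ ⟨hm.1, le_rfl⟩, ← heq x₀ ⟨hm.1, le_rfl⟩]; exact hm.2
  · by_contra! hlt
    refine absurd (h.2 ⟨hy.1, ?_⟩) (not_le.2 hlt)
    rw [e y ⟨hy.1, hlt.le⟩, heq y ⟨hy.1, hlt.le⟩]; exact hy.2

end Params

/-! ### The stopping regions -/

namespace Params

variable (M : Params)

theorem expMeasure_real_Iic {x : ℝ} (hx : 0 ≤ x) :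
    (expMeasure M.mu).real (Iic x) = 1 - Real.exp (-(M.mu * x)) := by
  rw [← cdf_eq_real, cdf_expMeasure_eq M.mu_pos, if_pos hx]

theorem expMeasure_real_le (t : ℝ≥0∞) :
    (expMeasure M.mu).real {a : ℝ | ENNReal.ofReal a ≤ t} ≤ M.mu * (min t 1).toReal := by
  rcases le_total 1 t with h | h
  · rw [min_eq_right h, ENNReal.toReal_one, mul_one]
    exact measureReal_le_one.trans M.one_lt_mu.le
  · have ht : t ≠ ∞ := ne_top_of_le_ne_top ENNReal.one_ne_top h
    have e : {a : ℝ | ENNReal.ofReal a ≤ t} = Iic t.toReal := by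
      ext a
      exact ENNReal.ofReal_le_iff_le_toReal ht
    rw [e, min_eq_left h, M.expMeasure_real_Iic ENNReal.toReal_nonneg]
    linarith [Real.add_one_le_exp (-(M.mu * t.toReal))]

theorem expMeasure_real_Ioi_one : (expMeasure M.mu).real (Ioi 1) = Real.exp (-M.mu) := by
  rw [← compl_Iic, probReal_compl_eq_one_sub measurableSet_Iic,
    M.expMeasure_real_Iic zero_le_one]
  simp

/-- If the running cost is at least this constant along the flow, then it is optimal to stop. -/
noncomputable def costLevel : ℝ := M.kap * M.mu * Real.exp (M.lam + M.mu)

theorem le_one_sub_exp {s : ℝ} (h0 : 0 ≤ s) (h1 : s ≤ 1) :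
    M.lam * s * Real.exp (-M.lam) ≤ 1 - Real.exp (-M.lam * s) := by
  have hl := M.lam_pos
  have h2 : Real.exp (-M.lam) ≤ Real.exp (-M.lam * s) := Real.exp_le_exp.2 (by nlinarith)
  have h3 := Real.add_one_le_exp (M.lam * s)
  have h4 : Real.exp (-M.lam * s) * Real.exp (M.lam * s) = 1 := by
    rw [← Real.exp_add]; simp
  have h5 := Real.exp_pos (-M.lam * s)
  have h6 : 0 ≤ M.lam * s := by positivity
  nlinarith

/-- Waiting can gain at most `kap`, and only if a jump occurs by time `t`. It costs at least a
multiple of `t ∧ 1` on the event that the first jump comes after time `1`. -/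
theorem le_stepVal_of_costLevel_le {w : ℝ × ℝ → ℝ} (hw : M.Adm w) (t : ℝ≥0∞)
    {p : ℝ × ℝ} (hp : p ∈ quadrant) (h : ∀ u : ℝ, 0 ≤ u → M.costLevel ≤ M.g (M.flow u p))
    {a : ℝ} (ha : 0 ≤ a) :
    (Ioi (1 : ℝ)).indicator (fun _ => M.costLevel * (min t 1).toReal * Real.exp (-M.lam)) a -
      {a : ℝ | ENNReal.ofReal a ≤ t}.indicator (fun _ => M.kap) a ≤ M.stepVal w t p a := by
  have hl := M.lam_pos
  have hk : 0 < M.costLevel := mul_pos (mul_pos M.kap_pos M.mu_pos) (Real.exp_pos _)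
  set σ := (min t (ENNReal.ofReal a)).toReal with hσ
  have h1 : M.costLevel / M.lam * (1 - Real.exp (-M.lam * σ)) ≤ M.costTo p σ :=
    M.le_costTo (fun u hu => by rw [div_mul_cancel₀ _ hl.ne']; exact h u hu) (stepTime_nonneg t a)
  unfold stepVal
  rw [sub_eq_add_neg]
  refine add_le_add (le_trans ?_ h1) ?_
  · by_cases ha1 : a ∈ Ioi (1 : ℝ)
    · rw [indicator_of_mem ha1]
      have hs1 : (min t 1).toReal ≤ 1 :=
        (ENNReal.toReal_mono ENNReal.one_ne_top (min_le_right t 1)).trans ENNReal.toReal_one.le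
      have h2 := M.le_one_sub_exp (ENNReal.toReal_nonneg (a := min t 1)) hs1
      have h3 : (min t 1).toReal ≤ σ := by
        refine ENNReal.toReal_mono (ne_top_of_le_ne_top ENNReal.ofReal_ne_top (min_le_right _ _)) ?_
        exact min_le_min le_rfl (by simpa using ENNReal.ofReal_le_ofReal (le_of_lt ha1))
      have h4 : Real.exp (-M.lam * σ) ≤ Real.exp (-M.lam * (min t 1).toReal) :=
        Real.exp_le_exp.2 (by nlinarith)
      have h5 : M.lam * (min t 1).toReal * Real.exp (-M.lam) ≤ 1 - Real.exp (-M.lam * σ) := by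
        linarith
      refine le_trans (le_of_eq ?_) (mul_le_mul_of_nonneg_left h5 (div_pos hk hl).le)
      field_simp
    · rw [indicator_of_notMem ha1]
      refine mul_nonneg (div_pos hk hl).le (sub_nonneg.2 ?_)
      exact M.exp_le_one_of_nonneg (stepTime_nonneg t a)
  · by_cases hat : ENNReal.ofReal a ≤ t
    · rw [if_pos hat, indicator_of_mem (by exact hat)]
      have h2 := hw.lb _ (M.jump_mem (M.flow_mem hp ha))
      nlinarith [M.kap_pos, Real.exp_pos (-M.lam * a), M.exp_le_one_of_nonneg ha]
    · rw [if_neg hat, indicator_of_notMem (by exact hat), neg_zero]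

section Jumps

variable {Ω : Type*} [MeasurableSpace Ω] {P : Measure Ω} (N : PoissonProcess P M.mu)

theorem J_nonneg_of_costLevel_le {w : ℝ × ℝ → ℝ} (hw : M.Adm w) (t : ℝ≥0∞)
    {p : ℝ × ℝ} (hp : p ∈ quadrant) (h : ∀ u : ℝ, 0 ≤ u → M.costLevel ≤ M.g (M.flow u p)) :
    0 ≤ M.J N w t p := by
  have hk := M.kap_pos
  rw [M.J_eq N hw t hp]
  have hm : MeasurableSet {a : ℝ | ENNReal.ofReal a ≤ t} :=
    measurableSet_le (by fun_prop) measurable_const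
  have i1 := (integrable_const (M.costLevel * (min t 1).toReal * Real.exp (-M.lam))
    (μ := expMeasure M.mu)).indicator (measurableSet_Ioi (a := (1 : ℝ)))
  have i2 := (integrable_const M.kap (μ := expMeasure M.mu)).indicator hm
  refine le_trans ?_ (integral_mono_ae (i1.sub i2) (M.integrable_stepVal hw t hp)
    (ae_expMeasure_pos.mono fun a ha => M.le_stepVal_of_costLevel_le hw t hp h ha.le))
  simp only [Pi.sub_apply]
  rw [integral_sub i1 i2, integral_indicator_const _ measurableSet_Ioi,
    integral_indicator_const _ hm, expMeasure_real_Ioi_one, smul_eq_mul, smul_eq_mul]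
  -- The constant `costLevel` is chosen so that the expected running cost exactly matches the bound
  -- `kap μ (t ∧ 1)` on the expected gain.
  have e : Real.exp (-M.mu) * (M.costLevel * (min t 1).toReal * Real.exp (-M.lam)) =
      M.mu * (min t 1).toReal * M.kap := by
    have : Real.exp (-M.mu) * Real.exp (-M.lam) * Real.exp (M.lam + M.mu) = 1 := by
      rw [← Real.exp_add, ← Real.exp_add]; simp
    unfold costLevel
    linear_combination M.kap * M.mu * (min t 1).toReal * this
  rw [e]
  have := mul_le_mul_of_nonneg_right (M.expMeasure_real_le t) hk.le
  linarith

theorem mem_Gamman_of_costLevel_le (n : ℕ) {p : ℝ × ℝ} (hp : p ∈ quadrant)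
    (h : ∀ u : ℝ, 0 ≤ u → M.costLevel ≤ M.g (M.flow u p)) : p ∈ M.Gamman N n := by
  cases n with
  | zero => exact ⟨hp, rfl⟩
  | succ n => exact ⟨hp, le_antisymm ((M.adm_vn N (n + 1)).ub p hp)
      (le_ciInf fun t => M.J_nonneg_of_costLevel_le N (M.adm_vn N n) t hp h)⟩

theorem mem_Gamma_of_costLevel_le {p : ℝ × ℝ} (hp : p ∈ quadrant)
    (h : ∀ u : ℝ, 0 ≤ u → M.costLevel ≤ M.g (M.flow u p)) : p ∈ M.Gamma N := by
  rw [Gamma_eq_iInter]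
  exact mem_iInter.2 fun n => M.mem_Gamman_of_costLevel_le N n hp h

theorem exists_fst_mem_Gamma : ∃ x, (x, 0) ∈ M.Gamma N := by
  set X := |M.costLevel + M.lam * M.kap| with hX
  have hXn : 0 ≤ X := abs_nonneg _
  have hp : (X, (0 : ℝ)) ∈ quadrant := ⟨hXn, le_rfl⟩
  refine ⟨X, M.mem_Gamma_of_costLevel_le N hp fun u hu => ?_⟩
  rw [g_eq]
  have h1 := (M.flow_mem hp hu).2
  have h2 : X ≤ (M.flow u (X, 0)).1 := by
    change X ≤ M.flowX u X
    rw [flowX_eq]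
    have := M.flowX_zero_nonneg hu
    have : 1 ≤ Real.exp ((M.lam + 1) * u) :=
      Real.one_le_exp (mul_nonneg (by linarith [M.lam_pos]) hu)
    nlinarith
  have := le_abs_self (M.costLevel + M.lam * M.kap)
  linarith

/-- For `λ < 1` the second coordinate may decay, but at rate at most `1`, so starting from `e^U X`
it stays above `X` until time `U`. By then the first coordinate, fed by its constant drift, has
itself reached `X`. -/
theorem exists_snd_mem_Gamma : ∃ y, (0, y) ∈ M.Gamma N := by
  have hl := M.lam_pos
  set X := |M.costLevel + M.lam * M.kap| with hX
  have hXn : 0 ≤ X := abs_nonneg _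
  have hle := le_abs_self (M.costLevel + M.lam * M.kap)
  set κ := M.lam * (1 - M.m) / (√2 * (M.lam + 1)) with hκ
  have hκ0 : 0 < κ := div_pos (mul_pos hl (by linarith [M.m_lt_one])) (by positivity)
  set U := X / κ with hU
  have hU0 : 0 ≤ U := div_nonneg hXn hκ0.le
  have hp : ((0 : ℝ), Real.exp U * X) ∈ quadrant := ⟨le_rfl, by positivity⟩
  refine ⟨Real.exp U * X, M.mem_Gamma_of_costLevel_le N hp fun u hu => ?_⟩
  rw [g_eq]
  have hm := M.flow_mem hp hu
  have h1 := hm.1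
  have h2 := hm.2
  rcases le_total u U with huU | huU
  · have h3 : X ≤ (M.flow u (0, Real.exp U * X)).2 := by
      change X ≤ M.flowY u (Real.exp U * X)
      rw [flowY_eq, ← mul_assoc, ← Real.exp_add]
      have h4 := M.flowY_zero_nonneg hu
      have : 1 ≤ Real.exp ((M.lam - 1) * u + U) := Real.one_le_exp (by nlinarith)
      nlinarith
    linarith
  · have h3 : X ≤ (M.flow u (0, Real.exp U * X)).1 := by
      change X ≤ M.flowX u 0
      rw [flowX_zero_eq]
      have h4 := Real.add_one_le_exp ((M.lam + 1) * u)
      have h5 : U ≤ Real.exp ((M.lam + 1) * u) - 1 := by nlinarith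
      have h6 : κ * U = X := by rw [hU]; field_simp
      rw [← h6]
      exact mul_le_mul_of_nonneg_left h5 hκ0.le
    linarith

/-- At the origin the running cost is negative, and by continuity it remains so for a short time
`δ`; waiting until `δ` has negative cost. -/
theorem zero_notMem_Gamman_one : ((0 : ℝ), (0 : ℝ)) ∉ M.Gamman N 1 := by
  intro hmem
  have h0 : ((0 : ℝ), (0 : ℝ)) ∈ quadrant := ⟨le_rfl, le_rfl⟩
  have hg0 : M.g (M.flow 0 (0, 0)) < 0 := by
    rw [flow_zero, g_eq]
    have := mul_pos M.lam_pos M.kap_pos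
    simp only; linarith
  have hcont : Continuous fun u : ℝ => M.g (M.flow u (0, 0)) :=
    M.continuous_g.comp (M.continuous_flow continuous_id continuous_const)
  obtain ⟨δ, hδ, hneg⟩ : ∃ δ > 0, ∀ u ∈ Ioo 0 δ, M.g (M.flow u (0, 0)) < 0 := by
    obtain ⟨δ, hδ, h⟩ := Metric.eventually_nhds_iff.1 (hcont.continuousAt.eventually_lt_const hg0)
    refine ⟨δ, hδ, fun u hu => h ?_⟩
    rw [Real.dist_eq, sub_zero, abs_of_pos hu.1]; exact hu.2
  have hstep : ∀ a : ℝ, 0 < a → M.stepVal (M.vn N 0) (ENNReal.ofReal δ) (0, 0) a < 0 := by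
    intro a ha
    have e : M.stepVal (M.vn N 0) (ENNReal.ofReal δ) (0, 0) a = M.costTo (0, 0) (min δ a) := by
      unfold stepVal
      rw [← ENNReal.ofReal_min, ENNReal.toReal_ofReal (le_min hδ.le ha.le)]
      simp [vn]
    rw [e, ← neg_pos, costTo, ← intervalIntegral.integral_neg]
    refine intervalIntegral.intervalIntegral_pos_of_pos_on
      ((M.continuous_running _).neg.intervalIntegrable _ _) (fun u hu => ?_) (lt_min hδ ha)
    have := mul_pos_of_neg_of_neg (neg_neg_of_pos (Real.exp_pos (-M.lam * u)))
      (hneg u ⟨hu.1, hu.2.trans_le (min_le_left _ _)⟩)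
    linarith
  have hw := M.adm_vn N 0
  have h1 : 0 ≤ M.J N (M.vn N 0) (ENNReal.ofReal δ) (0, 0) := by
    exact hmem.2.ge.trans (M.J0_le_J N hw _ h0)
  rw [M.J_eq N hw _ h0] at h1
  have hae : ∀ᵐ a ∂expMeasure M.mu, M.stepVal (M.vn N 0) (ENNReal.ofReal δ) (0, 0) a < 0 :=
    ae_expMeasure_pos.mono hstep
  have hint := M.integrable_stepVal hw (ENNReal.ofReal δ) h0
  have h2 : ∫ a, M.stepVal (M.vn N 0) (ENNReal.ofReal δ) (0, 0) a ∂expMeasure M.mu = 0 :=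
    le_antisymm (integral_nonpos_of_ae (hae.mono fun a ha => ha.le)) h1
  -- A nonpositive integrand with integral zero vanishes almost everywhere, contrary to its strict
  -- negativity.
  have h3 := (integral_eq_zero_iff_of_nonneg_ae (hae.mono fun a ha => neg_nonneg.2 ha.le)
    hint.neg).1 (by
      change ∫ a, -M.stepVal (M.vn N 0) (ENNReal.ofReal δ) (0, 0) a ∂expMeasure M.mu = 0
      rw [integral_neg, h2, neg_zero])
  obtain ⟨a, ha, ha'⟩ := (hae.and h3).exists
  simp only [Pi.zero_apply, neg_eq_zero] at ha'
  exact ha.ne ha'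

theorem Gamman_anti {n k : ℕ} (h : n ≤ k) : M.Gamman N k ⊆ M.Gamman N n := fun p hp =>
  ⟨hp.1, le_antisymm ((M.adm_vn N n).ub p hp.1) (hp.2 ▸ M.vn_antitone N hp.1 h)⟩

theorem isUpRegion_Gamman {n : ℕ} (hn : 1 ≤ n) : IsUpRegion (M.Gamman N n) where
  sub := fun _ h => h.1
  closed := M.isClosed_Gamman N n
  convex := M.convex_Gamman N n
  up := fun _ hp _ h => M.Gamman_upward N n hp h
  meets_fst := (M.exists_fst_mem_Gamma N).imp fun _ h => M.Gamma_subset_Gamman N n h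
  meets_snd := (M.exists_snd_mem_Gamma N).imp fun _ h => M.Gamma_subset_Gamman N n h
  zero_notMem := fun h => M.zero_notMem_Gamman_one N (M.Gamman_anti N hn h)

theorem isUpRegion_Gamma : IsUpRegion (M.Gamma N) where
  sub := fun _ h => h.1
  closed := by
    rw [Gamma_eq_iInter]; exact isClosed_iInter fun n => M.isClosed_Gamman N n
  convex := by
    rw [Gamma_eq_iInter]; exact convex_iInter fun n => M.convex_Gamman N n
  up := by
    rw [Gamma_eq_iInter]
    exact fun p hp q h => mem_iInter.2 fun n => M.Gamman_upward N n (mem_iInter.1 hp n) h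
  meets_fst := M.exists_fst_mem_Gamma N
  meets_snd := M.exists_snd_mem_Gamma N
  zero_notMem := fun h => M.zero_notMem_Gamman_one N (M.Gamma_subset_Gamman N 1 h)

/-! ### Consequences of the closedness condition -/

/-- From `S^{-n}(Γ)`, any `n` jumps separated by flow lead into `Γ`, where nothing remains to be
gained. Iterations beyond the `n`-th therefore change nothing. -/
theorem vn_eq_of_mem_preim (hclosed : M.FlowClosed N) (n : ℕ) :
    ∀ k, n ≤ k → ∀ p ∈ M.preim n (M.Gamma N), M.vn N k p = M.vn N n p := by
  induction n with
  | zero => exact fun k _ p hp => (M.Gamma_subset_Gamman N k hp).2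
  | succ n ih =>
    intro k hk p hp
    obtain ⟨k, rfl⟩ : ∃ j, k = j + 1 := ⟨k - 1, by omega⟩
    have hpq : p ∈ quadrant := ((M.mem_preim (fun _ h => h.1) _ _).1 hp).1
    refine iInf_congr fun t => M.J_congr N (M.adm_vn N k) (M.adm_vn N n) hpq (fun a ha => ?_) t
    refine ih k (by omega) _ ?_
    -- Flow first, inside `S^{-(n+1)}(Γ)`; the outermost preimage then says that the jump lands in
    -- `S^{-n}(Γ)`.
    have h1 := hclosed (n + 1) (by omega) p hp a ha
    unfold preim at h1
    rw [Function.iterate_succ_apply'] at h1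
    exact h1.2

theorem v_eq_of_mem_preim (hclosed : M.FlowClosed N) {n k : ℕ} (hk : n ≤ k) {p : ℝ × ℝ}
    (hpq : p ∈ quadrant) (hp : p ∈ M.preim n (M.Gamma N)) : M.v N p = M.vn N k p := by
  refine tendsto_nhds_unique (M.tendsto_vn N hpq) (tendsto_const_nhds.congr' ?_)
  filter_upwards [eventually_ge_atTop n] with j hj
  rw [M.vn_eq_of_mem_preim N hclosed n k hk p hp, M.vn_eq_of_mem_preim N hclosed n j hj p hp]

theorem preim_inter_Gamma (hclosed : M.FlowClosed N) {n k : ℕ} (hk : n ≤ k) :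
    M.preim n (M.Gamma N) ∩ M.Gamma N = M.preim n (M.Gamma N) ∩ M.Gamman N k := by
  ext p
  refine and_congr_right fun hp => and_congr_right fun hpq => ?_
  rw [M.v_eq_of_mem_preim N hclosed hk hpq hp]

theorem preim_inter_C (hclosed : M.FlowClosed N) {n k : ℕ} (hk : n ≤ k) :
    M.preim n (M.Gamma N) ∩ M.C N = M.preim n (M.Gamma N) ∩ M.Cn N k := by
  ext p
  refine and_congr_right fun hp => and_congr_right fun hpq => not_congr ?_
  refine and_congr_right fun _ => ?_
  rw [M.v_eq_of_mem_preim N hclosed hk hpq hp]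

/-- The point `0` lies left of every first crossing, so one iteration already finds `γ(0)`. -/
theorem gamma_zero_eq (hclosed : M.FlowClosed N) : M.gamma N 0 = M.gamman N 1 0 := by
  obtain ⟨x, hx, _, hlt⟩ := M.exists_isFirstCrossing (M.isUpRegion_Gamma N) le_rfl
  exact M.boundary_eq_of_inter_eq (M.isUpRegion_Gamma N) (M.isUpRegion_Gamman N le_rfl)
    (M.Gamma_subset_Gamman N 1) (M.preim_inter_Gamma N hclosed le_rfl) hx hlt 0 ⟨le_rfl, hx.le⟩

/-- The factor `(μ/(μ+1))^n` is the inverse of the vertical stretching by `n` jumps, and `γ` is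
largest at `0`. -/
theorem strip_subset_preim (hclosed : M.FlowClosed N) {B : ℝ} (hB : 0 < B) {n : ℕ}
    (h : (M.mu / (M.mu + 1)) ^ n * M.gamman N 1 0 < B) :
    Ici (0 : ℝ) ×ˢ Ici B ⊆ M.preim n (M.Gamma N) := by
  intro p hp
  have hp1 : 0 ≤ p.1 := hp.1
  have hp2 : B ≤ p.2 := hp.2
  have hG := M.isUpRegion_Gamma N
  have ha : 0 < (1 + 1 / M.mu) ^ n := pow_pos (by linarith [M.inv_mu_pos]) n
  have hb : 0 < (1 - 1 / M.mu) ^ n := pow_pos (by linarith [M.inv_mu_lt_one]) n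
  have hp2' : 0 ≤ p.2 := hB.le.trans hp2
  refine (M.mem_preim hG.sub n p).2 ⟨⟨hp1, hp2'⟩, ?_⟩
  refine (hG.mem_iff (mul_nonneg hb.le hp1) (mul_nonneg ha.le hp2')).2 ?_
  refine (hG.boundary_anti le_rfl (mul_nonneg hb.le hp1)).trans ?_
  have e : boundary (M.Gamma N) 0 = M.gamman N 1 0 := M.gamma_zero_eq N hclosed
  rw [e]
  have e1 : (1 + 1 / M.mu) ^ n * (M.mu / (M.mu + 1)) ^ n = 1 := by
    have := M.mu_pos
    have : (1 + 1 / M.mu) * (M.mu / (M.mu + 1)) = 1 := by field_simp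
    rw [← mul_pow, this, one_pow]
  calc M.gamman N 1 0 = (1 + 1 / M.mu) ^ n * ((M.mu / (M.mu + 1)) ^ n * M.gamman N 1 0) := by
        rw [← mul_assoc, e1, one_mul]
    _ ≤ (1 + 1 / M.mu) ^ n * p.2 := mul_le_mul_of_nonneg_left (h.le.trans hp2) ha.le

end Jumps

end Params

/-! ### Sequences of interarrival times -/

/-- The sequence without its first term. -/
def shift (a : ℕ → ℝ) : ℕ → ℝ := fun n => a (n + 1)

/-- The sequence `b` with the new first term `x`. -/
def seqCons (x : ℝ) (b : ℕ → ℝ) : ℕ → ℝ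
  | 0 => x
  | n + 1 => b n

/-- The arrival times that belong to a sequence of interarrival times. -/
def arrival (a : ℕ → ℝ) (n : ℕ) : ℝ := ∑ i ∈ Finset.range n, a i

/-- The number of arrivals in `[0, t]`. -/
noncomputable def arrivalCount (a : ℕ → ℝ) (t : ℝ) : ℕ := sSup {n : ℕ | arrival a n ≤ t}

/-- A sequence of positive interarrival times without accumulation of arrivals. -/
def Regular (a : ℕ → ℝ) : Prop := (∀ n, 0 < a n) ∧ ∀ m : ℕ, ∃ n, (m : ℝ) < arrival a n

@[simp] theorem seqCons_zero (x : ℝ) (b : ℕ → ℝ) : seqCons x b 0 = x := rfl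

@[simp] theorem shift_seqCons (x : ℝ) (b : ℕ → ℝ) : shift (seqCons x b) = b := rfl

theorem measurable_seqCons : Measurable fun q : ℝ × (ℕ → ℝ) => seqCons q.1 q.2 := by
  refine measurable_pi_lambda _ fun n => ?_
  cases n with
  | zero => exact measurable_fst
  | succ n => exact (measurable_pi_apply n).comp measurable_snd

@[fun_prop]
theorem measurable_shift : Measurable shift :=
  measurable_pi_lambda _ fun n => measurable_pi_apply (n + 1)

@[simp] theorem arrival_zero (a : ℕ → ℝ) : arrival a 0 = 0 := by simp [arrival]

theorem arrival_succ (a : ℕ → ℝ) (n : ℕ) : arrival a (n + 1) = arrival a n + a n :=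
  Finset.sum_range_succ _ _

theorem arrival_succ' (a : ℕ → ℝ) (n : ℕ) : arrival a (n + 1) = a 0 + arrival (shift a) n := by
  rw [arrival, Finset.sum_range_succ', add_comm]; rfl

theorem measurable_arrival (n : ℕ) : Measurable fun a => arrival a n := by
  unfold arrival; fun_prop

namespace Regular

variable {a : ℕ → ℝ}

theorem arrival_mono (ha : Regular a) : Monotone (arrival a) :=
  monotone_nat_of_le_succ fun n => by rw [arrival_succ]; linarith [ha.1 n]

theorem arrival_nonneg (ha : Regular a) (n : ℕ) : 0 ≤ arrival a n := by
  simpa using ha.arrival_mono (Nat.zero_le n)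

theorem exists_lt_arrival (ha : Regular a) (t : ℝ) : ∃ n, t < arrival a n := by
  obtain ⟨m, hm⟩ := exists_nat_ge t
  exact (ha.2 m).imp fun n h => hm.trans_lt h

theorem le_arrivalCount_iff (ha : Regular a) {t : ℝ} (ht : 0 ≤ t) (n : ℕ) :
    n ≤ arrivalCount a t ↔ arrival a n ≤ t := by
  have hne : {n : ℕ | arrival a n ≤ t}.Nonempty := ⟨0, by simpa using ht⟩
  have hbdd : BddAbove {n : ℕ | arrival a n ≤ t} := by
    obtain ⟨b, hb⟩ := ha.exists_lt_arrival t
    refine ⟨b, fun k hk => ?_⟩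
    by_contra! hlt
    exact absurd (hb.trans_le (ha.arrival_mono hlt.le)) (not_lt.mpr hk)
  exact ⟨fun h => (ha.arrival_mono h).trans (Nat.sSup_mem hne hbdd), fun h => le_csSup hbdd h⟩

theorem arrivalCount_eq_iff (ha : Regular a) {t : ℝ} (ht : 0 ≤ t) (n : ℕ) :
    arrivalCount a t = n ↔ arrival a n ≤ t ∧ t < arrival a (n + 1) := by
  rw [← ha.le_arrivalCount_iff ht, ← not_le, ← ha.le_arrivalCount_iff ht]
  omega

protected theorem shift (ha : Regular a) : Regular (shift a) := by
  refine ⟨fun n => ha.1 (n + 1), fun m => ?_⟩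
  obtain ⟨n, hn⟩ := ha.exists_lt_arrival (a 0 + m)
  refine ⟨n, ?_⟩
  have := ha.arrival_mono n.le_succ
  rw [arrival_succ'] at this
  linarith

theorem cons (ha : Regular a) {x : ℝ} (hx : 0 < x) : Regular (seqCons x a) := by
  refine ⟨fun n => ?_, fun m => ?_⟩
  · cases n with
    | zero => exact hx
    | succ n => exact ha.1 n
  · obtain ⟨n, hn⟩ := ha.2 m
    refine ⟨n + 1, ?_⟩
    rw [arrival_succ', shift_seqCons, seqCons_zero]
    linarith

theorem arrivalCount_add (ha : Regular a) {s : ℝ} (hs : 0 ≤ s) :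
    arrivalCount a (a 0 + s) = arrivalCount (shift a) s + 1 := by
  rw [ha.arrivalCount_eq_iff (by linarith [ha.1 0]), arrival_succ', arrival_succ']
  have := (ha.shift.arrivalCount_eq_iff hs _).1 rfl
  constructor <;> linarith [this.1, this.2]

theorem arrivalCount_of_lt (ha : Regular a) {t : ℝ} (ht : 0 ≤ t) (h : t < a 0) :
    arrivalCount a t = 0 := by
  rw [ha.arrivalCount_eq_iff ht, arrival_succ', arrival_zero, arrival_zero]
  exact ⟨ht, by linarith⟩

end Regular

theorem measurableSet_regular : MeasurableSet {a : ℕ → ℝ | Regular a} := by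
  have e : {a : ℕ → ℝ | Regular a} =
      (⋂ n, {a | 0 < a n}) ∩ ⋂ m : ℕ, ⋃ n, {a | (m : ℝ) < arrival a n} := by
    ext a
    simp [Regular]
  rw [e]
  exact (MeasurableSet.iInter fun n => measurableSet_lt measurable_const (measurable_pi_apply n)).inter
    (MeasurableSet.iInter fun m => MeasurableSet.iUnion fun n =>
      measurableSet_lt measurable_const (measurable_arrival n))

/-! ### Costs along a path, leg by leg -/

namespace Params

variable (M : Params)

/-- The state after the `n`-th arrival. -/
noncomputable def post (p : ℝ × ℝ) (a : ℕ → ℝ) : ℕ → ℝ × ℝ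
  | 0 => p
  | n + 1 => M.jump (M.flow (a n) (post p a n))

/-- The path with the interarrival times `a`. -/
noncomputable def path (p : ℝ × ℝ) (a : ℕ → ℝ) (t : ℝ) : ℝ × ℝ :=
  M.flow (t - arrival a (arrivalCount a t)) (M.post p a (arrivalCount a t))

theorem post_succ' (p : ℝ × ℝ) (a : ℕ → ℝ) (n : ℕ) :
    M.post p a (n + 1) = M.post (M.jump (M.flow (a 0) p)) (shift a) n := by
  induction n with
  | zero => rfl
  | succ n ih =>
    rw [post, ih]; rfl

theorem path_add {a : ℕ → ℝ} (ha : Regular a) (p : ℝ × ℝ) {s : ℝ} (hs : 0 ≤ s) :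
    M.path p a (a 0 + s) = M.path (M.jump (M.flow (a 0) p)) (shift a) s := by
  unfold path
  rw [ha.arrivalCount_add hs, post_succ', arrival_succ', add_sub_add_left_eq_sub]

theorem path_of_lt {a : ℕ → ℝ} (ha : Regular a) (p : ℝ × ℝ) {t : ℝ} (ht : 0 ≤ t) (h : t < a 0) :
    M.path p a t = M.flow t p := by
  unfold path
  rw [ha.arrivalCount_of_lt ht h, arrival_zero, sub_zero, post]

/-- The discounted integral of `h` along the flow until the time `T ∧ s`. -/
noncomputable def legCost (h : ℝ × ℝ → ℝ≥0∞) (p : ℝ × ℝ) (T : ℝ≥0∞) (s : ℝ) : ℝ≥0∞ :=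
  ∫⁻ t in Ico 0 (min T (ENNReal.ofReal s)).toReal,
    ENNReal.ofReal (Real.exp (-M.lam * t)) * h (M.flow t p)

/-- The discounted integral of `h` along the path until the minimum of `T` and the `n`-th arrival
time. -/
noncomputable def pathCost (h : ℝ × ℝ → ℝ≥0∞) : ℕ → ℝ × ℝ → (ℕ → ℝ) → ℝ≥0∞ → ℝ≥0∞
  | 0, _, _, _ => 0
  | n + 1, p, a, T => M.legCost h p T (a 0) + ENNReal.ofReal (Real.exp (-M.lam * a 0)) *
      pathCost h n (M.jump (M.flow (a 0) p)) (shift a) (T - ENNReal.ofReal (a 0))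

theorem measurable_legCost {h : ℝ × ℝ → ℝ≥0∞} (hh : Measurable h) {X : Type*} [MeasurableSpace X]
    {p : X → ℝ × ℝ} {T : X → ℝ≥0∞} {s : X → ℝ} (hp : Measurable p) (hT : Measurable T)
    (hs : Measurable s) : Measurable fun x => M.legCost h (p x) (T x) (s x) := by
  have e : (fun x => M.legCost h (p x) (T x) (s x)) = fun x => ∫⁻ t,
      {q : X × ℝ | 0 ≤ q.2 ∧ q.2 < (min (T q.1) (ENNReal.ofReal (s q.1))).toReal}.indicator
        (fun q => ENNReal.ofReal (Real.exp (-M.lam * q.2)) * h (M.flow q.2 (p q.1))) (x, t) := by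
    funext x
    rw [legCost, ← lintegral_indicator measurableSet_Ico]
    rfl
  rw [e]
  refine Measurable.lintegral_prod_right' (Measurable.indicator ?_ ?_)
  · fun_prop
  · exact (measurableSet_le measurable_const measurable_snd).inter
      (measurableSet_lt measurable_snd (by fun_prop))

theorem measurable_pathCost {h : ℝ × ℝ → ℝ≥0∞} (hh : Measurable h) (n : ℕ) {X : Type*}
    [MeasurableSpace X] {p : X → ℝ × ℝ} {a : X → ℕ → ℝ} {T : X → ℝ≥0∞} (hp : Measurable p)
    (ha : Measurable a) (hT : Measurable T) :
    Measurable fun x => M.pathCost h n (p x) (a x) (T x) := by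
  induction n generalizing p a T with
  | zero => exact measurable_const
  | succ n ih =>
    have ha0 : Measurable fun x => a x 0 := (measurable_pi_apply 0).comp ha
    exact (M.measurable_legCost hh hp hT ha0).add ((by fun_prop : Measurable fun x =>
      ENNReal.ofReal (Real.exp (-M.lam * a x 0))).mul (ih (by fun_prop) (by fun_prop)
        (hT.sub (by fun_prop))))

/-- Links the recursive cost, suited to induction over jumps, with the integral along the path. The
tail after the first arrival is a translated and discounted copy of the cost of the shifted
sequence. -/
theorem pathCost_eq (h : ℝ × ℝ → ℝ≥0∞) (n : ℕ) {a : ℕ → ℝ} (ha : Regular a) (p : ℝ × ℝ)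
    (T : ℝ≥0∞) : M.pathCost h n p a T =
      ∫⁻ t in {t : ℝ | 0 ≤ t ∧ ENNReal.ofReal t < T ∧ t < arrival a n},
        ENNReal.ofReal (Real.exp (-M.lam * t)) * h (M.path p a t) := by
  induction n generalizing p a T with
  | zero =>
    have : {t : ℝ | 0 ≤ t ∧ ENNReal.ofReal t < T ∧ t < arrival a 0} = ∅ := by
      ext t
      simp only [arrival_zero, mem_ofPred_eq, mem_empty_iff_false, iff_false]
      exact fun h => not_lt.2 h.1 h.2.2
    rw [pathCost, this, Measure.restrict_empty, lintegral_zero_measure]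
  | succ n ih =>
    have ha0 := ha.1 0
    set F : ℝ → ℝ≥0∞ := fun t => ENNReal.ofReal (Real.exp (-M.lam * t)) * h (M.path p a t) with hF
    rw [← lintegral_inter_add_sdiff F _ (measurableSet_Iio (a := a 0)), pathCost, ih ha.shift]
    congr 1
    · have e : {t : ℝ | 0 ≤ t ∧ ENNReal.ofReal t < T ∧ t < arrival a (n + 1)} ∩ Iio (a 0) =
          Ico 0 (min T (ENNReal.ofReal (a 0))).toReal := by
        ext t
        have hfin : min T (ENNReal.ofReal (a 0)) ≠ ∞ :=
          ne_top_of_le_ne_top ENNReal.ofReal_ne_top (min_le_right _ _)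
        have hle : a 0 ≤ arrival a (n + 1) := by
          rw [arrival_succ']; linarith [ha.shift.arrival_nonneg n]
        simp only [mem_inter_iff, mem_ofPred_eq, mem_Iio, mem_Ico]
        constructor
        · rintro ⟨⟨h1, h2, _⟩, h4⟩
          refine ⟨h1, (ENNReal.ofReal_lt_iff_lt_toReal h1 hfin).1 (lt_min h2 ?_)⟩
          exact (ENNReal.ofReal_lt_ofReal_iff ha0).2 h4
        · rintro ⟨h1, h2⟩
          have h3 := (ENNReal.ofReal_lt_iff_lt_toReal h1 hfin).2 h2
          have h4 := (ENNReal.ofReal_lt_ofReal_iff ha0).1 (h3.trans_le (min_le_right _ _))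
          exact ⟨⟨h1, h3.trans_le (min_le_left _ _), h4.trans_le hle⟩, h4⟩
      rw [e, legCost]
      refine setLIntegral_congr_fun measurableSet_Ico fun t ht => ?_
      have : t < a 0 := ht.2.trans_le (stepTime_le T ha0.le)
      simp only [hF, M.path_of_lt ha p ht.1 this]
    · have hm1 : MeasurableSet {t : ℝ | 0 ≤ t ∧ ENNReal.ofReal t < T - ENNReal.ofReal (a 0) ∧
          t < arrival (shift a) n} :=
        (measurableSet_le measurable_const measurable_id).inter
          ((measurableSet_lt ENNReal.measurable_ofReal measurable_const).inter
            (measurableSet_lt measurable_id measurable_const))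
      have hm2 : MeasurableSet
          ({t : ℝ | 0 ≤ t ∧ ENNReal.ofReal t < T ∧ t < arrival a (n + 1)} \ Iio (a 0)) :=
        ((measurableSet_le measurable_const measurable_id).inter
          ((measurableSet_lt ENNReal.measurable_ofReal measurable_const).inter
            (measurableSet_lt measurable_id measurable_const))).diff measurableSet_Iio
      -- Translation invariance of Lebesgue measure moves the time origin to the first arrival.
      rw [← lintegral_const_mul' _ _ ENNReal.ofReal_ne_top, ← lintegral_indicator hm1,
        ← lintegral_indicator hm2,
        ← lintegral_add_left_eq_self (indicator (_ \ _) F) (a 0)]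
      refine lintegral_congr fun s => ?_
      have hiff : s ∈ {t : ℝ | 0 ≤ t ∧ ENNReal.ofReal t < T - ENNReal.ofReal (a 0) ∧
          t < arrival (shift a) n} ↔ a 0 + s ∈
          {t : ℝ | 0 ≤ t ∧ ENNReal.ofReal t < T ∧ t < arrival a (n + 1)} \ Iio (a 0) := by
        simp only [mem_ofPred_eq, Set.mem_sdiff, mem_Iio, not_lt, arrival_succ', le_add_iff_nonneg_right,
          add_lt_add_iff_left]
        constructor
        · rintro ⟨h1, h2, h3⟩
          refine ⟨⟨by linarith, ?_, h3⟩, h1⟩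
          rw [add_comm, ENNReal.ofReal_add h1 ha0.le]
          exact lt_tsub_iff_right.1 h2
        · rintro ⟨⟨_, h2, h3⟩, h1⟩
          rw [add_comm, ENNReal.ofReal_add h1 ha0.le] at h2
          exact ⟨h1, lt_tsub_iff_right.2 h2, h3⟩
      by_cases hs : s ∈ {t : ℝ | 0 ≤ t ∧ ENNReal.ofReal t < T - ENNReal.ofReal (a 0) ∧
          t < arrival (shift a) n}
      · rw [indicator_of_mem hs, indicator_of_mem (hiff.1 hs)]
        simp only [hF, M.path_add ha p hs.1, mul_add, Real.exp_add,
          ENNReal.ofReal_mul (Real.exp_pos _).le, mul_assoc]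
      · rw [indicator_of_notMem hs, indicator_of_notMem (fun h => hs (hiff.2 h))]

theorem iSup_pathCost (h : ℝ × ℝ → ℝ≥0∞) {a : ℕ → ℝ} (ha : Regular a) (p : ℝ × ℝ) (T : ℝ≥0∞) :
    ⨆ n, M.pathCost h n p a T = ∫⁻ t in {t : ℝ | 0 ≤ t ∧ ENNReal.ofReal t < T},
        ENNReal.ofReal (Real.exp (-M.lam * t)) * h (M.path p a t) := by
  simp only [M.pathCost_eq h _ ha]
  rw [← setLIntegral_iUnion_of_directed]
  · congr 2
    ext t
    simp only [mem_iUnion, mem_ofPred_eq]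
    constructor
    · rintro ⟨n, h1, h2, _⟩
      exact ⟨h1, h2⟩
    · rintro ⟨h1, h2⟩
      exact (ha.exists_lt_arrival t).imp fun n hn => ⟨h1, h2, hn⟩
  · refine Monotone.directed_le fun m n hmn t ht => ⟨ht.1, ht.2.1, ht.2.2.trans_le ?_⟩
    exact ha.arrival_mono hmn

end Params

/-! ### The law of the interarrival times -/

/-- The law of a sequence of independent exponential random variables with rate `r`. -/
noncomputable def seqLaw (r : ℝ) : Measure (ℕ → ℝ) := Measure.infinitePi fun _ => expMeasure r

/-- Equality is checked on finite-dimensional boxes. Padding the index set to an initial segment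
with whole lines lets the factor with index `0` be split off. -/
theorem seqLaw_eq_map {r : ℝ} (hr : 0 < r) :
    seqLaw r = ((expMeasure r).prod (seqLaw r)).map fun q => seqCons q.1 q.2 := by
  have := isProbabilityMeasure_expMeasure hr
  have hprob : IsProbabilityMeasure (seqLaw r) := by unfold seqLaw; infer_instance
  symm
  refine Measure.eq_infinitePi _ fun s t ht => ?_
  classical
  set t' : ℕ → Set ℝ := fun i => if i ∈ s then t i else univ with ht'
  have hmt' : ∀ i, MeasurableSet (t' i) := fun i => by
    simp only [ht']; split_ifs
    · exact ht i
    · exact MeasurableSet.univ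
  obtain ⟨n, hn⟩ := s.exists_nat_subset_range
  have hs : s ⊆ Finset.range (n + 1) := hn.trans (Finset.range_subset_range.2 n.le_succ)
  have e1 : Set.pi (s : Set ℕ) t = Set.pi (Finset.range (n + 1) : Set ℕ) t' := by
    ext a
    simp only [Set.mem_pi, ht', Finset.mem_coe]
    constructor
    · intro h i _
      split_ifs with hi
      · exact h i hi
      · trivial
    · intro h i hi
      have := h i (hs hi)
      rwa [if_pos hi] at this
  have e2 : (fun q : ℝ × (ℕ → ℝ) => seqCons q.1 q.2) ⁻¹' Set.pi (Finset.range (n + 1) : Set ℕ) t' =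
      t' 0 ×ˢ Set.pi (Finset.range n : Set ℕ) fun i => t' (i + 1) := by
    ext ⟨x, b⟩
    simp only [mem_preimage, Set.mem_pi, Finset.mem_coe, Finset.mem_range, mem_prod]
    constructor
    · intro h
      exact ⟨h 0 (by omega), fun i hi => h (i + 1) (by omega)⟩
    · rintro ⟨h0, h⟩ i hi
      cases i with
      | zero => exact h0
      | succ i => exact h i (by omega)
  have hm : MeasurableSet (Set.pi (Finset.range (n + 1) : Set ℕ) t') :=
    MeasurableSet.pi (Finset.countable_toSet _) fun i _ => hmt' i
  have e3 : ∏ i ∈ s, expMeasure r (t i) = ∏ i ∈ Finset.range (n + 1), expMeasure r (t' i) := by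
    rw [← Finset.prod_subset hs fun i _ hi => by simp [ht', hi]]
    exact Finset.prod_congr rfl fun i hi => by simp [ht', hi]
  rw [e1, Measure.map_apply measurable_seqCons hm, e2, Measure.prod_prod, e3,
    Finset.prod_range_succ', mul_comm]
  congr 1
  exact Measure.infinitePi_pi _ fun i _ => hmt' (i + 1)

theorem lintegral_seqLaw {r : ℝ} (hr : 0 < r) {F : (ℕ → ℝ) → ℝ≥0∞} (hF : Measurable F) :
    ∫⁻ a, F a ∂seqLaw r = ∫⁻ x, ∫⁻ b, F (seqCons x b) ∂seqLaw r ∂expMeasure r := by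
  have := isProbabilityMeasure_expMeasure hr
  have hprob : IsProbabilityMeasure (seqLaw r) := by unfold seqLaw; infer_instance
  conv_lhs => rw [seqLaw_eq_map hr]
  rw [lintegral_map hF measurable_seqCons]
  exact lintegral_prod _ (hF.comp measurable_seqCons).aemeasurable

namespace PoissonProcess

variable {Ω : Type*} [MeasurableSpace Ω] {P : Measure Ω} {r : ℝ} (N : PoissonProcess P r)

/-- The sequence of interarrival times. -/
def gaps (ω : Ω) : ℕ → ℝ := fun n => N.gap n ω

theorem measurable_gaps : Measurable N.gaps := measurable_pi_lambda _ N.measurable_gap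

theorem map_gaps : P.map N.gaps = seqLaw r := by
  have := N.indep_gap.map_fun_eq_infinitePi_map N.measurable_gap
  simp only [N.law_gap] at this
  exact this

theorem regular_gaps (ω : Ω) : Regular (N.gaps ω) :=
  ⟨fun n => N.gap_pos n ω, fun m => ((N.tendsto_sum_gap ω).eventually_gt_atTop (m : ℝ)).exists⟩

include N in
theorem ae_regular : ∀ᵐ a ∂seqLaw r, Regular a := by
  rw [← N.map_gaps, ae_map_iff N.measurable_gaps.aemeasurable measurableSet_regular]
  exact Eventually.of_forall N.regular_gaps

end PoissonProcess

/-! ### Times that depend on the past only -/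

/-- Two sequences of interarrival times with the same arrivals up to the time `t`. -/
def Agree (t : ℝ) (a a' : ℕ → ℝ) : Prop :=
  ∀ n, arrival a n = arrival a' n ∨ (t < arrival a n ∧ t < arrival a' n)

/-- A time that depends on the past only. -/
def PathAdapted (T : (ℕ → ℝ) → ℝ≥0∞) : Prop :=
  ∀ a a', Regular a → Regular a' → ∀ t : ℝ, 0 ≤ t → Agree t a a' → T a ≤ ENNReal.ofReal t →
    T a' ≤ ENNReal.ofReal t

theorem agree_of_lt {a a' : ℕ → ℝ} (ha : Regular a) (ha' : Regular a') {t : ℝ} (h : t < a 0)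
    (h' : t < a' 0) : Agree t a a' := by
  intro n
  cases n with
  | zero => left; simp
  | succ n =>
    right
    rw [arrival_succ', arrival_succ']
    constructor <;> linarith [ha.shift.arrival_nonneg n, ha'.shift.arrival_nonneg n]

theorem Agree.seqCons {t : ℝ} {b b' : ℕ → ℝ} (h : Agree t b b') (x : ℝ) :
    Agree (t + x) (seqCons x b) (seqCons x b') := by
  intro n
  cases n with
  | zero => left; simp
  | succ n =>
    simp only [arrival_succ', seqCons_zero, shift_seqCons]
    rcases h n with h | h
    · left; rw [h]
    · right; constructor <;> linarith [h.1, h.2]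

namespace PathAdapted

variable {T : (ℕ → ℝ) → ℝ≥0∞}

/-- Before both first arrivals two sequences are indistinguishable; adaptedness is applied at the
time `T a` itself. -/
theorem le_of_lt (hT : PathAdapted T) {a a' : ℕ → ℝ} (ha : Regular a) (ha' : Regular a')
    (h : T a < ENNReal.ofReal (a 0)) (h' : T a < ENNReal.ofReal (a' 0)) : T a' ≤ T a := by
  have hfin : T a ≠ ∞ := h.ne_top
  have e : ENNReal.ofReal (T a).toReal = T a := ENNReal.ofReal_toReal hfin
  have h1 : (T a).toReal < a 0 := (ENNReal.ofReal_lt_ofReal_iff (ha.1 0)).1 (by rwa [e])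
  have h2 : (T a).toReal < a' 0 := (ENNReal.ofReal_lt_ofReal_iff (ha'.1 0)).1 (by rwa [e])
  have := hT a a' ha ha' _ ENNReal.toReal_nonneg (agree_of_lt ha ha' h1 h2) e.ge
  rwa [e] at this

/-- Before the first arrival, an adapted time is deterministic. -/
theorem exists_deterministic (hT : PathAdapted T) : ∃ r : ℝ≥0∞, ∀ a, Regular a →
    (T a < ENNReal.ofReal (a 0) ∧ T a = r) ∨
      (ENNReal.ofReal (a 0) ≤ T a ∧ ENNReal.ofReal (a 0) ≤ r) := by
  by_cases hex : ∃ a, Regular a ∧ T a < ENNReal.ofReal (a 0)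
  · obtain ⟨a, ha, hlt⟩ := hex
    refine ⟨T a, fun a' ha' => ?_⟩
    rcases lt_or_ge (T a') (ENNReal.ofReal (a' 0)) with h1 | h1
    · left
      refine ⟨h1, ?_⟩
      rcases lt_or_ge (T a) (ENNReal.ofReal (a' 0)) with h2 | h2
      · have h3 := hT.le_of_lt ha ha' hlt h2
        exact le_antisymm h3 (hT.le_of_lt ha' ha h1 (h3.trans_lt hlt))
      · have h3 := hT.le_of_lt ha' ha h1 (h1.trans_le (h2.trans hlt.le))
        exact absurd (h3.trans_lt h1) (not_lt.2 h2)
    · right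
      refine ⟨h1, ?_⟩
      by_contra! h2
      exact absurd (hT.le_of_lt ha ha' hlt h2) (not_le.2 (h2.trans_le h1))
  · push Not at hex
    -- If the time never precedes the first arrival, waiting forever plays the role of `r`.
    exact ⟨∞, fun a ha => Or.inr ⟨hex a ha, le_top⟩⟩

theorem after (hT : PathAdapted T) {x : ℝ} (hx : 0 < x) :
    PathAdapted fun b => T (seqCons x b) - ENNReal.ofReal x := by
  intro b b' hb hb' t ht hag h
  rw [tsub_le_iff_right, ← ENNReal.ofReal_add ht hx.le] at h ⊢
  exact hT _ _ (hb.cons hx) (hb'.cons hx) _ (by positivity) (hag.seqCons x) h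

end PathAdapted

/-! ### The single-jump operator as a difference of nonnegative integrals -/

namespace Params

variable (M : Params)

theorem measurable_legCost_right {h : ℝ × ℝ → ℝ≥0∞} (hh : Measurable h) (p : ℝ × ℝ) (T : ℝ≥0∞) :
    Measurable fun x : ℝ => M.legCost h p T x :=
  M.measurable_legCost hh measurable_const measurable_const measurable_id

/-- The positive part of the running cost. -/
noncomputable def gPos (p : ℝ × ℝ) : ℝ≥0∞ := ENNReal.ofReal (M.g p)

/-- The negative part of the running cost. -/
noncomputable def gNeg (p : ℝ × ℝ) : ℝ≥0∞ := ENNReal.ofReal (-M.g p)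

@[fun_prop]
theorem measurable_gPos : Measurable M.gPos := by unfold gPos; fun_prop

@[fun_prop]
theorem measurable_gNeg : Measurable M.gNeg := by unfold gNeg; fun_prop

theorem legCost_gPos (p : ℝ × ℝ) (T : ℝ≥0∞) (s : ℝ) : M.legCost M.gPos p T s =
    ∫⁻ t in Ico 0 (min T (ENNReal.ofReal s)).toReal,
      ENNReal.ofReal (Real.exp (-M.lam * t) * M.g (M.flow t p)) :=
  lintegral_congr fun _ => (ENNReal.ofReal_mul (Real.exp_pos _).le).symm

theorem legCost_gNeg (p : ℝ × ℝ) (T : ℝ≥0∞) (s : ℝ) : M.legCost M.gNeg p T s =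
    ∫⁻ t in Ico 0 (min T (ENNReal.ofReal s)).toReal,
      ENNReal.ofReal (-(Real.exp (-M.lam * t) * M.g (M.flow t p))) :=
  lintegral_congr fun t => by
    rw [← mul_neg, ENNReal.ofReal_mul (Real.exp_pos _).le]; rfl

theorem costTo_eq_legCost (p : ℝ × ℝ) (T : ℝ≥0∞) (s : ℝ) :
    M.costTo p (min T (ENNReal.ofReal s)).toReal =
      (M.legCost M.gPos p T s).toReal - (M.legCost M.gNeg p T s).toReal := by
  have hint : IntegrableOn (fun u => Real.exp (-M.lam * u) * M.g (M.flow u p))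
      (Ico 0 (min T (ENNReal.ofReal s)).toReal) :=
    ((M.continuous_running p).integrableOn_Icc).mono_set Ico_subset_Icc_self
  rw [legCost_gPos, legCost_gNeg, ← integral_eq_lintegral_pos_part_sub_lintegral_neg_part hint,
    costTo, intervalIntegral.integral_of_le (stepTime_nonneg _ _),
    Measure.restrict_congr_set Ico_ae_eq_Ioc]

theorem lintegral_exp_le {K s : ℝ} (hK : 0 ≤ K) (T : ℝ≥0∞) (hs : 0 ≤ s) :
    ∫⁻ t in Ico 0 (min T (ENNReal.ofReal s)).toReal, ENNReal.ofReal (K * Real.exp t) ≤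
      ENNReal.ofReal (K * Real.exp s) := by
  have hint : IntegrableOn (fun u => K * Real.exp u) (Ico 0 (min T (ENNReal.ofReal s)).toReal) :=
    ((by fun_prop : Continuous fun u => K * Real.exp u).integrableOn_Icc).mono_set
      Ico_subset_Icc_self
  rw [← ofReal_integral_eq_lintegral_ofReal hint
    (Eventually.of_forall fun u => mul_nonneg hK (Real.exp_pos u).le),
    Measure.restrict_congr_set Ico_ae_eq_Ioc, ← intervalIntegral.integral_of_le
    (stepTime_nonneg _ _), intervalIntegral.integral_const_mul, integral_exp]
  refine ENNReal.ofReal_le_ofReal (mul_le_mul_of_nonneg_left ?_ hK)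
  have := Real.exp_le_exp.2 (stepTime_le T hs)
  linarith [Real.exp_pos 0]

theorem exists_legCost_le {p : ℝ × ℝ} (hp : p ∈ quadrant) : ∃ K : ℝ, 0 ≤ K ∧
    ∀ (T : ℝ≥0∞) (s : ℝ), 0 ≤ s →
      M.legCost M.gPos p T s ≤ ENNReal.ofReal (K * Real.exp s) ∧
      M.legCost M.gNeg p T s ≤ ENNReal.ofReal (K * Real.exp s) := by
  obtain ⟨K, hK, h⟩ := M.exists_abs_g_flow_le hp
  refine ⟨K, hK, fun T s hs => ⟨?_, ?_⟩⟩
  · rw [legCost_gPos]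
    refine le_trans (setLIntegral_mono (by fun_prop) fun t ht => ?_) (lintegral_exp_le hK T hs)
    exact ENNReal.ofReal_le_ofReal ((le_abs_self _).trans (h t ht.1))
  · rw [legCost_gNeg]
    refine le_trans (setLIntegral_mono (by fun_prop) fun t ht => ?_) (lintegral_exp_le hK T hs)
    exact ENNReal.ofReal_le_ofReal ((neg_le_abs _).trans (h t ht.1))

open Classical in
/-- The discounted terminal reward `-w` if the first jump happens at the time `x ≤ t`. -/
noncomputable def endReward (w : ℝ × ℝ → ℝ) (t : ℝ≥0∞) (p : ℝ × ℝ) (x : ℝ) : ℝ≥0∞ :=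
  if ENNReal.ofReal x ≤ t then
    ENNReal.ofReal (Real.exp (-M.lam * x)) * ENNReal.ofReal (-w (M.jump (M.flow x p)))
  else 0

theorem endReward_toReal {w : ℝ × ℝ → ℝ} (hub : ∀ p ∈ quadrant, w p ≤ 0) (t : ℝ≥0∞) {p : ℝ × ℝ}
    (hp : p ∈ quadrant) {x : ℝ} (hx : 0 ≤ x) : (M.endReward w t p x).toReal =
      -(if ENNReal.ofReal x ≤ t then Real.exp (-M.lam * x) * w (M.jump (M.flow x p)) else 0) := by
  unfold endReward
  have := hub _ (M.jump_mem (M.flow_mem hp hx))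
  split_ifs
  · rw [ENNReal.toReal_mul, ENNReal.toReal_ofReal (Real.exp_pos _).le,
      ENNReal.toReal_ofReal (by linarith), mul_neg]
  · simp

theorem endReward_le {w : ℝ × ℝ → ℝ} (hlb : ∀ p ∈ quadrant, -M.kap ≤ w p) (t : ℝ≥0∞) {p : ℝ × ℝ}
    (hp : p ∈ quadrant) {x : ℝ} (hx : 0 ≤ x) :
    M.endReward w t p x ≤ ENNReal.ofReal (M.kap * Real.exp x) := by
  unfold endReward
  have := hlb _ (M.jump_mem (M.flow_mem hp hx))
  split_ifs
  · rw [← ENNReal.ofReal_mul (Real.exp_pos _).le]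
    refine ENNReal.ofReal_le_ofReal ?_
    have h1 := M.exp_le_one_of_nonneg hx
    have h2 := Real.one_le_exp hx
    have h3 := M.kap_pos
    have h4 := Real.exp_pos (-M.lam * x)
    nlinarith
  · exact zero_le

theorem aemeasurable_endReward {w : ℝ × ℝ → ℝ} (hw : ContinuousOn w quadrant) (t : ℝ≥0∞)
    {p : ℝ × ℝ} (hp : p ∈ quadrant) : AEMeasurable (M.endReward w t p) (expMeasure M.mu) := by
  have h1 := (M.ae_continuousOn_comp hw hp).aemeasurable.neg.ennreal_ofReal
  have h2 : MeasurableSet {x : ℝ | ENNReal.ofReal x ≤ t} :=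
    measurableSet_le (by fun_prop) measurable_const
  have h3 : Measurable fun x : ℝ => ENNReal.ofReal (Real.exp (-M.lam * x)) := by fun_prop
  refine ((h3.aemeasurable.mul h1).indicator h2).congr (Eventually.of_forall fun x => ?_)
  by_cases h : ENNReal.ofReal x ≤ t <;> simp [endReward, indicator, h]

theorem lintegral_exp_expMeasure_lt_top (K : ℝ) :
    ∫⁻ x, ENNReal.ofReal (K * Real.exp x) ∂expMeasure M.mu < ∞ :=
  ((integrable_exp_expMeasure M.one_lt_mu).const_mul K).lintegral_lt_top

section Jumps

variable {Ω : Type*} [MeasurableSpace Ω] {P : Measure Ω} (N : PoissonProcess P M.mu)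

/-- Separates gains and losses into finite `ℝ≥0∞`-integrals, so that the two induction inequalities
can be handled without subtraction. -/
theorem J_eq_lintegral {w : ℝ × ℝ → ℝ} (hw : M.Adm w) (t : ℝ≥0∞) {p : ℝ × ℝ} (hp : p ∈ quadrant) :
    ∫⁻ x, M.legCost M.gPos p t x ∂expMeasure M.mu ≠ ∞ ∧
    ∫⁻ x, (M.legCost M.gNeg p t x + M.endReward w t p x) ∂expMeasure M.mu ≠ ∞ ∧
    M.J N w t p = (∫⁻ x, M.legCost M.gPos p t x ∂expMeasure M.mu).toReal -
      (∫⁻ x, (M.legCost M.gNeg p t x + M.endReward w t p x) ∂expMeasure M.mu).toReal := by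
  obtain ⟨K, hK, hle⟩ := M.exists_legCost_le hp
  have hX : ∫⁻ x, M.legCost M.gPos p t x ∂expMeasure M.mu ≠ ∞ :=
    ((lintegral_mono_ae (ae_expMeasure_pos.mono fun x hx => (hle t x hx.le).1)).trans_lt
      (M.lintegral_exp_expMeasure_lt_top K)).ne
  have hY : ∫⁻ x, (M.legCost M.gNeg p t x + M.endReward w t p x) ∂expMeasure M.mu ≠ ∞ := by
    refine ((lintegral_mono_ae (ae_expMeasure_pos.mono fun x hx => ?_)).trans_lt
      (M.lintegral_exp_expMeasure_lt_top (K + M.kap))).ne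
    rw [add_mul, ENNReal.ofReal_add (mul_nonneg hK (Real.exp_pos _).le)
      (mul_nonneg M.kap_pos.le (Real.exp_pos _).le)]
    exact add_le_add (hle t x hx.le).2 (M.endReward_le hw.lb t hp hx.le)
  refine ⟨hX, hY, ?_⟩
  have mX : Measurable fun x : ℝ => M.legCost M.gPos p t x :=
    M.measurable_legCost_right M.measurable_gPos p t
  have mY : AEMeasurable (fun x : ℝ => M.legCost M.gNeg p t x + M.endReward w t p x)
      (expMeasure M.mu) :=
    (M.measurable_legCost_right M.measurable_gNeg p t).aemeasurable.add
      (M.aemeasurable_endReward hw.continuousOn t hp)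
  rw [← integral_toReal mX.aemeasurable (ae_lt_top mX hX),
    ← integral_toReal mY (ae_lt_top' mY hY),
    ← integral_sub (integrable_toReal_of_lintegral_ne_top mX.aemeasurable hX)
      (integrable_toReal_of_lintegral_ne_top mY hY), M.J_eq N hw t hp]
  refine integral_congr_ae (ae_expMeasure_pos.mono fun x hx => ?_)
  have h1 : M.legCost M.gNeg p t x ≠ ∞ := ne_top_of_le_ne_top ENNReal.ofReal_ne_top (hle t x hx.le).2
  have h2 : M.endReward w t p x ≠ ∞ :=
    ne_top_of_le_ne_top ENNReal.ofReal_ne_top (M.endReward_le hw.lb t hp hx.le)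
  simp only [stepVal]
  rw [costTo_eq_legCost, ENNReal.toReal_add h1 h2, M.endReward_toReal hw.ub t hp hx.le]
  ring

theorem lintegral_le_of_le_J {w : ℝ × ℝ → ℝ} (hw : M.Adm w) {t : ℝ≥0∞} {p : ℝ × ℝ}
    (hp : p ∈ quadrant) {z : ℝ} (hz : z ≤ M.J N w t p) :
    ∫⁻ x, (M.legCost M.gNeg p t x + M.endReward w t p x) ∂expMeasure M.mu ≤
      ∫⁻ x, M.legCost M.gPos p t x ∂expMeasure M.mu + ENNReal.ofReal (-z) := by
  obtain ⟨hX, hY, hJ⟩ := M.J_eq_lintegral N hw t hp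
  rw [hJ] at hz
  rw [← ENNReal.ofReal_toReal hX, ← ENNReal.ofReal_toReal hY]
  refine le_trans (ENNReal.ofReal_le_ofReal ?_) ENNReal.ofReal_add_le
  linarith

theorem lintegral_le_of_J_le {w : ℝ × ℝ → ℝ} (hw : M.Adm w) {t : ℝ≥0∞} {p : ℝ × ℝ}
    (hp : p ∈ quadrant) {z ε : ℝ} (hz : z ≤ 0) (h : M.J N w t p ≤ z + ε) :
    ∫⁻ x, M.legCost M.gPos p t x ∂expMeasure M.mu + ENNReal.ofReal (-z) ≤
      ∫⁻ x, (M.legCost M.gNeg p t x + M.endReward w t p x) ∂expMeasure M.mu +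
        ENNReal.ofReal ε := by
  obtain ⟨hX, hY, hJ⟩ := M.J_eq_lintegral N hw t hp
  rw [hJ] at h
  rw [← ENNReal.ofReal_toReal hX, ← ENNReal.ofReal_toReal hY,
    ← ENNReal.ofReal_add ENNReal.toReal_nonneg (neg_nonneg.2 hz)]
  refine le_trans (ENNReal.ofReal_le_ofReal ?_) ENNReal.ofReal_add_le
  linarith

end Jumps

/-! ### Splitting the expected cost at the first jump -/

open Classical in
/-- The expected cost after the first jump at the time `x ≤ r`. -/
noncomputable def tailCost (h : ℝ × ℝ → ℝ≥0∞) (n : ℕ) (r : ℝ≥0∞) (p : ℝ × ℝ)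
    (T : ℝ → (ℕ → ℝ) → ℝ≥0∞) (x : ℝ) : ℝ≥0∞ :=
  if ENNReal.ofReal x ≤ r then ENNReal.ofReal (Real.exp (-M.lam * x)) *
    ∫⁻ b, M.pathCost h n (M.jump (M.flow x p)) b (T x b) ∂seqLaw M.mu else 0

theorem pathCost_zero_time (h : ℝ × ℝ → ℝ≥0∞) (n : ℕ) (p : ℝ × ℝ) (a : ℕ → ℝ) :
    M.pathCost h n p a 0 = 0 := by
  induction n generalizing p a with
  | zero => rfl
  | succ n ih => simp [pathCost, legCost, ih]

instance isProbabilityMeasure_seqLaw : IsProbabilityMeasure (seqLaw M.mu) := by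
  unfold seqLaw; infer_instance

theorem measurable_tailCost {h : ℝ × ℝ → ℝ≥0∞} (hh : Measurable h) (n : ℕ) (r : ℝ≥0∞) (p : ℝ × ℝ)
    {T : ℝ → (ℕ → ℝ) → ℝ≥0∞} (hT : Measurable fun q : ℝ × (ℕ → ℝ) => T q.1 q.2) :
    Measurable (M.tailCost h n r p T) := by
  refine Measurable.ite (measurableSet_le (by fun_prop) measurable_const) ?_ measurable_const
  refine Measurable.mul (by fun_prop) (Measurable.lintegral_prod_right'
    (f := fun q : ℝ × (ℕ → ℝ) => M.pathCost h n (M.jump (M.flow q.1 p)) q.2 (T q.1 q.2)) ?_)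
  exact M.measurable_pathCost hh n (by fun_prop) measurable_snd hT

/-- The time `r` is the deterministic waiting time before the first jump, and `T'` the remaining
time after it. Leaving both abstract serves arbitrary adapted times and the constructed strategies
alike. -/
theorem lintegral_pathCost_succ (hreg : ∀ᵐ a ∂seqLaw M.mu, Regular a) {h : ℝ × ℝ → ℝ≥0∞}
    (hh : Measurable h) (n : ℕ) (p : ℝ × ℝ) {r : ℝ≥0∞} {T : (ℕ → ℝ) → ℝ≥0∞} (hT : Measurable T)
    {T' : ℝ → (ℕ → ℝ) → ℝ≥0∞} (hT' : Measurable fun q : ℝ × (ℕ → ℝ) => T' q.1 q.2)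
    (hmin : ∀ x b, 0 < x → Regular b →
      min (T (seqCons x b)) (ENNReal.ofReal x) = min r (ENNReal.ofReal x))
    (hle : ∀ x b, 0 < x → Regular b → ENNReal.ofReal x ≤ r →
      T (seqCons x b) - ENNReal.ofReal x = T' x b)
    (hgt : ∀ x b, 0 < x → Regular b → r < ENNReal.ofReal x →
      T (seqCons x b) - ENNReal.ofReal x = 0) :
    ∫⁻ a, M.pathCost h (n + 1) p a (T a) ∂seqLaw M.mu =
      ∫⁻ x, M.legCost h p r x ∂expMeasure M.mu +
        ∫⁻ x, M.tailCost h n r p T' x ∂expMeasure M.mu := by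
  rw [lintegral_seqLaw M.mu_pos (F := fun a => M.pathCost h (n + 1) p a (T a))
      (M.measurable_pathCost hh _ measurable_const measurable_id hT),
    ← lintegral_add_right _ (M.measurable_tailCost hh n r p hT')]
  refine lintegral_congr_ae (ae_expMeasure_pos.mono fun x hx => ?_)
  have e : ∀ᵐ b ∂seqLaw M.mu, M.pathCost h (n + 1) p (seqCons x b) (T (seqCons x b)) =
      M.legCost h p r x + ENNReal.ofReal (Real.exp (-M.lam * x)) *
        M.pathCost h n (M.jump (M.flow x p)) b (if ENNReal.ofReal x ≤ r then T' x b else 0) := by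
    filter_upwards [hreg] with b hb
    rw [pathCost, seqCons_zero, shift_seqCons, legCost, hmin x b hx hb]
    split_ifs with h1
    · rw [hle x b hx hb h1]; rfl
    · rw [hgt x b hx hb (not_le.1 h1)]; rfl
  beta_reduce
  rw [lintegral_congr_ae e, lintegral_add_left measurable_const, lintegral_const, measure_univ,
    mul_one, lintegral_const_mul' _ _ ENNReal.ofReal_ne_top]
  simp only [tailCost]
  split_ifs with h1
  · rfl
  · simp [pathCost_zero_time]

section Jumps

variable {Ω : Type*} [MeasurableSpace Ω] {P : Measure Ω} (N : PoissonProcess P M.mu)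

/-- No adapted time has a smaller expected cost up to the `n`-th jump than `v_n`. -/
theorem lintegral_pathCost_lower (n : ℕ) {p : ℝ × ℝ} (hp : p ∈ quadrant)
    {T : (ℕ → ℝ) → ℝ≥0∞} (hT : Measurable T) (hTa : PathAdapted T) :
    ∫⁻ a, M.pathCost M.gNeg n p a (T a) ∂seqLaw M.mu ≤
      ∫⁻ a, M.pathCost M.gPos n p a (T a) ∂seqLaw M.mu + ENNReal.ofReal (-M.vn N n p) := by
  induction n generalizing p T with
  | zero => simp [pathCost]
  | succ n ih =>
    -- The first leg is governed by `J` at the fixed time `r`, which is at least the infimum `J₀`;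
    -- the induction hypothesis covers the restarted time after the jump.
    obtain ⟨r, hr⟩ := hTa.exists_deterministic
    have hmT' : Measurable fun q : ℝ × (ℕ → ℝ) => T (seqCons q.1 q.2) - ENNReal.ofReal q.1 :=
      (hT.comp measurable_seqCons).sub (by fun_prop)
    have hsplit := fun (h : ℝ × ℝ → ℝ≥0∞) (hh : Measurable h) =>
      M.lintegral_pathCost_succ N.ae_regular hh n p (r := r) hT
        (T' := fun x b => T (seqCons x b) - ENNReal.ofReal x) hmT'
        (fun x b hx hb => by
          rcases hr _ (hb.cons hx) with ⟨_, h2⟩ | ⟨h1, h2⟩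
          · rw [h2]
          · rw [seqCons_zero] at h1 h2
            rw [min_eq_right h1, min_eq_right h2])
        (fun _ _ _ _ _ => rfl)
        (fun x b hx hb hlt => by
          rcases hr _ (hb.cons hx) with ⟨h1, _⟩ | ⟨_, h2⟩
          · exact tsub_eq_zero_of_le h1.le
          · exact absurd h2 (not_le.2 hlt))
    rw [hsplit _ M.measurable_gNeg, hsplit _ M.measurable_gPos]
    have hw := M.adm_vn N n
    have hJ := M.lintegral_le_of_le_J N hw hp (M.J0_le_J N hw r hp)
    have hmtail := M.measurable_tailCost M.measurable_gPos n r p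
      (T := fun x b => T (seqCons x b) - ENNReal.ofReal x) hmT'
    have htail : ∫⁻ x, M.tailCost M.gNeg n r p (fun x b => T (seqCons x b) - ENNReal.ofReal x) x
          ∂expMeasure M.mu ≤
        ∫⁻ x, (M.endReward (M.vn N n) r p x +
          M.tailCost M.gPos n r p (fun x b => T (seqCons x b) - ENNReal.ofReal x) x)
            ∂expMeasure M.mu := by
      refine lintegral_mono_ae (ae_expMeasure_pos.mono fun x hx => ?_)
      simp only [tailCost, endReward]
      split_ifs
      · rw [← mul_add]
        refine mul_le_mul_right ?_ _
        rw [add_comm]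
        exact ih (M.jump_mem (M.flow_mem hp hx.le)) (hmT'.comp measurable_prodMk_left)
          (hTa.after hx)
      · simp
    rw [lintegral_add_right _ hmtail] at htail
    rw [lintegral_add_left (M.measurable_legCost_right M.measurable_gNeg p r)] at hJ
    change _ ≤ _ + ENNReal.ofReal (-M.J0 N (M.vn N n) p)
    calc _ ≤ _ := add_le_add le_rfl htail
      _ = _ := (add_assoc _ _ _).symm
      _ ≤ _ := add_le_add hJ le_rfl
      _ = _ := by ring

end Jumps

end Params

/-! ### Nearly optimal strategies -/

namespace Params

variable (M : Params)

section Jumps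

variable {Ω : Type*} [MeasurableSpace Ω] {P : Measure Ω} (N : PoissonProcess P M.mu)

/-- Only right-continuity holds: the event `σ₁ ≤ t` jumps at `t = σ₁`. It suffices for replacing a
good time by a nearby later one from a countable set. -/
theorem tendsto_stepVal (w : ℝ × ℝ → ℝ) (t : ℝ≥0∞) (p : ℝ × ℝ) (a : ℝ) :
    Tendsto (fun s => M.stepVal w s p a) (𝓝[>] t) (𝓝 (M.stepVal w t p a)) := by
  refine Tendsto.add ?_ ?_
  · have hfin : min t (ENNReal.ofReal a) ≠ ∞ :=
      ne_top_of_le_ne_top ENNReal.ofReal_ne_top (min_le_right _ _)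
    have h1 : Tendsto (fun s => min s (ENNReal.ofReal a)) (𝓝[>] t)
        (𝓝 (min t (ENNReal.ofReal a))) :=
      ((continuous_id.min continuous_const).tendsto t).mono_left nhdsWithin_le_nhds
    exact ((M.continuous_costTo p).tendsto _).comp ((ENNReal.tendsto_toReal hfin).comp h1)
  · refine tendsto_const_nhds.congr' ?_
    by_cases h : ENNReal.ofReal a ≤ t
    · filter_upwards [self_mem_nhdsWithin] with s hs
      rw [if_pos h, if_pos (h.trans (le_of_lt hs))]
    · have h2 : Iio (ENNReal.ofReal a) ∈ 𝓝[>] t :=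
        nhdsWithin_le_nhds (Iio_mem_nhds (not_le.1 h))
      filter_upwards [h2] with s hs
      rw [if_neg h, if_neg (not_le.2 hs)]

theorem tendsto_J {w : ℝ × ℝ → ℝ} (hw : M.Adm w) (t : ℝ≥0∞) {p : ℝ × ℝ} (hp : p ∈ quadrant) :
    Tendsto (fun s => M.J N w s p) (𝓝[>] t) (𝓝 (M.J N w t p)) := by
  simp only [M.J_eq N hw _ hp]
  obtain ⟨K, _, h⟩ := M.exists_abs_stepVal_le hw.lb hw.ub hp
  exact tendsto_integral_filter_of_dominated_convergence (fun a => K * Real.exp a)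
    (Eventually.of_forall fun s => M.aestronglyMeasurable_stepVal hw.continuousOn s hp)
    (Eventually.of_forall fun s => ae_expMeasure_pos.mono fun a ha => h s a ha.le)
    ((integrable_exp_expMeasure M.one_lt_mu).const_mul K)
    (Eventually.of_forall fun a => M.tendsto_stepVal w t p a)

/-- A sequence of times that contains `∞` and is dense. -/
noncomputable def trialTime : ℕ → ℝ≥0∞
  | 0 => ∞
  | n + 1 => TopologicalSpace.denseSeq ℝ≥0∞ n

theorem exists_trialTime {w : ℝ × ℝ → ℝ} (hw : M.Adm w) {p : ℝ × ℝ} (hp : p ∈ quadrant) {ε : ℝ}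
    (hε : 0 < ε) : ∃ i, M.J N w (trialTime i) p ≤ M.J0 N w p + ε := by
  obtain ⟨t, ht⟩ := exists_lt_of_ciInf_lt (show M.J0 N w p < M.J0 N w p + ε by linarith)
  -- No time lies to the right of `∞`, which is why it is listed separately among the trial times.
  by_cases htop : t = ∞
  · exact ⟨0, by rw [trialTime, ← htop]; exact ht.le⟩
  · have hev := (M.tendsto_J N hw t hp).eventually_lt_const ht
    obtain ⟨u, hu, hsub⟩ :=
      (mem_nhdsGT_iff_exists_Ioo_subset' (lt_top_iff_ne_top.2 htop)).1 hev
    obtain ⟨_, ⟨i, rfl⟩, hi⟩ :=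
      (TopologicalSpace.denseRange_denseSeq ℝ≥0∞).exists_between hu
    exact ⟨i + 1, (show _ < _ from hsub hi).le⟩

/-- The projection to the quadrant. -/
def toQuadrant (p : ℝ × ℝ) : ℝ × ℝ := (max p.1 0, max p.2 0)

theorem toQuadrant_mem (p : ℝ × ℝ) : toQuadrant p ∈ quadrant := ⟨le_max_right _ _, le_max_right _ _⟩

theorem toQuadrant_of_mem {p : ℝ × ℝ} (hp : p ∈ quadrant) : toQuadrant p = p :=
  Prod.ext (max_eq_left hp.1) (max_eq_left hp.2)

theorem measurable_comp_toQuadrant {w : ℝ × ℝ → ℝ} (hw : ContinuousOn w quadrant) :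
    Measurable fun p => w (toQuadrant p) :=
  (hw.comp_continuous (by unfold toQuadrant; fun_prop) toQuadrant_mem).measurable

/-- The first ε-optimal trial time is a measurable choice, since for each fixed trial time both
sides of the inequality are continuous in the state. Projecting to the quadrant makes them defined
and measurable on the whole plane. -/
theorem exists_measurable_time {w : ℝ × ℝ → ℝ} (hw : M.Adm w) {ε : ℝ} (hε : 0 < ε) :
    ∃ R : ℝ × ℝ → ℝ≥0∞, Measurable R ∧
      ∀ p ∈ quadrant, M.J N w (R p) p ≤ M.J0 N w p + ε := by
  classical
  have hex : ∀ p, ∃ i, M.J N w (trialTime i) (toQuadrant p) ≤ M.J0 N w (toQuadrant p) + ε :=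
    fun p => M.exists_trialTime N hw (toQuadrant_mem p) hε
  obtain ⟨L, hL, hlip⟩ := M.J_lip N hw
  refine ⟨fun p => trialTime (Nat.find (hex p)), ?_, fun p hp => ?_⟩
  · refine (measurable_from_nat (f := trialTime)).comp (measurable_find hex fun i => ?_)
    exact measurableSet_le
      (measurable_comp_toQuadrant (continuousOn_of_lip hL (hlip (trialTime i))))
      ((measurable_comp_toQuadrant (M.adm_J0 N hw).continuousOn).add_const ε)
  · have := Nat.find_spec (hex p)
    simp only [toQuadrant_of_mem hp] at this ⊢
    exact this

/-- The strategy that waits, after the `j`-th jump, for the time `R (n - 1 - j)` of the current state,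
and stops if there was no jump in the meantime; it stops at the `n`-th jump at the latest. -/
noncomputable def strategy (R : ℕ → ℝ × ℝ → ℝ≥0∞) : ℕ → ℝ × ℝ → (ℕ → ℝ) → ℝ≥0∞
  | 0, _, _ => 0
  | n + 1, p, a => if ENNReal.ofReal (a 0) ≤ R n p then
      ENNReal.ofReal (a 0) + strategy R n (M.jump (M.flow (a 0) p)) (shift a) else R n p

theorem measurable_strategy {R : ℕ → ℝ × ℝ → ℝ≥0∞} (hR : ∀ n, Measurable (R n)) (n : ℕ)
    {X : Type*} [MeasurableSpace X] {p : X → ℝ × ℝ} {a : X → ℕ → ℝ} (hp : Measurable p)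
    (ha : Measurable a) : Measurable fun x => M.strategy R n (p x) (a x) := by
  induction n generalizing p a with
  | zero => exact measurable_const
  | succ n ih =>
    have ha0 : Measurable fun x => a x 0 := (measurable_pi_apply 0).comp ha
    have hRp : Measurable fun x => R n (p x) := (hR n).comp hp
    refine Measurable.ite (measurableSet_le (by fun_prop) hRp) ?_ hRp
    exact Measurable.add (by fun_prop) (ih (by fun_prop) (by fun_prop))

/-- Whether the first arrival has been seen by time `t` is part of the past; if it has, both
sequences share it and the shifted sequences agree up to `t - a 0`. -/
theorem pathAdapted_strategy (R : ℕ → ℝ × ℝ → ℝ≥0∞) (n : ℕ) (p : ℝ × ℝ) :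
    PathAdapted (M.strategy R n p) := by
  induction n generalizing p with
  | zero => exact fun _ _ _ _ _ _ _ _ => by simp [strategy]
  | succ n ih =>
    intro a a' ha ha' t ht hag h
    simp only [strategy] at h ⊢
    have h1 : a 0 = a' 0 ∨ (t < a 0 ∧ t < a' 0) := by
      simpa [arrival_succ] using hag 1
    rcases h1 with h1 | ⟨h1, h2⟩
    · rw [← h1]
      split_ifs at h ⊢ with hle
      · have ha0 := ha.1 0
        have h3 : a 0 ≤ t :=
          (ENNReal.ofReal_le_ofReal_iff ht).1 (le_self_add.trans h)
        have hag' : Agree (t - a 0) (shift a) (shift a') := by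
          intro k
          have h4 := hag (k + 1)
          rw [arrival_succ', arrival_succ', ← h1] at h4
          rcases h4 with h4 | h4
          · left; linarith
          · right; constructor <;> linarith [h4.1, h4.2]
        have e : ENNReal.ofReal t = ENNReal.ofReal (a 0) + ENNReal.ofReal (t - a 0) := by
          rw [← ENNReal.ofReal_add ha0.le (by linarith)]; congr 1; ring
        rw [e] at h ⊢
        have h5 := (ENNReal.add_le_add_iff_left ENNReal.ofReal_ne_top).1 h
        exact add_le_add le_rfl
          (ih _ _ _ ha.shift ha'.shift _ (by linarith) hag' h5)
      · exact h
    · have h3 : ENNReal.ofReal t < ENNReal.ofReal (a 0) :=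
        (ENNReal.ofReal_lt_ofReal_iff (ha.1 0)).2 h1
      have h4 : ENNReal.ofReal t < ENNReal.ofReal (a' 0) :=
        (ENNReal.ofReal_lt_ofReal_iff (ha'.1 0)).2 h2
      split_ifs at h with hle
      · exact absurd (le_self_add.trans h) (not_le.2 h3)
      · rwa [if_neg (not_le.2 (h.trans_lt h4))]

/-- Each leg loses at most `ε` against the infimum, and discounting does not enlarge later losses,
so `n` legs lose at most `n ε`. -/
theorem lintegral_pathCost_upper {R : ℕ → ℝ × ℝ → ℝ≥0∞} (hR : ∀ n, Measurable (R n)) {ε : ℝ}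
    (hRJ : ∀ n, ∀ p ∈ quadrant, M.J N (M.vn N n) (R n p) p ≤ M.vn N (n + 1) p + ε) (n : ℕ)
    {p : ℝ × ℝ} (hp : p ∈ quadrant) :
    ∫⁻ a, M.pathCost M.gPos n p a (M.strategy R n p a) ∂seqLaw M.mu + ENNReal.ofReal (-M.vn N n p) ≤
      ∫⁻ a, M.pathCost M.gNeg n p a (M.strategy R n p a) ∂seqLaw M.mu +
        n * ENNReal.ofReal ε := by
  induction n generalizing p with
  | zero => simp [pathCost, vn]
  | succ n ih =>
    set r := R n p with hr
    set T' : ℝ → (ℕ → ℝ) → ℝ≥0∞ := fun x b => M.strategy R n (M.jump (M.flow x p)) b with hT'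
    have hmT' : Measurable fun q : ℝ × (ℕ → ℝ) => T' q.1 q.2 :=
      M.measurable_strategy hR n (by fun_prop) measurable_snd
    have hT : Measurable (M.strategy R (n + 1) p) :=
      M.measurable_strategy hR (n + 1) measurable_const measurable_id
    have hstrat : ∀ x b, M.strategy R (n + 1) p (seqCons x b) =
        if ENNReal.ofReal x ≤ r then ENNReal.ofReal x + T' x b else r := fun x b => rfl
    have hsplit := fun (h : ℝ × ℝ → ℝ≥0∞) (hh : Measurable h) =>
      M.lintegral_pathCost_succ N.ae_regular hh n p (r := r) hT hmT'
        (fun x b _ _ => by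
          rw [hstrat]
          split_ifs with h1
          · rw [min_eq_right h1, min_eq_right le_self_add]
          · rfl)
        (fun x b _ _ h1 => by
          rw [hstrat, if_pos h1, ENNReal.add_sub_cancel_left ENNReal.ofReal_ne_top])
        (fun x b _ _ h1 => by
          rw [hstrat, if_neg (not_le.2 h1), tsub_eq_zero_of_le h1.le])
    rw [hsplit _ M.measurable_gNeg, hsplit _ M.measurable_gPos]
    have hw := M.adm_vn N n
    have hJ := M.lintegral_le_of_J_le N hw hp ((M.adm_vn N (n + 1)).ub p hp) (hRJ n p hp)
    have hmtail := M.measurable_tailCost M.measurable_gPos n r p hmT'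
    have hmtail' := M.measurable_tailCost M.measurable_gNeg n r p hmT'
    have htail : ∫⁻ x, (M.endReward (M.vn N n) r p x + M.tailCost M.gPos n r p T' x)
          ∂expMeasure M.mu ≤
        ∫⁻ x, (M.tailCost M.gNeg n r p T' x + n * ENNReal.ofReal ε) ∂expMeasure M.mu := by
      refine lintegral_mono_ae (ae_expMeasure_pos.mono fun x hx => ?_)
      simp only [tailCost, endReward]
      split_ifs
      · rw [← mul_add, add_comm (ENNReal.ofReal _)]
        refine (mul_le_mul_right (ih (M.jump_mem (M.flow_mem hp hx.le))) _).trans ?_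
        rw [mul_add]
        refine add_le_add le_rfl (mul_le_of_le_one_left zero_le ?_)
        exact ENNReal.ofReal_le_one.2 (M.exp_le_one_of_nonneg hx.le)
      · simp
    rw [lintegral_add_right _ hmtail, lintegral_add_right _ measurable_const, lintegral_const,
      measure_univ, mul_one] at htail
    rw [lintegral_add_left (M.measurable_legCost_right M.measurable_gNeg p r)] at hJ
    calc _ = (∫⁻ x, M.legCost M.gPos p r x ∂expMeasure M.mu +
          ENNReal.ofReal (-M.vn N (n + 1) p)) +
            ∫⁻ x, M.tailCost M.gPos n r p T' x ∂expMeasure M.mu := by ring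
      _ ≤ _ := add_le_add hJ le_rfl
      _ = ∫⁻ x, M.legCost M.gNeg p r x ∂expMeasure M.mu + ENNReal.ofReal ε +
          (∫⁻ x, M.endReward (M.vn N n) r p x ∂expMeasure M.mu +
            ∫⁻ x, M.tailCost M.gPos n r p T' x ∂expMeasure M.mu) := by ring
      _ ≤ _ := add_le_add le_rfl htail
      _ = _ := by push_cast; ring

end Jumps

end Params

/-! ### Stopping times and adapted times on the space of interarrival times -/

theorem Agree.symm {t : ℝ} {a a' : ℕ → ℝ} (h : Agree t a a') : Agree t a' a := fun n =>
  (h n).imp Eq.symm And.symm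

theorem Agree.mono {s t : ℝ} {a a' : ℕ → ℝ} (h : Agree t a a') (hst : s ≤ t) : Agree s a a' :=
  fun n => (h n).imp id fun h => ⟨hst.trans_lt h.1, hst.trans_lt h.2⟩

/-- The next arrival after `t` is strictly later in both sequences, so agreement persists a little
longer. This matches the right-continuity of the filtration. -/
theorem Agree.exists_gt {t : ℝ} {a a' : ℕ → ℝ} (ha : Regular a) (ha' : Regular a')
    (h : Agree t a a') : ∃ u, t < u ∧ Agree u a a' := by
  classical
  have hex := ha.exists_lt_arrival t
  set n := Nat.find hex with hn
  have h1 : t < arrival a n := Nat.find_spec hex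
  have h2 : t < arrival a' n := by
    rcases h n with h3 | h3
    · rwa [← h3]
    · exact h3.2
  obtain ⟨u, hu, hu'⟩ := exists_between (lt_min h1 h2)
  refine ⟨u, hu, fun j => ?_⟩
  rcases lt_or_ge j n with hj | hj
  · left
    rcases h j with h3 | h3
    · exact h3
    · exact absurd h3.1 (Nat.find_min hex hj)
  · right
    exact ⟨(hu'.trans_le (min_le_left _ _)).trans_le (ha.arrival_mono hj),
      (hu'.trans_le (min_le_right _ _)).trans_le (ha'.arrival_mono hj)⟩

/-- The arrival times of a sequence whose arrivals after `t` are replaced by fixed times. -/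
noncomputable def truncArrival (t : ℝ) (a : ℕ → ℝ) (n : ℕ) : ℝ :=
  if arrival a n ≤ t then arrival a n else t + n

/-- The sequence of interarrival times whose arrivals after `t` are replaced by fixed times. -/
noncomputable def truncGaps (t : ℝ) (a : ℕ → ℝ) (n : ℕ) : ℝ :=
  truncArrival t a (n + 1) - truncArrival t a n

theorem arrival_truncGaps {t : ℝ} (ht : 0 ≤ t) (a : ℕ → ℝ) (n : ℕ) :
    arrival (truncGaps t a) n = truncArrival t a n := by
  unfold arrival truncGaps
  rw [Finset.sum_range_sub]
  simp [truncArrival, ht]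

theorem Regular.truncGaps {a : ℕ → ℝ} (ha : Regular a) {t : ℝ} (ht : 0 ≤ t) :
    Regular (truncGaps t a) := by
  constructor
  · intro n
    have h1 := ha.arrival_mono n.le_succ
    have h2 := ha.1 n
    have h3 := arrival_succ a n
    simp only [PoissonDisorder.truncGaps, truncArrival]
    push_cast
    split_ifs with h4 h5 h5
    · linarith
    · linarith
    · have : (0 : ℝ) ≤ n := n.cast_nonneg
      linarith
    · linarith
  · intro m
    obtain ⟨n, hn⟩ := ha.exists_lt_arrival t
    refine ⟨max n (m + 1), ?_⟩
    have h1 : ¬ arrival a (max n (m + 1)) ≤ t :=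
      not_le.2 (hn.trans_le (ha.arrival_mono (le_max_left _ _)))
    rw [arrival_truncGaps ht, truncArrival, if_neg h1]
    have : ((m + 1 : ℕ) : ℝ) ≤ (max n (m + 1) : ℕ) := by exact_mod_cast le_max_right _ _
    push_cast at this ⊢
    linarith

theorem agree_truncGaps {t : ℝ} (ht : 0 ≤ t) (a : ℕ → ℝ) : Agree t a (truncGaps t a) := by
  intro n
  rw [arrival_truncGaps ht, truncArrival]
  split_ifs with h
  · exact Or.inl rfl
  · right
    refine ⟨not_le.1 h, ?_⟩
    have : n ≠ 0 := by
      rintro rfl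
      simp [ht] at h
    have : (0 : ℝ) < n := by exact_mod_cast Nat.pos_of_ne_zero this
    linarith

namespace PoissonProcess

variable {Ω : Type*} [MeasurableSpace Ω] {P : Measure Ω} {r : ℝ} (N : PoissonProcess P r)

theorem arrival_gaps (n : ℕ) (ω : Ω) : arrival (N.gaps ω) n = N.jumpTime n ω := rfl

/-- The natural filtration of the counting process. -/
noncomputable def naturalFiltration : Filtration ℝ≥0 (inferInstance : MeasurableSpace Ω) :=
  Filtration.natural (fun (t : ℝ≥0) => N.count t)
    (fun t => (N.measurable_count t.coe_nonneg).stronglyMeasurable)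

/-- The natural filtration, augmented by the null sets. -/
noncomputable def augmentedFiltration : Filtration ℝ≥0 (inferInstance : MeasurableSpace Ω) :=
  N.naturalFiltration ⊔ Filtration.const ℝ≥0
    (MeasurableSpace.generateFrom {A : Set Ω | MeasurableSet A ∧ P A = 0})
    (MeasurableSpace.generateFrom_le fun _ hA => hA.1)

theorem filtration_eq : N.filtration = N.augmentedFiltration.rightCont := rfl

theorem naturalFiltration_le : N.naturalFiltration ≤ N.filtration :=
  le_sup_left.trans (Filtration.le_rightCont N.augmentedFiltration)

theorem measurableSet_jumpTime_le {s t : ℝ≥0} (hst : s ≤ t) (n : ℕ) :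
    MeasurableSet[N.naturalFiltration t] {ω | N.jumpTime n ω ≤ s} := by
  have h1 : MeasurableSpace.comap (N.count s) inferInstance ≤ N.naturalFiltration t :=
    le_iSup₂_of_le (f := fun (j : ℝ≥0) (_ : j ≤ t) =>
      MeasurableSpace.comap (N.count j) inferInstance) s hst le_rfl
  refine h1 _ ⟨Ici n, measurableSet_Ici, ?_⟩
  ext ω
  exact N.le_count_iff s.coe_nonneg n ω

theorem measurable_truncGaps (t : ℝ≥0) :
    Measurable[N.naturalFiltration t] fun ω => truncGaps t (N.gaps ω) := by
  have key : ∀ n, Measurable[N.naturalFiltration t] fun ω => truncArrival t (N.gaps ω) n := by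
    intro n
    refine @measurable_of_Iic _ _ _ _ _ (N.naturalFiltration t) _ _ _ _ fun c => ?_
    rcases lt_or_ge c (t + n) with hc | hc
    · have e : (fun ω => truncArrival t (N.gaps ω) n) ⁻¹' Iic c =
          {ω | N.jumpTime n ω ≤ min c t} := by
        ext ω
        simp only [mem_preimage, mem_Iic, truncArrival, mem_ofPred_eq, le_min_iff, ← arrival_gaps]
        by_cases h : arrival (N.gaps ω) n ≤ t
        · rw [if_pos h]
          exact ⟨fun h' => ⟨h', h⟩, fun h' => h'.1⟩
        · rw [if_neg h]
          exact ⟨fun h' => absurd h' (not_le.2 hc), fun h' => absurd h'.2 h⟩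
      rw [e]
      rcases lt_or_ge (min c t) 0 with hneg | hnn
      · have : {ω | N.jumpTime n ω ≤ min c t} = ∅ := by
          ext ω
          simp only [mem_ofPred_eq, mem_empty_iff_false, iff_false, not_le]
          exact hneg.trans_le ((N.regular_gaps ω).arrival_nonneg n)
        rw [this]
        exact @MeasurableSet.empty _ (N.naturalFiltration t)
      · have := N.measurableSet_jumpTime_le (s := (min c t).toNNReal) (t := t)
          (Real.toNNReal_le_iff_le_coe.2 (min_le_right _ _)) n
        rwa [Real.coe_toNNReal _ hnn] at this
    · have e : (fun ω => truncArrival t (N.gaps ω) n) ⁻¹' Iic c = univ := by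
        refine eq_univ_of_forall fun ω => ?_
        simp only [mem_preimage, mem_Iic, truncArrival]
        split_ifs with h
        · exact h.trans (le_trans (by linarith [n.cast_nonneg (α := ℝ)]) hc)
        · exact hc
      rw [e]
      exact @MeasurableSet.univ _ (N.naturalFiltration t)
  exact @measurable_pi_lambda _ _ _ (N.naturalFiltration t) _ _ fun n => (key (n + 1)).sub (key n)

/-- An adapted time on the space of interarrival times is a stopping time. -/
theorem isStoppingTime_comp_gaps {T : (ℕ → ℝ) → ℝ≥0∞} (hT : Measurable T) (hTa : PathAdapted T) :
    IsStoppingTime N.filtration fun ω => (T (N.gaps ω) : WithTop ℝ≥0) := by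
  intro t
  refine N.naturalFiltration_le t _ ?_
  -- The true and the truncated sequence agree up to `t`, so adaptedness decides `T ≤ t` from the
  -- truncated one, which is measurable at time `t`.
  have e : {ω | (T (N.gaps ω) : WithTop ℝ≥0) ≤ t} =
      (fun ω => truncGaps t (N.gaps ω)) ⁻¹' {a | T a ≤ ENNReal.ofReal t} := by
    ext ω
    have hr := N.regular_gaps ω
    have hr' := hr.truncGaps t.coe_nonneg
    have hag := agree_truncGaps t.coe_nonneg (N.gaps ω)
    have h0 : (T (N.gaps ω) : WithTop ℝ≥0) ≤ t ↔ T (N.gaps ω) ≤ ENNReal.ofReal t := by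
      rw [ENNReal.ofReal_coe_nnreal]
    exact h0.trans ⟨hTa _ _ hr hr' _ t.coe_nonneg hag, hTa _ _ hr' hr _ t.coe_nonneg hag.symm⟩
  have hm := N.measurable_truncGaps t
    (measurableSet_le hT (measurable_const (a := ENNReal.ofReal t)))
  rw [← e] at hm
  exact hm

theorem isStoppingTime_jumpTime (n : ℕ) : IsStoppingTime N.filtration
    fun ω => ((N.jumpTime n ω).toNNReal : WithTop ℝ≥0) := by
  intro t
  refine N.naturalFiltration_le t _ ?_
  convert N.measurableSet_jumpTime_le (le_refl t) n using 1
  ext ω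
  exact WithTop.coe_le_coe.trans Real.toNNReal_le_iff_le_coe

/-- The events that agree, up to a null set, with an event that depends only on the arrivals up to
the time `q`. -/
@[reducible]
def agreeSpace (q : ℝ) : MeasurableSpace Ω where
  MeasurableSet' A := ∃ B : Set (ℕ → ℝ), MeasurableSet B ∧
    (∀ a a', Regular a → Regular a' → Agree q a a' → a ∈ B → a' ∈ B) ∧ A =ᵐ[P] N.gaps ⁻¹' B
  measurableSet_empty := ⟨∅, MeasurableSet.empty, fun _ _ _ _ _ h => h, by simp⟩
  measurableSet_compl := by
    rintro A ⟨B, hB, hsat, hAB⟩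
    exact ⟨Bᶜ, hB.compl, fun a a' ha ha' hag h h' => h (hsat _ _ ha' ha hag.symm h'), hAB.compl⟩
  measurableSet_iUnion := by
    intro A hA
    choose B hB hsat hAB using hA
    refine ⟨⋃ i, B i, MeasurableSet.iUnion hB, fun a a' ha ha' hag h => ?_, ?_⟩
    · obtain ⟨i, hi⟩ := mem_iUnion.1 h
      exact mem_iUnion.2 ⟨i, hsat i _ _ ha ha' hag hi⟩
    · rw [preimage_iUnion]
      exact Filter.EventuallyEq.countable_iUnion hAB

/-- It suffices to test generators: the counts by time `j ≤ q` depend on arrivals up to `q`, and a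
null event is represented by the empty set. -/
theorem augmentedFiltration_le_agreeSpace (q : ℝ≥0) :
    N.augmentedFiltration q ≤ N.agreeSpace q := by
  refine sup_le (iSup₂_le fun j hj => ?_) (MeasurableSpace.generateFrom_le fun A hA => ?_)
  · refine Measurable.comap_le ?_
    refine @measurable_of_Ici _ _ _ _ _ (N.agreeSpace q) _ _ _ _ fun n => ?_
    refine ⟨{a | arrival a n ≤ j}, measurableSet_le (measurable_arrival n) measurable_const,
      fun a a' _ _ hag h => ?_, ?_⟩
    · rcases hag n with h1 | h1
      · exact (h1.ge.trans h : arrival a' n ≤ j)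
      · exact absurd (h1.1.trans_le h) (not_lt.2 (NNReal.coe_le_coe.2 hj))
    · refine Eq.eventuallyEq ?_
      ext ω
      exact N.le_count_iff j.coe_nonneg n ω
  · exact ⟨∅, MeasurableSet.empty, fun _ _ _ _ _ h => h, by
      rw [preimage_empty]; exact ae_eq_empty.2 hA.2⟩

/-- The strict inequality leaves room to absorb the right limit of the filtration: each `{τ ≤ s}`
with `s < q` is already known at `q`. -/
theorem measurableSet_lt_of_isStoppingTime {τ : Ω → ℝ≥0∞}
    (hτ : IsStoppingTime N.filtration (fun ω => (τ ω : WithTop ℝ≥0))) (q : ℝ≥0) :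
    MeasurableSet[N.augmentedFiltration q] {ω | τ ω < q} := by
  have e : {ω | τ ω < q} = ⋃ s : ℚ, ⋃ _ : Real.toNNReal s < q, {ω | τ ω ≤ Real.toNNReal s} := by
    ext ω
    simp only [mem_ofPred_eq, mem_iUnion, exists_prop]
    constructor
    · intro h
      obtain ⟨s, _, h1, h2⟩ := ENNReal.lt_iff_exists_rat_btwn.1 h
      exact ⟨s, by exact_mod_cast h2, h1.le⟩
    · rintro ⟨s, h1, h2⟩
      exact h2.trans_lt (by exact_mod_cast h1)
  rw [e]
  refine MeasurableSet.iUnion fun s => MeasurableSet.iUnion fun hs => ?_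
  have h1 := hτ (Real.toNNReal s)
  rw [filtration_eq, Filtration.rightCont_eq] at h1
  exact (iInf₂_le (f := fun (j : ℝ≥0) (_ : j > Real.toNNReal s) => N.augmentedFiltration j) q hs) _ h1

/-- A stopping time is almost surely an adapted function of the interarrival times. -/
theorem exists_pathAdapted {τ : Ω → ℝ≥0∞}
    (hτ : IsStoppingTime N.filtration (fun ω => (τ ω : WithTop ℝ≥0))) :
    ∃ T : (ℕ → ℝ) → ℝ≥0∞, Measurable T ∧ PathAdapted T ∧ ∀ᵐ ω ∂P, T (N.gaps ω) = τ ω := by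
  classical
  have h := fun q : ℚ => N.augmentedFiltration_le_agreeSpace (Real.toNNReal q) _
    (N.measurableSet_lt_of_isStoppingTime hτ (Real.toNNReal q))
  choose B hB hsat hae using h
  -- The time is rebuilt from representatives of the events `{τ < q}` for rational `q`, so only
  -- countably many null sets are discarded.
  refine ⟨fun a => ⨅ q : ℚ, if a ∈ B q then (Real.toNNReal q : ℝ≥0∞) else ∞, ?_, ?_, ?_⟩
  · exact Measurable.iInf fun q => Measurable.ite (hB q) measurable_const measurable_const
  · intro a a' ha ha' t ht hag hle
    obtain ⟨u, hu, hag'⟩ := hag.exists_gt ha ha'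
    refine le_of_forall_gt fun c hc => ?_
    have hu' : ENNReal.ofReal t < ENNReal.ofReal u :=
      (ENNReal.ofReal_lt_ofReal_iff (ht.trans_lt hu)).2 hu
    obtain ⟨q, hq⟩ := iInf_lt_iff.1 (hle.trans_lt (lt_min hc hu'))
    split_ifs at hq with hmem
    · have hqu : ((Real.toNNReal q : ℝ≥0) : ℝ) ≤ u := by
        have := ENNReal.coe_lt_coe.1 (hq.trans_le (min_le_right _ _))
        exact (Real.lt_toNNReal_iff_coe_lt.1 this).le
      refine (iInf_le _ q).trans_lt ?_
      rw [if_pos (hsat q a a' ha ha' (hag'.mono hqu) hmem)]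
      exact hq.trans_le (min_le_left _ _)
    · exact absurd hq not_top_lt
  · have hall : ∀ᵐ ω ∂P, ∀ q : ℚ, τ ω < Real.toNNReal q ↔ N.gaps ω ∈ B q :=
      ae_all_iff.2 fun q => (hae q).mem_iff
    filter_upwards [hall] with ω hω
    refine le_antisymm (le_of_forall_gt fun c hc => ?_) (le_iInf fun q => ?_)
    · obtain ⟨q, _, h1, h2⟩ := ENNReal.lt_iff_exists_rat_btwn.1 hc
      refine (iInf_le _ q).trans_lt ?_
      rwa [if_pos ((hω q).1 h1)]
    · split_ifs with h1
      · exact ((hω q).2 h1).le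
      · exact le_top

end PoissonProcess

/-! ### The value functions -/

namespace Params

variable (M : Params)

theorem legCost_gNeg_le {p : ℝ × ℝ} (hp : p ∈ quadrant) (T : ℝ≥0∞) {s : ℝ} (hs : 0 ≤ s) :
    M.legCost M.gNeg p T s ≤ ENNReal.ofReal (M.kap * (1 - Real.exp (-M.lam * s))) := by
  have hl := M.lam_pos
  have hk := M.kap_pos
  have hint : IntegrableOn (fun u => M.kap * (M.lam * Real.exp (-M.lam * u)))
      (Ico 0 (min T (ENNReal.ofReal s)).toReal) :=
    ((by fun_prop : Continuous fun u => M.kap * (M.lam * Real.exp (-M.lam * u))).integrableOn_Icc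
      ).mono_set Ico_subset_Icc_self
  have h1 : M.legCost M.gNeg p T s ≤ ∫⁻ u in Ico 0 (min T (ENNReal.ofReal s)).toReal,
      ENNReal.ofReal (M.kap * (M.lam * Real.exp (-M.lam * u))) := by
    rw [legCost_gNeg]
    refine setLIntegral_mono (by fun_prop) fun u hu => ENNReal.ofReal_le_ofReal ?_
    nlinarith [M.neg_le_g (M.flow_mem hp hu.1), Real.exp_pos (-M.lam * u)]
  rw [← ofReal_integral_eq_lintegral_ofReal hint
    (Eventually.of_forall fun u => by positivity),
    Measure.restrict_congr_set Ico_ae_eq_Ioc, ← intervalIntegral.integral_of_le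
    (stepTime_nonneg _ _), intervalIntegral.integral_const_mul, integral_discount] at h1
  refine h1.trans (ENNReal.ofReal_le_ofReal (mul_le_mul_of_nonneg_left ?_ hk.le))
  have : Real.exp (-M.lam * s) ≤ Real.exp (-M.lam * (min T (ENNReal.ofReal s)).toReal) :=
    Real.exp_le_exp.2 (by nlinarith [stepTime_le T hs])
  linarith

/-- The same self-reproducing bound as for one step. Its uniformity in the number of jumps keeps the
negative part of every cost finite. -/
theorem pathCost_gNeg_le (n : ℕ) {p : ℝ × ℝ} (hp : p ∈ quadrant) {a : ℕ → ℝ} (ha : Regular a)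
    (T : ℝ≥0∞) : M.pathCost M.gNeg n p a T ≤ ENNReal.ofReal M.kap := by
  induction n generalizing p a T with
  | zero => exact zero_le
  | succ n ih =>
    have ha0 := (ha.1 0).le
    have hk := M.kap_pos
    have he := M.exp_le_one_of_nonneg ha0
    refine (add_le_add (M.legCost_gNeg_le hp T ha0) (mul_le_mul_right
      (ih (M.jump_mem (M.flow_mem hp ha0)) ha.shift _) _)).trans (le_of_eq ?_)
    rw [← ENNReal.ofReal_mul (Real.exp_pos _).le, ← ENNReal.ofReal_add
      (mul_nonneg hk.le (by linarith)) (by positivity)]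
    congr 1; ring

theorem pathCost_mono (h : ℝ × ℝ → ℝ≥0∞) {a : ℕ → ℝ} (ha : Regular a) (p : ℝ × ℝ) (T : ℝ≥0∞)
    {m n : ℕ} (hmn : m ≤ n) : M.pathCost h m p a T ≤ M.pathCost h n p a T := by
  rw [M.pathCost_eq h m ha, M.pathCost_eq h n ha]
  exact lintegral_mono_set fun t ht => ⟨ht.1, ht.2.1, ht.2.2.trans_le (ha.arrival_mono hmn)⟩

section Jumps

variable {Ω : Type*} [MeasurableSpace Ω] {P : Measure Ω} (N : PoissonProcess P M.mu)

theorem postJump_eq (p : ℝ × ℝ) (n : ℕ) (ω : Ω) : M.postJump N p n ω = M.post p (N.gaps ω) n := by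
  induction n with
  | zero => rfl
  | succ n ih => rw [postJump, ih]; rfl

theorem Phi_eq (p : ℝ × ℝ) (t : ℝ) (ω : Ω) : M.Phi N p t ω = M.path p (N.gaps ω) t := by
  unfold Phi
  rw [postJump_eq]
  rfl

theorem ofReal_running (p : ℝ × ℝ) (t : ℝ) :
    ENNReal.ofReal (Real.exp (-M.lam * t) * M.g p) =
      ENNReal.ofReal (Real.exp (-M.lam * t)) * M.gPos p :=
  ENNReal.ofReal_mul (Real.exp_pos _).le

theorem ofReal_neg_running (p : ℝ × ℝ) (t : ℝ) :
    ENNReal.ofReal (-(Real.exp (-M.lam * t) * M.g p)) =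
      ENNReal.ofReal (Real.exp (-M.lam * t)) * M.gNeg p := by
  rw [← mul_neg]; exact ENNReal.ofReal_mul (Real.exp_pos _).le

/-- The closing `rfl` uses that `ℝ≥0∞` is by definition `WithTop ℝ≥0`. -/
theorem cost_eq (p : ℝ × ℝ) (τ : Ω → ℝ≥0∞) : M.cost N p τ =
    ((∫⁻ ω, ⨆ n, M.pathCost M.gPos n p (N.gaps ω) (τ ω) ∂P : ℝ≥0∞) : EReal) -
      ((∫⁻ ω, ⨆ n, M.pathCost M.gNeg n p (N.gaps ω) (τ ω) ∂P : ℝ≥0∞) : EReal) := by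
  simp only [M.iSup_pathCost _ (N.regular_gaps _), ← ofReal_running, ← ofReal_neg_running,
    ← Phi_eq]
  rfl

theorem cost_min_eq (p : ℝ × ℝ) (τ : Ω → ℝ≥0∞) (n : ℕ) :
    M.cost N p (fun ω => min (τ ω : WithTop ℝ≥0) ((N.jumpTime n ω).toNNReal : WithTop ℝ≥0)) =
    ((∫⁻ ω, M.pathCost M.gPos n p (N.gaps ω) (τ ω) ∂P : ℝ≥0∞) : EReal) -
      ((∫⁻ ω, M.pathCost M.gNeg n p (N.gaps ω) (τ ω) ∂P : ℝ≥0∞) : EReal) := by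
  have e : ∀ (ω : Ω) (s : WithTop ℝ≥0), {t : ℝ | 0 ≤ t ∧ (t.toNNReal : WithTop ℝ≥0) <
      min s ((N.jumpTime n ω).toNNReal : WithTop ℝ≥0)} =
      {t : ℝ | 0 ≤ t ∧ (t.toNNReal : WithTop ℝ≥0) < s ∧ t < arrival (N.gaps ω) n} := by
    intro ω s
    ext t
    refine and_congr_right fun ht => ?_
    rw [lt_min_iff]
    refine and_congr_right fun _ => ?_
    rw [WithTop.coe_lt_coe, Real.lt_toNNReal_iff_coe_lt, Real.coe_toNNReal _ ht]
    rfl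
  simp only [M.pathCost_eq _ n (N.regular_gaps _), ← ofReal_running, ← ofReal_neg_running,
    ← Phi_eq]
  exact congrArg₂ (fun X Y : ℝ≥0∞ => (X : EReal) - (Y : EReal))
    (lintegral_congr fun ω => congrArg (fun S => ∫⁻ t in S,
      ENNReal.ofReal (Real.exp (-M.lam * t) * M.g (M.Phi N p t ω))) (e ω (τ ω)))
    (lintegral_congr fun ω => congrArg (fun S => ∫⁻ t in S,
      ENNReal.ofReal (-(Real.exp (-M.lam * t) * M.g (M.Phi N p t ω)))) (e ω (τ ω)))

theorem coe_eq_coe_toReal {X : ℝ≥0∞} (hX : X ≠ ∞) : (X : EReal) = ((X.toReal : ℝ) : EReal) := by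
  lift X to ℝ≥0 using hX
  rfl

theorem lintegral_comp_gaps {F : (ℕ → ℝ) → ℝ≥0∞} (hF : Measurable F) :
    ∫⁻ ω, F (N.gaps ω) ∂P = ∫⁻ a, F a ∂seqLaw M.mu := by
  rw [← N.map_gaps, lintegral_map hF N.measurable_gaps]

/-- The value function is bounded from below by each limit of lower bounds `v_n`. -/
theorem v_le_V {p : ℝ × ℝ} (hp : p ∈ quadrant) : (M.v N p : EReal) ≤ M.V N p := by
  refine le_iInf₂ fun τ hτ => ?_
  obtain ⟨T, hT, hTa, hae⟩ := N.exists_pathAdapted (τ := τ) hτ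
  have hm : ∀ (h : ℝ × ℝ → ℝ≥0∞), Measurable h → ∀ n,
      Measurable fun a => M.pathCost h n p a (T a) := fun h hh n =>
    M.measurable_pathCost hh n measurable_const measurable_id hT
  have hcost : ∀ (h : ℝ × ℝ → ℝ≥0∞), Measurable h →
      ∫⁻ ω, ⨆ n, M.pathCost h n p (N.gaps ω) (τ ω) ∂P =
        ∫⁻ a, ⨆ n, M.pathCost h n p a (T a) ∂seqLaw M.mu := by
    intro h hh
    rw [← M.lintegral_comp_gaps N (F := fun a => ⨆ n, M.pathCost h n p a (T a))
      (Measurable.iSup (hm h hh))]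
    exact lintegral_congr_ae (hae.mono fun ω hω => by simp only [hω])
  rw [M.cost_eq N p τ, hcost _ M.measurable_gPos, hcost _ M.measurable_gNeg]
  set X := ∫⁻ a, ⨆ n, M.pathCost M.gPos n p a (T a) ∂seqLaw M.mu with hX
  set Y := ∫⁻ a, ⨆ n, M.pathCost M.gNeg n p a (T a) ∂seqLaw M.mu with hY
  have hYle : Y ≤ ENNReal.ofReal M.kap := by
    refine (lintegral_mono_ae (N.ae_regular.mono fun a ha =>
      iSup_le fun n => M.pathCost_gNeg_le n hp ha (T a))).trans ?_
    rw [lintegral_const, measure_univ, mul_one]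
  have hYfin : Y ≠ ∞ := ne_top_of_le_ne_top ENNReal.ofReal_ne_top hYle
  have hYX : Y ≤ X + ENNReal.ofReal (-M.v N p) := by
    rw [hY, lintegral_iSup_ae (fun n => hm _ M.measurable_gNeg n)
      (fun n => N.ae_regular.mono fun a ha => M.pathCost_mono _ ha p _ n.le_succ)]
    refine iSup_le fun n => (M.lintegral_pathCost_lower N n hp hT hTa).trans (add_le_add ?_ ?_)
    · exact lintegral_mono fun a => le_iSup (fun n => M.pathCost M.gPos n p a (T a)) n
    · exact ENNReal.ofReal_le_ofReal (neg_le_neg (M.v_le_vn N n hp))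
  -- The negative part is finite, so an infinite positive part makes the cost `∞` and the bound
  -- trivial.
  by_cases hXfin : X = ∞
  · rw [hXfin, coe_eq_coe_toReal hYfin]
    simp
  · rw [coe_eq_coe_toReal hXfin, coe_eq_coe_toReal hYfin, ← EReal.coe_sub, EReal.coe_le_coe_iff]
    have hv : M.v N p ≤ 0 := M.v_le_vn N 0 hp
    have h1 := ENNReal.toReal_mono (ENNReal.add_ne_top.2 ⟨hXfin, ENNReal.ofReal_ne_top⟩) hYX
    rw [ENNReal.toReal_add hXfin ENNReal.ofReal_ne_top,
      ENNReal.toReal_ofReal (neg_nonneg.2 hv)] at h1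
    linarith

theorem V_le_Vn (n : ℕ) (p : ℝ × ℝ) : M.V N p ≤ M.Vn N n p :=
  le_iInf₂ fun τ hτ => iInf₂_le (fun ω => min (τ ω) ((N.jumpTime n ω).toNNReal : WithTop ℝ≥0))
    (hτ.min (N.isStoppingTime_jumpTime n))

theorem Vn_le_vn (n : ℕ) {p : ℝ × ℝ} (hp : p ∈ quadrant) : M.Vn N n p ≤ (M.vn N n p : EReal) := by
  have key : ∀ ε : ℝ, 0 < ε → M.Vn N n p ≤ ((M.vn N n p + n * ε : ℝ) : EReal) := by
    intro ε hε
    have hR := fun k => M.exists_measurable_time N (M.adm_vn N k) hε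
    choose R hRm hRJ using hR
    have hS : Measurable (M.strategy R n p) :=
      M.measurable_strategy hRm n measurable_const measurable_id
    refine (iInf₂_le _ (N.isStoppingTime_comp_gaps hS (M.pathAdapted_strategy R n p))).trans ?_
    rw [M.cost_min_eq N p (fun ω => M.strategy R n p (N.gaps ω)) n]
    have hm : ∀ (h : ℝ × ℝ → ℝ≥0∞), Measurable h →
        Measurable fun a => M.pathCost h n p a (M.strategy R n p a) := fun h hh =>
      M.measurable_pathCost hh n measurable_const measurable_id hS
    rw [M.lintegral_comp_gaps N (hm _ M.measurable_gPos),
      M.lintegral_comp_gaps N (hm _ M.measurable_gNeg)]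
    have hXY := M.lintegral_pathCost_upper N hRm hRJ n hp
    set X := ∫⁻ a, M.pathCost M.gPos n p a (M.strategy R n p a) ∂seqLaw M.mu
    set Y := ∫⁻ a, M.pathCost M.gNeg n p a (M.strategy R n p a) ∂seqLaw M.mu with hY
    have hYle : Y ≤ ENNReal.ofReal M.kap := by
      refine (lintegral_mono_ae (N.ae_regular.mono fun a ha =>
        M.pathCost_gNeg_le n hp ha (M.strategy R n p a))).trans ?_
      rw [lintegral_const, measure_univ, mul_one]
    have hYfin : Y ≠ ∞ := ne_top_of_le_ne_top ENNReal.ofReal_ne_top hYle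
    have hfin : (n : ℝ≥0∞) * ENNReal.ofReal ε ≠ ∞ :=
      ENNReal.mul_ne_top (ENNReal.natCast_ne_top n) ENNReal.ofReal_ne_top
    have hXfin : X ≠ ∞ :=
      ne_top_of_le_ne_top (ENNReal.add_ne_top.2 ⟨hYfin, hfin⟩) (le_self_add.trans hXY)
    rw [coe_eq_coe_toReal hXfin, coe_eq_coe_toReal hYfin, ← EReal.coe_sub, EReal.coe_le_coe_iff]
    have h1 := ENNReal.toReal_mono (ENNReal.add_ne_top.2 ⟨hYfin, hfin⟩) hXY
    rw [ENNReal.toReal_add hXfin ENNReal.ofReal_ne_top, ENNReal.toReal_add hYfin hfin,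
      ENNReal.toReal_ofReal (neg_nonneg.2 ((M.adm_vn N n).ub p hp)), ENNReal.toReal_mul,
      ENNReal.toReal_natCast, ENNReal.toReal_ofReal hε.le] at h1
    linarith
  refine EReal.le_of_forall_lt_iff_le.1 fun z hz => ?_
  have hz' : M.vn N n p < z := EReal.coe_lt_coe_iff.1 hz
  have hn : (0 : ℝ) < n + 1 := by positivity
  -- Dividing by `n + 1` keeps `n ε` below the gap and also covers `n = 0`.
  refine (key ((z - M.vn N n p) / (n + 1)) (div_pos (by linarith) hn)).trans ?_
  rw [EReal.coe_le_coe_iff]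
  have : n * ((z - M.vn N n p) / (n + 1)) ≤ z - M.vn N n p := by
    rw [mul_div_assoc', div_le_iff₀ hn]
    nlinarith
  linarith

/-- The chain `v ≤ V ≤ V_k ≤ v_k` collapses because its ends are equal here; no separate proof of
`V_k ≥ v_k` is required. -/
theorem V_eq_of_mem_preim (hclosed : M.FlowClosed N) {n k : ℕ} (hk : n ≤ k) {p : ℝ × ℝ}
    (hpq : p ∈ quadrant) (hp : p ∈ M.preim n (M.Gamma N)) :
    M.V N p = M.Vn N k p ∧ M.V N p = (M.vn N k p : EReal) := by
  have h1 := M.v_le_V N hpq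
  have h2 := M.V_le_Vn N k p
  have h3 := M.Vn_le_vn N k hpq
  rw [M.v_eq_of_mem_preim N hclosed hk hpq hp] at h1
  exact ⟨le_antisymm h2 (h3.trans h1), le_antisymm (h2.trans h3) h1⟩

end Jumps

end Params

end PoissonDisorder

/-! ### Assembly of the three claims -/

theorem proposition8p3 {Ω : Type*} [MeasurableSpace Ω] (P : Measure Ω) [IsProbabilityMeasure P]
    (M : PoissonDisorder.Params) (N : PoissonDisorder.PoissonProcess P M.mu)
    (hclosed : M.FlowClosed N) :
    -- the value functions and the regions agree on `S^{-n}(Γ)`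
    (∀ n : ℕ, 1 ≤ n → ∀ k : ℕ, n ≤ k →
      (∀ p ∈ M.preim n (M.Gamma N), M.V N p = M.Vn N k p) ∧
      M.preim n (M.Gamma N) ∩ M.Gamma N = M.preim n (M.Gamma N) ∩ M.Gamman N k ∧
      M.preim n (M.Gamma N) ∩ M.C N = M.preim n (M.Gamma N) ∩ M.Cn N k) ∧
    -- the boundary functions agree on `[0, x_n]`
    (∀ n : ℕ, 1 ≤ n → ∃ xn : ℝ, 0 < xn ∧ M.IsFirstCrossing n (M.gamma N) xn ∧
      (∀ k : ℕ, n ≤ k →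
        M.IsFirstCrossing n (M.gamman N k) xn ∧
        M.preim n (M.Gamma N) ∩ M.C N ∩ (Icc 0 xn ×ˢ Ici 0) =
          M.preim n (M.Gamman N k) ∩ M.Cn N k ∩ (Icc 0 xn ×ˢ Ici 0) ∧
        ∀ x ∈ Icc 0 xn, M.gamma N x = M.gamman N k x) ∧
      ∀ p ∈ M.preim n (M.Gamman N n) ∩ M.Cn N n ∩ (Icc 0 xn ×ˢ Ici 0),
        M.V N p = M.Vn N n p) ∧
    -- `V` and `C` are found on `ℝ₊ × [B, ∞)` after finitely many iterations
    (∀ B : ℝ, 0 < B →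
      (∃ n : ℕ, 1 ≤ n ∧ (M.mu / (M.mu + 1)) ^ n * M.gamman N 1 0 < B) ∧
      ∀ n : ℕ, 1 ≤ n → (M.mu / (M.mu + 1)) ^ n * M.gamman N 1 0 < B →
        ∀ k : ℕ, n ≤ k →
          (∀ p ∈ Ici (0 : ℝ) ×ˢ Ici B, M.V N p = M.Vn N k p ∧ M.V N p = (M.vn N k p : EReal)) ∧
          (Ici (0 : ℝ) ×ˢ Ici B) ∩ M.C N = (Ici (0 : ℝ) ×ˢ Ici B) ∩ M.Cn N k) := by 
  have hG := M.isUpRegion_Gamma N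
  have hquad : ∀ n, ∀ p ∈ M.preim n (M.Gamma N), p ∈ PoissonDisorder.quadrant := fun n p hp =>
    ((M.mem_preim hG.sub n p).1 hp).1
  refine ⟨fun n _ k hk => ⟨fun p hp => (M.V_eq_of_mem_preim N hclosed hk (hquad n p hp) hp).1,
    M.preim_inter_Gamma N hclosed hk, M.preim_inter_C N hclosed hk⟩, fun n hn => ?_,
    fun B hB => ⟨?_, fun n _ hlt k hk => ?_⟩⟩
  · obtain ⟨x₀, hx₀, hcross, hlt⟩ := M.exists_isFirstCrossing hG hn
    have hb : 0 < (1 - 1 / M.mu) ^ n := pow_pos (by linarith [M.inv_mu_lt_one]) n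
    have hb1 : (1 - 1 / M.mu) ^ n ≤ 1 :=
      pow_le_one₀ (by linarith [M.inv_mu_lt_one]) (by linarith [M.inv_mu_pos])
    have ha : 0 < (1 + 1 / M.mu) ^ n := pow_pos (by linarith [M.inv_mu_pos]) n
    have hbd : ∀ k, n ≤ k → ∀ x ∈ Icc 0 x₀, M.gamma N x = M.gamman N k x := fun k hk =>
      M.boundary_eq_of_inter_eq hG (M.isUpRegion_Gamman N (hn.trans hk))
        (M.Gamma_subset_Gamman N k) (M.preim_inter_Gamma N hclosed hk) hx₀ hlt
    have hmem : ∀ k, n ≤ k → ∀ x ∈ Icc 0 x₀, ∀ y, 0 ≤ y →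
        ((x, y) ∈ M.Gamma N ↔ (x, y) ∈ M.Gamman N k) := fun k hk x hx y hy => by
      rw [hG.mem_iff hx.1 hy, (M.isUpRegion_Gamman N (hn.trans hk)).mem_iff hx.1 hy]
      exact iff_of_eq (congrArg (· ≤ y) (hbd k hk x hx))
    have hset : ∀ k, n ≤ k → M.preim n (M.Gamma N) ∩ M.C N ∩ (Icc 0 x₀ ×ˢ Ici 0) =
        M.preim n (M.Gamman N k) ∩ M.Cn N k ∩ (Icc 0 x₀ ×ˢ Ici 0) := by
      intro k hk
      ext ⟨x, y⟩
      refine and_congr_left fun hxy => ?_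
      have hx : x ∈ Icc 0 x₀ := hxy.1
      have hy : 0 ≤ y := hxy.2
      -- Membership in either preimage is membership of `S^n (x, y)` in the region, and its first
      -- coordinate is again in `[0, x₀]`, where the two boundaries coincide.
      refine and_congr ?_ (and_congr_right fun _ => not_congr (hmem k hk x hx y hy))
      rw [M.mem_preim hG.sub, M.mem_preim (M.isUpRegion_Gamman N (hn.trans hk)).sub]
      refine and_congr_right fun _ => hmem k hk _ ⟨mul_nonneg hb.le hx.1, ?_⟩ _
        (mul_nonneg ha.le hy)
      exact (mul_le_of_le_one_left hx.1 hb1).trans hx.2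
    refine ⟨x₀, hx₀, hcross, fun k hk => ⟨?_, hset k hk, hbd k hk⟩, fun p hp => ?_⟩
    · exact M.isFirstCrossing_congr (PoissonDisorder.boundary_nonneg _)
        (PoissonDisorder.boundary_nonneg _) hcross (hbd k hk)
    -- Over `[0, x₀]` the set built from `Γ_n` is the one built from `Γ`, on which the squeeze
    -- applies.
    · rw [← hset n le_rfl] at hp
      exact (M.V_eq_of_mem_preim N hclosed le_rfl (hquad n p hp.1.1) hp.1.1).1
  · have hm := M.mu_pos
    have hlim : Tendsto (fun n => (M.mu / (M.mu + 1)) ^ n * M.gamman N 1 0) atTop (𝓝 0) := by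
      have := (tendsto_pow_atTop_nhds_zero_of_lt_one (r := M.mu / (M.mu + 1)) (by positivity)
        ((div_lt_one (by positivity)).2 (by linarith))).mul_const (M.gamman N 1 0)
      rwa [zero_mul] at this
    exact ((eventually_ge_atTop 1).and (hlim.eventually_lt_const hB)).exists
  · have hsub := M.strip_subset_preim N hclosed hB hlt
    refine ⟨fun p hp => M.V_eq_of_mem_preim N hclosed hk (hquad n p (hsub hp)) (hsub hp), ?_⟩
    have hC := M.preim_inter_C N hclosed hk
    rw [← inter_eq_self_of_subset_left hsub, inter_assoc, hC, inter_assoc]
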